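/- **Definitions.** An *$\infty$-cosmos* is a (locally small) simplicially enriched category $\mathcal K$ whose hom simplicial sets $\mathrm{Fun}(A,B)$ are quasi-categories, together with a specified subcategory of *isofibrations* (written $\twoheadrightarrow$), such that: (a) as a simplicially enriched category, $\mathcal K$ has a terminal object, small products, cotensors $A^U$ of objects $A$ by small simplicial sets $U$, limits of countable towers $\cdots\twoheadrightarrow A_1\twoheadrightarrow A_0$ of isofibrations, and pullbacks of isofibrations along arbitrary maps; (b) the isofibrations contain all isomorphisms and all maps to a terminal object; they are stable under pullback along arbitrary maps and under small products; the legs of the limit cone of a countable tower of isofibrations are isofibrations; if $p\colon E\twoheadrightarrow B$ is an isofibration and $i\colon U\hookrightarrow V$ is a monomorphism of simplicial sets, then the induced map $E^V\to E^U\times_{B^U}B^V$ is an isofibration; and for every object $X$ and isofibration $p\colon E\twoheadrightarrow B$ the map $\mathrm{Fun}(X,p)\colon \mathrm{Fun}(X,E)\to\mathrm{Fun}(X,B)$ is an isofibration of quasi-categories, i.e. an inner fibration with the right lifting property against both endpoint inclusions $\mathbb 1\hookrightarrow\mathbb I$ into the nerve of the free-standing isomorphism. A map $f\colon A\to B$ of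 $\mathcal K$ is an *equivalence* if for every object $X$ the map $\mathrm{Fun}(X,f)$ is an equivalence of quasi-categories (it has an inverse up to homotopies parametrised by $\mathbb I$); a *trivial fibration* is an isofibration that is an equivalence. The *cosmological limits* are those listed in (a). **Theorem.** Let $\mathcal K$ be an $\infty$-cosmos. Let $\mathcal K^{\mathbb 2}$ be the simplicially enriched category whose objects are the isofibrations $p\colon E\twoheadrightarrow A$ of $\mathcal K$ and whose functor spaces, for $p\colon E\twoheadrightarrow A$ and $q\colon F\twoheadrightarrow B$, are $$\mathrm{Fun}_{\mathcal K^{\mathbb 2}}(p,q)=\mathrm{Fun}_{\mathcal K}(A,B)\times_{\mathrm{Fun}_{\mathcal K}(E,B)}\mathrm{Fun}_{\mathcal K}(E,F),$$ so that the $0$-arrows $p\to q$ are the commutative squares $(g\colon E\to F,\ f\colon A\to B)$ with $qg=fp$. Call such a square an isofibration if both $f$ and the induced map $E\to A\times_B F$ are isofibrations of $\mathcal K$. Then: 1. $\mathcal K^{\mathbb 2}$ with this class of isofibrations is an $\infty$-cosmos. 2. A square $(g,f)$ is an equivalence in $\mathcal K^{\mathbb 2}$ if and only if $g$ and $f$ are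 equivalences in $\mathcal K$; it is a trivial fibration in $\mathcal K^{\mathbb 2}$ if and only if $f$ and the induced map $E\to A\times_BF$ are trivial fibrations in $\mathcal K$. If $(g,f)$ is an isofibration (resp. a trivial fibration), then so is $g$. 3. The cosmological limits of $\mathcal K^{\mathbb 2}$ (terminal object, small products, limits of towers of isofibrations, pullbacks of isofibrations along arbitrary maps, and cotensors by small simplicial sets) are jointly created by the projections $\mathrm{dom},\mathrm{cod}\colon\mathcal K^{\mathbb 2}\to\mathcal K$: any pair consisting of a limit cone over the domain diagram and a limit cone over the codomain diagram lifts to a unique cone in $\mathcal K^{\mathbb 2}$, and a cone in $\mathcal K^{\mathbb 2}$ is a limit cone if and only if its images under $\mathrm{dom}$ and $\mathrm{cod}$ both are (limits being understood in the simplicially enriched sense). 4. Let $F\colon\mathcal D\to\mathcal K^{\mathbb 2}$ be a diagram of one of the conical cosmological limit types (all of the above except cotensors). Then $F$ has a limit in the simplicially enriched category of all arrows of $\mathcal K$ and commutative squares, this limit is an isofibration of $\mathcal K$ and thus an object of $\mathcal K^{\mathbb 2}$, and the components of the limit cone that (b) requires to be isofibrations (all legs for a tower; the pullback of the given isofibration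 for a pullback) are isofibrations of $\mathcal K^{\mathbb 2}$. -/

import Mathlib

open CategoryTheory MonoidalCategory Limits Opposite

universe w v' v u' u

namespace InfCosmos

/-! ### Enriched hom objects between arrows -/

section ArrowEnrichment

variable (V : Type u') [Category.{v'} V] [MonoidalCategory V]
  {C : Type u} [Category.{v} C] [EnrichedOrdinaryCategory V C]

lemma eId_eHomWhiskerLeft {X Y : C} (f : X ⟶ Y) :
    eId V X ≫ eHomWhiskerLeft V X f = eHomEquiv V f := by
  have h := eHomEquiv_comp V (𝟙 X) f
  simp only [Category.id_comp, eHomEquiv_id] at h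
  rw [h, eHomWhiskerLeft, MonoidalCategory.tensorHom_def, Category.assoc, unitors_inv_equal,
    rightUnitor_inv_naturality_assoc]

lemma eId_eHomWhiskerRight {X Y : C} (f : X ⟶ Y) :
    eId V Y ≫ eHomWhiskerRight V f Y = eHomEquiv V f := by
  have h := eHomEquiv_comp V f (𝟙 Y)
  simp only [Category.comp_id, eHomEquiv_id] at h
  rw [h, eHomWhiskerRight, tensorHom_def', Category.assoc,
    leftUnitor_inv_naturality_assoc]

lemma eHomEquiv_comp_eHomWhiskerLeft {X Y Z : C} (f : X ⟶ Y) (g : Y ⟶ Z) :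
    eHomEquiv V f ≫ eHomWhiskerLeft V X g = eHomEquiv V (f ≫ g) := by
  rw [← eId_eHomWhiskerLeft, ← eId_eHomWhiskerLeft, eHomWhiskerLeft_comp, Category.assoc]

lemma eHomEquiv_comp_eHomWhiskerRight {X Y Z : C} (f : X ⟶ Y) (g : Y ⟶ Z) :
    eHomEquiv V g ≫ eHomWhiskerRight V f Z = eHomEquiv V (f ≫ g) := by
  rw [← eId_eHomWhiskerRight, ← eId_eHomWhiskerRight, eHomWhiskerRight_comp, Category.assoc]

lemma eHomWhiskerRight_whisker_eComp {X Y Y' Z : C} (g : Y ⟶ Y') :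
    (X ⟶[V] Y) ◁ eHomWhiskerRight V g Z ≫ eComp V X Y Z =
      eHomWhiskerLeft V X g ▷ (Y' ⟶[V] Z) ≫ eComp V X Y' Z := by
  dsimp [eHomWhiskerLeft, eHomWhiskerRight]
  simp only [MonoidalCategory.whiskerLeft_comp_assoc, whisker_assoc_symm,
    triangle_assoc_comp_left_inv_assoc, e_assoc', Category.assoc, comp_whiskerRight]

variable [HasPullbacks V]

/-- The object of maps from `p : E ⟶ A` to `q : F ⟶ B`: the pullback of
`Fun(E, q) : Fun(E, F) ⟶ Fun(E, B)` along `Fun(p, B) : Fun(A, B) ⟶ Fun(E, B)`. -/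
noncomputable def arrowHom (p q : Arrow C) : V :=
  pullback (eHomWhiskerLeft V p.left q.hom) (eHomWhiskerRight V p.hom q.right)

/-- The projection of `Fun(p, q)` to `Fun(dom p, dom q)`. -/
noncomputable def arrowHomDom (p q : Arrow C) : arrowHom V p q ⟶ (p.left ⟶[V] q.left) :=
  pullback.fst _ _

/-- The projection of `Fun(p, q)` to `Fun(cod p, cod q)`. -/
noncomputable def arrowHomCod (p q : Arrow C) : arrowHom V p q ⟶ (p.right ⟶[V] q.right) :=
  pullback.snd _ _

lemma arrowHom_isPullback (p q : Arrow C) :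
    IsPullback (arrowHomDom V p q) (arrowHomCod V p q)
      (eHomWhiskerLeft V p.left q.hom) (eHomWhiskerRight V p.hom q.right) :=
  IsPullback.of_hasPullback _ _

lemma arrowHom_condition (p q : Arrow C) :
    arrowHomDom V p q ≫ eHomWhiskerLeft V p.left q.hom =
      arrowHomCod V p q ≫ eHomWhiskerRight V p.hom q.right :=
  (arrowHom_isPullback V p q).w

lemma arrowHom_hom_ext {p q : Arrow C} {W : V} {a b : W ⟶ arrowHom V p q}
    (h₁ : a ≫ arrowHomDom V p q = b ≫ arrowHomDom V p q)
    (h₂ : a ≫ arrowHomCod V p q = b ≫ arrowHomCod V p q) : a = b :=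
  (arrowHom_isPullback V p q).hom_ext h₁ h₂

lemma arrowComp_condition (p q r : Arrow C) :
    ((arrowHomDom V p q ⊗ₘ arrowHomDom V q r) ≫ eComp V p.left q.left r.left) ≫
        eHomWhiskerLeft V p.left r.hom =
      ((arrowHomCod V p q ⊗ₘ arrowHomCod V q r) ≫ eComp V p.right q.right r.right) ≫
        eHomWhiskerRight V p.hom r.right := by
  rw [Category.assoc, Category.assoc, eComp_eHomWhiskerLeft, eComp_eHomWhiskerRight,
    MonoidalCategory.tensorHom_def_assoc, ← MonoidalCategory.whiskerLeft_comp_assoc,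
    arrowHom_condition,
    MonoidalCategory.whiskerLeft_comp_assoc, eHomWhiskerRight_whisker_eComp,
    whisker_exchange_assoc, ← comp_whiskerRight_assoc, arrowHom_condition,
    ← whisker_exchange_assoc, comp_whiskerRight_assoc, MonoidalCategory.tensorHom_def'_assoc]

/-- The identity of the arrow `p`, with components the identities of its domain and codomain. -/
noncomputable def arrowId (p : Arrow C) : 𝟙_ V ⟶ arrowHom V p p :=
  (arrowHom_isPullback V p p).lift (eId V p.left) (eId V p.right)
    (by rw [eId_eHomWhiskerLeft, eId_eHomWhiskerRight])

/-- The composition of maps of arrows, computed on domains and on codomains. -/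
noncomputable def arrowComp (p q r : Arrow C) :
    arrowHom V p q ⊗ arrowHom V q r ⟶ arrowHom V p r :=
  (arrowHom_isPullback V p r).lift
    ((arrowHomDom V p q ⊗ₘ arrowHomDom V q r) ≫ eComp V p.left q.left r.left)
    ((arrowHomCod V p q ⊗ₘ arrowHomCod V q r) ≫ eComp V p.right q.right r.right)
    (arrowComp_condition V p q r)

@[simp]
lemma arrowId_dom (p : Arrow C) : arrowId V p ≫ arrowHomDom V p p = eId V p.left :=
  IsPullback.lift_fst _ _ _ _

@[simp]
lemma arrowId_cod (p : Arrow C) : arrowId V p ≫ arrowHomCod V p p = eId V p.right :=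
  IsPullback.lift_snd _ _ _ _

@[simp]
lemma arrowComp_dom (p q r : Arrow C) : arrowComp V p q r ≫ arrowHomDom V p r =
    (arrowHomDom V p q ⊗ₘ arrowHomDom V q r) ≫ eComp V p.left q.left r.left :=
  IsPullback.lift_fst _ _ _ _

@[simp]
lemma arrowComp_cod (p q r : Arrow C) : arrowComp V p q r ≫ arrowHomCod V p r =
    (arrowHomCod V p q ⊗ₘ arrowHomCod V q r) ≫ eComp V p.right q.right r.right :=
  IsPullback.lift_snd _ _ _ _

/-- Commutative squares from `p` to `q` are the same as global elements of `Fun(p, q)`. -/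
noncomputable def arrowHomEquiv (p q : Arrow C) : (p ⟶ q) ≃ (𝟙_ V ⟶ arrowHom V p q) where
  toFun f := (arrowHom_isPullback V p q).lift (eHomEquiv V f.left) (eHomEquiv V f.right)
    (by rw [eHomEquiv_comp_eHomWhiskerLeft, eHomEquiv_comp_eHomWhiskerRight, Arrow.w])
  invFun a := Arrow.homMk ((eHomEquiv V).symm (a ≫ arrowHomDom V p q))
    ((eHomEquiv V).symm (a ≫ arrowHomCod V p q)) (by
      apply (eHomEquiv V).injective
      rw [← eHomEquiv_comp_eHomWhiskerLeft, ← eHomEquiv_comp_eHomWhiskerRight,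
        Equiv.apply_symm_apply, Equiv.apply_symm_apply, Category.assoc, Category.assoc,
        arrowHom_condition])
  left_inv f := by
    ext
    · simp
    · simp
  right_inv a := arrowHom_hom_ext V (by simp) (by simp)

@[simp]
lemma arrowHomEquiv_dom {p q : Arrow C} (f : p ⟶ q) :
    arrowHomEquiv V p q f ≫ arrowHomDom V p q = eHomEquiv V f.left :=
  IsPullback.lift_fst _ _ _ _

@[simp]
lemma arrowHomEquiv_cod {p q : Arrow C} (f : p ⟶ q) :
    arrowHomEquiv V p q f ≫ arrowHomCod V p q = eHomEquiv V f.right :=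
  IsPullback.lift_snd _ _ _ _

lemma arrow_id_comp (p q : Arrow C) :
    (λ_ (arrowHom V p q)).inv ≫ arrowId V p ▷ _ ≫ arrowComp V p p q = 𝟙 _ := by
  apply arrowHom_hom_ext
  · rw [Category.assoc, Category.assoc, arrowComp_dom, MonoidalCategory.tensorHom_def_assoc,
      ← comp_whiskerRight_assoc, arrowId_dom, ← whisker_exchange_assoc,
      ← leftUnitor_inv_naturality_assoc, e_id_comp, Category.comp_id, Category.id_comp]
  · rw [Category.assoc, Category.assoc, arrowComp_cod, MonoidalCategory.tensorHom_def_assoc,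
      ← comp_whiskerRight_assoc, arrowId_cod, ← whisker_exchange_assoc,
      ← leftUnitor_inv_naturality_assoc, e_id_comp, Category.comp_id, Category.id_comp]

lemma arrow_comp_id (p q : Arrow C) :
    (ρ_ (arrowHom V p q)).inv ≫ _ ◁ arrowId V q ≫ arrowComp V p q q = 𝟙 _ := by
  apply arrowHom_hom_ext
  · rw [Category.assoc, Category.assoc, arrowComp_dom, MonoidalCategory.tensorHom_def'_assoc,
      ← MonoidalCategory.whiskerLeft_comp_assoc, arrowId_dom, whisker_exchange_assoc,
      ← rightUnitor_inv_naturality_assoc, e_comp_id, Category.comp_id, Category.id_comp]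
  · rw [Category.assoc, Category.assoc, arrowComp_cod, MonoidalCategory.tensorHom_def'_assoc,
      ← MonoidalCategory.whiskerLeft_comp_assoc, arrowId_cod, whisker_exchange_assoc,
      ← rightUnitor_inv_naturality_assoc, e_comp_id, Category.comp_id, Category.id_comp]

lemma arrow_assoc (p q r s : Arrow C) :
    (α_ _ _ _).inv ≫ arrowComp V p q r ▷ _ ≫ arrowComp V p r s =
      _ ◁ arrowComp V q r s ≫ arrowComp V p q s := by
  apply arrowHom_hom_ext
  · simp only [Category.assoc, arrowComp_dom]
    rw [← tensorHom_id, ← id_tensorHom, tensorHom_comp_tensorHom_assoc,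
      tensorHom_comp_tensorHom_assoc, arrowComp_dom, arrowComp_dom, Category.id_comp,
      Category.id_comp, ← Category.comp_id (arrowHomDom V r s),
      ← tensorHom_comp_tensorHom_assoc, Category.comp_id,
      ← associator_inv_naturality_assoc, tensorHom_id, e_assoc,
      ← id_tensorHom, tensorHom_comp_tensorHom_assoc, Category.comp_id]
  · simp only [Category.assoc, arrowComp_cod]
    rw [← tensorHom_id, ← id_tensorHom, tensorHom_comp_tensorHom_assoc,
      tensorHom_comp_tensorHom_assoc, arrowComp_cod, arrowComp_cod, Category.id_comp,
      Category.id_comp, ← Category.comp_id (arrowHomCod V r s),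
      ← tensorHom_comp_tensorHom_assoc, Category.comp_id,
      ← associator_inv_naturality_assoc, tensorHom_id, e_assoc,
      ← id_tensorHom, tensorHom_comp_tensorHom_assoc, Category.comp_id]

/-- The enrichment of the category of all arrows of `C` and commutative squares. -/
noncomputable instance arrowEnrichment : EnrichedOrdinaryCategory V (Arrow C) where
  Hom p q := arrowHom V p q
  id p := arrowId V p
  comp p q r := arrowComp V p q r
  id_comp p q := arrow_id_comp V p q
  comp_id p q := arrow_comp_id V p q
  assoc p q r s := arrow_assoc V p q r s
  homEquiv {p q} := arrowHomEquiv V p q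
  homEquiv_id p := arrowHom_hom_ext V
    ((arrowHomEquiv_dom V _).trans ((eHomEquiv_id V _).trans (arrowId_dom V p).symm))
    ((arrowHomEquiv_cod V _).trans ((eHomEquiv_id V _).trans (arrowId_cod V p).symm))
  homEquiv_comp {p q r} f g := by
    change arrowHomEquiv V p r (f ≫ g) = (λ_ _).inv ≫
      (arrowHomEquiv V p q f ⊗ₘ arrowHomEquiv V q r g) ≫ arrowComp V p q r
    apply arrowHom_hom_ext
    · simp [eHomEquiv_comp]
    · simp [eHomEquiv_comp]

/-- The domain projection, as an enriched functor. -/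
noncomputable def arrowDom : EnrichedFunctor V (Arrow C) C where
  obj p := p.left
  map p q := arrowHomDom V p q
  map_id p := arrowId_dom V p
  map_comp p q r := arrowComp_dom V p q r

/-- The codomain projection, as an enriched functor. -/
noncomputable def arrowCod : EnrichedFunctor V (Arrow C) C where
  obj p := p.right
  map p q := arrowHomCod V p q
  map_id p := arrowId_cod V p
  map_comp p q r := arrowComp_cod V p q r

end ArrowEnrichment

/-- A full subcategory of an enriched category is enriched, with the same hom objects. -/
noncomputable instance fullSubcategoryEnrichment (V : Type u') [Category.{v'} V]
    [MonoidalCategory V] {C : Type u} [Category.{v} C] [EnrichedOrdinaryCategory V C]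
    (P : ObjectProperty C) : EnrichedOrdinaryCategory V P.FullSubcategory where
  Hom X Y := X.obj ⟶[V] Y.obj
  id X := eId V X.obj
  comp X Y Z := eComp V X.obj Y.obj Z.obj
  id_comp X Y := e_id_comp V X.obj Y.obj
  comp_id X Y := e_comp_id V X.obj Y.obj
  assoc W X Y Z := e_assoc V W.obj X.obj Y.obj Z.obj
  homEquiv := P.fullyFaithfulι.homEquiv.trans (eHomEquiv V)
  homEquiv_id X := eHomEquiv_id V X.obj
  homEquiv_comp f g := eHomEquiv_comp V f.hom g.hom

/-- The inclusion of a full subcategory, as an enriched functor. -/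
noncomputable def fullSubcategoryInclusion (V : Type u') [Category.{v'} V]
    [MonoidalCategory V] {C : Type u} [Category.{v} C] [EnrichedOrdinaryCategory V C]
    (P : ObjectProperty C) : EnrichedFunctor V P.FullSubcategory C where
  obj X := X.obj
  map X Y := 𝟙 (X.obj ⟶[V] Y.obj)
  map_id X := Category.comp_id (eId V X.obj)
  map_comp X Y Z := by
    refine (Category.comp_id (eComp V X.obj Y.obj Z.obj)).trans ?_
    exact ((congrArg (· ≫ eComp V X.obj Y.obj Z.obj) (id_tensorHom_id _ _)).trans
      (Category.id_comp _)).symm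

/-! ### Quasi-categories -/

/-- An isofibration of quasi-categories is an inner fibration with the right lifting property
against the inclusion of either endpoint of the nerve of the free-standing isomorphism. -/
structure IsQCatIsofibration {X Y : SSet.{v}} (f : X ⟶ Y) : Prop where
  innerFibration : SSet.innerFibrations f
  lift_zero : HasLiftingProperty (SSet.yonedaEquiv.symm SSet.coherentIso.x₀) f
  lift_one : HasLiftingProperty (SSet.yonedaEquiv.symm SSet.coherentIso.x₁) f

/-- A homotopy from `f` to `g` parametrised by the free-standing isomorphism. -/
def IsIsoHomotopic {X Y : SSet.{v}} (f g : X ⟶ Y) : Prop :=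
  ∃ H : X ⊗ SSet.coherentIso.{v} ⟶ Y,
    CartesianMonoidalCategory.lift (𝟙 X) (SSet.const SSet.coherentIso.x₀) ≫ H = f ∧
    CartesianMonoidalCategory.lift (𝟙 X) (SSet.const SSet.coherentIso.x₁) ≫ H = g

/-- An equivalence of quasi-categories. -/
def IsQCatEquivalence {X Y : SSet.{v}} (f : X ⟶ Y) : Prop :=
  ∃ g : Y ⟶ X, IsIsoHomotopic (𝟙 X) (f ≫ g) ∧ IsIsoHomotopic (g ≫ f) (𝟙 Y)

/-! ### Simplicially enriched limits -/

section SimplicialLimits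

variable {C : Type u} [Category.{v} C] [SimplicialCategory C]

/-- A limit cone in the underlying category that is moreover carried to a limit cone of
simplicial sets by each simplicial representable functor `Fun(X, -)`. -/
structure IsConicalLimit {J : Type*} [Category* J] {F : J ⥤ C} (c : Cone F) : Prop where
  isLimit : Nonempty (IsLimit c)
  isLimit_eCoyoneda (X : C) : Nonempty (IsLimit ((eCoyoneda SSet.{v} X).mapCone c))

/-- A cone over `A` weighted by the simplicial set `U`. -/
structure CotensorCone (U : SSet.{v}) (A : C) where
  /-- the apex -/
  pt : C
  /-- the weighted cone -/
  cone : U ⟶ (pt ⟶[SSet.{v}] A)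

/-- The comparison map `Fun(X, P) ⟶ Fun(X, A)^U` induced by a `U`-weighted cone from `P` to
`A`. -/
noncomputable def CotensorCone.comparison {U : SSet.{v}} {A : C} (c : CotensorCone U A) (X : C) :
    (X ⟶[SSet.{v}] c.pt) ⟶ (ihom U).obj (X ⟶[SSet.{v}] A) :=
  MonoidalClosed.curry
    (c.cone ▷ (X ⟶[SSet.{v}] c.pt) ≫ (β_ _ _).hom ≫ eComp SSet.{v} X c.pt A)

/-- The weighted cone `c` exhibits its apex as the simplicial cotensor `A^U`. -/
def CotensorCone.IsCotensor {U : SSet.{v}} {A : C} (c : CotensorCone U A) : Prop :=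
  ∀ X : C, IsIso (c.comparison X)

lemma CotensorCone.eHomEquiv_comparison {U : SSet.{v}} {A X : C} (c : CotensorCone U A)
    (m : X ⟶ c.pt) : eHomEquiv SSet.{v} m ≫ c.comparison X =
      MonoidalClosed.curry ((ρ_ U).hom ≫ c.cone ≫ eHomWhiskerRight SSet.{v} m A) := by
  unfold CotensorCone.comparison
  rw [← MonoidalClosed.curry_natural_left]
  congr 1

/-- Every weighted cone factors uniquely through a cotensor. -/
lemma CotensorCone.IsCotensor.existsUnique_lift {U : SSet.{v}} {A X : C} {c : CotensorCone U A}
    (hc : c.IsCotensor) (κ : U ⟶ (X ⟶[SSet.{v}] A)) :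
    ∃! m : X ⟶ c.pt, c.cone ≫ eHomWhiskerRight SSet.{v} m A = κ := by
  have := hc X
  have key : ∀ m : X ⟶ c.pt, c.cone ≫ eHomWhiskerRight SSet.{v} m A = κ ↔
      eHomEquiv SSet.{v} m ≫ c.comparison X = MonoidalClosed.curry ((ρ_ U).hom ≫ κ) := by
    intro m
    rw [c.eHomEquiv_comparison]
    constructor
    · rintro rfl; rfl
    · intro h
      exact (cancel_epi (ρ_ U).hom).1 (MonoidalClosed.curry_injective h)
  refine ⟨(eHomEquiv SSet.{v}).symm
    (MonoidalClosed.curry ((ρ_ U).hom ≫ κ) ≫ inv (c.comparison X)), ?_, ?_⟩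
  · refine (key _).2 ?_
    rw [Equiv.apply_symm_apply, Category.assoc, IsIso.inv_hom_id, Category.comp_id]
  · intro m hm
    rw [Equiv.eq_symm_apply, ← (key m).1 hm, Category.assoc, IsIso.hom_inv_id,
      Category.comp_id]

/-- The image of a weighted cone under a simplicial functor. -/
def CotensorCone.map {D : Type w} [Category.{v} D] [SimplicialCategory D]
    (G : EnrichedFunctor SSet.{v} C D) {U : SSet.{v}} {A : C} (c : CotensorCone U A) :
    CotensorCone U (G.obj A) where
  pt := G.obj c.pt
  cone := c.cone ≫ G.map c.pt A

/-- For `i : U ⟶ V` and `p : A ⟶ B`, the map `m` between the apices is the one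
`p^i : A^V ⟶ B^U` induced between cotensors, that is, it is compatible with the weighted cones.
When `d` is a cotensor, there is exactly one such map. -/
def IsCotensorMap {U V : SSet.{v}} (i : U ⟶ V) {A B : C} (p : A ⟶ B) (c : CotensorCone V A)
    (d : CotensorCone U B) (m : c.pt ⟶ d.pt) : Prop :=
  d.cone ≫ eHomWhiskerRight SSet.{v} m B = i ≫ c.cone ≫ eHomWhiskerLeft SSet.{v} c.pt p

/-- A tower `⋯ ⟶ F 2 ⟶ F 1 ⟶ F 0` of maps in the class `I`. -/
def IsTower (I : MorphismProperty C) (F : ℕᵒᵖ ⥤ C) : Prop :=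
  ∀ n : ℕ, I (F.map (homOfLE (Nat.le_succ n)).op)

end SimplicialLimits

/-! ### `∞`-cosmoi -/

/-- The simplicial category `K`, with the class `I` of isofibrations, is an `∞`-cosmos. -/
structure IsInfinityCosmos (K : Type u) [Category.{v} K] [SimplicialCategory K]
    (I : MorphismProperty K) : Prop where
  /-- the functor spaces are quasi-categories -/
  quasicategory (A B : K) : SSet.Quasicategory (A ⟶[SSet.{v}] B)
  /-- the isofibrations form a subcategory -/
  isMultiplicative : I.IsMultiplicative
  terminal : Enriched.HasConicalTerminal SSet.{v} K
  products (J : Type v) (F : Discrete J ⥤ K) : Enriched.HasConicalLimit SSet.{v} F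
  cotensors (U : SSet.{v}) (A : K) : ∃ c : CotensorCone U A, c.IsCotensor
  towers (F : ℕᵒᵖ ⥤ K) (hF : IsTower I F) : Enriched.HasConicalLimit SSet.{v} F
  pullbacks (F : WalkingCospan ⥤ K) (hF : I (F.map WalkingCospan.Hom.inr)) :
    Enriched.HasConicalLimit SSet.{v} F
  isofibration_of_isIso {A B : K} (f : A ⟶ B) [IsIso f] : I f
  isofibration_terminal {A T : K} (hT : IsTerminal T) (f : A ⟶ T) : I f
  isofibration_pullback : I.IsStableUnderBaseChange
  /-- products of isofibrations are isofibrations -/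
  isofibration_product (J : Type v) : I.IsStableUnderLimitsOfShape (Discrete J)
  /-- the legs of the limit cone of a tower of isofibrations are isofibrations -/
  isofibration_tower (F : ℕᵒᵖ ⥤ K) (hF : IsTower I F) (c : Cone F) (hc : IsLimit c) (n : ℕ) :
    I (c.π.app (op n))
  /-- The Leibniz cotensor `E^V ⟶ E^U ×_{B^U} B^V` of an inclusion and an isofibration is an
  isofibration. The cotensors and the pullback that occur in it exist by the axioms above and
  are unique up to isomorphism; the statement is made for all choices of them. -/
  isofibration_leibniz {E B : K} (p : E ⟶ B) (hp : I p) {U V : SSet.{v}} (i : U ⟶ V) [Mono i]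
    (EV : CotensorCone V E) (EU : CotensorCone U E) (BV : CotensorCone V B)
    (BU : CotensorCone U B) (hEV : EV.IsCotensor) (hEU : EU.IsCotensor) (hBV : BV.IsCotensor)
    (hBU : BU.IsCotensor)
    (Ei : EV.pt ⟶ EU.pt) (pV : EV.pt ⟶ BV.pt) (pU : EU.pt ⟶ BU.pt) (Bi : BV.pt ⟶ BU.pt)
    (hEi : IsCotensorMap i (𝟙 E) EV EU Ei) (hpV : IsCotensorMap (𝟙 V) p EV BV pV)
    (hpU : IsCotensorMap (𝟙 U) p EU BU pU) (hBi : IsCotensorMap i (𝟙 B) BV BU Bi)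
    {P : K} {fst : P ⟶ EU.pt} {snd : P ⟶ BV.pt} (hP : IsPullback fst snd pU Bi)
    (l : EV.pt ⟶ P) (hl₁ : l ≫ fst = Ei) (hl₂ : l ≫ snd = pV) : I l
  isofibration_fun (X : K) {E B : K} (p : E ⟶ B) (hp : I p) :
    IsQCatIsofibration (eHomWhiskerLeft SSet.{v} X p)

/-- The (representably defined) equivalences of a simplicial category. -/
def equivalences (K : Type u) [Category.{v} K] [SimplicialCategory K] : MorphismProperty K :=
  fun _ _ f => ∀ X : K, IsQCatEquivalence (eHomWhiskerLeft SSet.{v} X f)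

/-- The trivial fibrations: the equivalences that are isofibrations. -/
def trivialFibrations {K : Type u} [Category.{v} K] [SimplicialCategory K]
    (I : MorphismProperty K) : MorphismProperty K :=
  fun _ _ f => I f ∧ equivalences K f

/-! ### The simplicial category of isofibrations -/

section IsofibArrow

variable {K : Type u} [Category.{v} K]

/-- The squares from `p : E ⟶ A` to `q : F ⟶ B` with components `g : E ⟶ F` and `f : A ⟶ B`
such that `f` and the induced map `E ⟶ A ×_B F` are in the class `W`. -/
def reedy (W : MorphismProperty K) : MorphismProperty (Arrow K) := fun p q s =>
  W s.right ∧ ∃ (P : K) (fst : P ⟶ p.right) (snd : P ⟶ q.left)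
    (h : IsPullback fst snd s.right q.hom), W (h.lift p.hom s.left (Arrow.w s).symm)

/-- The category of isofibrations and commutative squares between them, as a full subcategory of
the category of arrows; its simplicial enrichment is the one of the category of arrows. -/
abbrev IsofibArrow (I : MorphismProperty K) : Type (max u v) :=
  ObjectProperty.FullSubcategory (fun p : Arrow K => I p.hom)

variable (I : MorphismProperty K)

/-- The inclusion into the category of all arrows. -/
abbrev IsofibArrow.incl : IsofibArrow I ⥤ Arrow K :=
  ObjectProperty.ι (fun p : Arrow K => I p.hom)

/-- The domain projection. -/
abbrev IsofibArrow.dom : IsofibArrow I ⥤ K := IsofibArrow.incl I ⋙ Arrow.leftFunc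

/-- The codomain projection. -/
abbrev IsofibArrow.cod : IsofibArrow I ⥤ K := IsofibArrow.incl I ⋙ Arrow.rightFunc

/-- The squares between isofibrations that are Reedy isofibrations. -/
def reedyIsofibrations : MorphismProperty (IsofibArrow I) :=
  (reedy I).inverseImage (IsofibArrow.incl I)

variable [SimplicialCategory K]

/-- The domain projection, as a simplicial functor. -/
noncomputable def IsofibArrow.eDom : EnrichedFunctor SSet.{v} (IsofibArrow I) K :=
  (fullSubcategoryInclusion SSet.{v} _).comp SSet.{v} (arrowDom SSet.{v})

/-- The codomain projection, as a simplicial functor. -/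
noncomputable def IsofibArrow.eCod : EnrichedFunctor SSet.{v} (IsofibArrow I) K :=
  (fullSubcategoryInclusion SSet.{v} _).comp SSet.{v} (arrowCod SSet.{v})

/-- The conical limit of `F` is jointly created by the domain and codomain projections. -/
def IsJointlyCreated {J : Type*} [Category* J] (F : J ⥤ IsofibArrow I) : Prop :=
  (∀ (c₀ : Cone (F ⋙ IsofibArrow.dom I)) (c₁ : Cone (F ⋙ IsofibArrow.cod I)),
    IsConicalLimit c₀ → IsConicalLimit c₁ →
      ∃! c : Cone F, (IsofibArrow.dom I).mapCone c = c₀ ∧ (IsofibArrow.cod I).mapCone c = c₁) ∧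
  ∀ c : Cone F, IsConicalLimit c ↔
    IsConicalLimit ((IsofibArrow.dom I).mapCone c) ∧
      IsConicalLimit ((IsofibArrow.cod I).mapCone c)

/-- The cotensor of the isofibration `p` by `U` is jointly created by the domain and codomain
projections. -/
def IsCotensorJointlyCreated (U : SSet.{v}) (p : IsofibArrow I) : Prop :=
  (∀ (c₀ : CotensorCone U ((IsofibArrow.eDom I).obj p))
    (c₁ : CotensorCone U ((IsofibArrow.eCod I).obj p)), c₀.IsCotensor → c₁.IsCotensor →
      ∃! c : CotensorCone U p, c.map (IsofibArrow.eDom I) = c₀ ∧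
        c.map (IsofibArrow.eCod I) = c₁) ∧
  ∀ c : CotensorCone U p, c.IsCotensor ↔
    (c.map (IsofibArrow.eDom I)).IsCotensor ∧ (c.map (IsofibArrow.eCod I)).IsCotensor

/-- The isofibrations are closed, in the category of all arrows of `K`, under the limit of `F`,
and the legs of the limit cone indexed by `S` are Reedy isofibrations. -/
def IsClosedUnderLimitInArrows {J : Type*} [Category* J] (F : J ⥤ IsofibArrow I)
    (S : Set J) : Prop :=
  Enriched.HasConicalLimit SSet.{v} (F ⋙ IsofibArrow.incl I) ∧
    ∀ (c : Cone (F ⋙ IsofibArrow.incl I)), IsLimit c →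
      I c.pt.hom ∧ ∀ j ∈ S, reedy I (c.π.app j)

end IsofibArrow

end InfCosmos

namespace InfCosmos

/-! ### Whiskering and enriched functors -/

section Whisker

variable (V : Type u') [Category.{v'} V] [MonoidalCategory V]
  {C : Type u} [Category.{v} C] [EnrichedOrdinaryCategory V C]

/-! Three ideas carry the theorem.

Limits. A functor space `Fun(x, p)` of squares is the pullback of `Fun(dom x, dom p)` and `Fun(cod
x, cod p)` over `Fun(dom x, cod p)`. Since limits commute with pullbacks, a cone of squares whose
two components are simplicial limits is itself one (`isConicalLimit_arrow`,
`isCotensor_of_components`). The limit lies in `K^𝟚` as soon as the induced arrow between the apices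
is an isofibration. For conical limits `HasPointwiseLimit` isolates this condition; existence, joint
creation and closure inside all arrows follow from it formally.

Isofibrations. A square is controlled by its codomain component and its gap map `E ⟶ A ×_B F`. Each
closure axiom holds because the gap map of the new square arises from the given gap maps by an
operation allowed in `K`: a pullback of a gap map (`reedy_of_isPullback`), a composite with such a
pullback (`reedy_comp`), a product (`reedy_product`), a leg of the limit of a tower of pullbacks
(`reedy_tower_leg`), or a Leibniz cotensor of the gap map (`isofibration_relative_leibniz`).
Likewise `Fun(x, s)` is a pullback of `Fun(dom x, gap)` followed by a pullback of `Fun(cod x, cod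
s)`.

Equivalences. Representable equivalences are the homotopy equivalences for paths parametrised by the
free-standing isomorphism (`equivalences_iff_exists`), that is, the isomorphisms of a quotient
category; hence two-out-of-three and two-out-of-six. If both components of a square have homotopy
inverses, lifting a homotopy along an isofibration makes the inverses into a strict square. The
composites then have components homotopic to identities, but by homotopies that need not be
compatible. As in Dold's theorem, such an endomorphism over a fixed codomain has a one-sided
fibrewise inverse of the same kind (`exists_homotopic_fibreEnd_comp`), and two-out-of-six concludes.
Trivial fibrations follow by two-out-of-three, once they are known to be stable under pullback. -/

lemma enrichedFunctor_whiskerLeft {D : Type w} [Category.{v} D] [EnrichedOrdinaryCategory V D]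
    (G : EnrichedFunctor V C D) (X : C) {Y Z : C} (s : Y ⟶ Z) (s' : G.obj Y ⟶ G.obj Z)
    (h : eHomEquiv V s ≫ G.map Y Z = eHomEquiv V s') :
    eHomWhiskerLeft V X s ≫ G.map X Z = G.map X Y ≫ eHomWhiskerLeft V (G.obj X) s' := by
  simp only [eHomWhiskerLeft, Category.assoc, G.map_comp, ← h]
  rw [rightUnitor_inv_naturality_assoc, MonoidalCategory.tensorHom_def,
    MonoidalCategory.whiskerLeft_comp, Category.assoc, Category.assoc,
    whisker_exchange_assoc]

lemma enrichedFunctor_whiskerRight {D : Type w} [Category.{v} D] [EnrichedOrdinaryCategory V D]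
    (G : EnrichedFunctor V C D) {X Y : C} (Z : C) (s : X ⟶ Y) (s' : G.obj X ⟶ G.obj Y)
    (h : eHomEquiv V s ≫ G.map X Y = eHomEquiv V s') :
    eHomWhiskerRight V s Z ≫ G.map X Z = G.map Y Z ≫ eHomWhiskerRight V s' (G.obj Z) := by
  simp only [eHomWhiskerRight, Category.assoc, G.map_comp, ← h]
  rw [leftUnitor_inv_naturality_assoc, MonoidalCategory.tensorHom_def,
    comp_whiskerRight, Category.assoc, Category.assoc,
    whisker_exchange_assoc, whisker_exchange_assoc]

variable [HasPullbacks V]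

lemma arrow_whiskerLeft_dom (x : Arrow C) {p q : Arrow C} (s : p ⟶ q) :
    eHomWhiskerLeft V x s ≫ arrowHomDom V x q =
      arrowHomDom V x p ≫ eHomWhiskerLeft V x.left s.left :=
  enrichedFunctor_whiskerLeft V (arrowDom V) x s s.left (arrowHomEquiv_dom V s)

lemma arrow_whiskerLeft_cod (x : Arrow C) {p q : Arrow C} (s : p ⟶ q) :
    eHomWhiskerLeft V x s ≫ arrowHomCod V x q =
      arrowHomCod V x p ≫ eHomWhiskerLeft V x.right s.right :=
  enrichedFunctor_whiskerLeft V (arrowCod V) x s s.right (arrowHomEquiv_cod V s)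

lemma arrow_whiskerRight_dom {p q : Arrow C} (s : p ⟶ q) (x : Arrow C) :
    eHomWhiskerRight V s x ≫ arrowHomDom V p x =
      arrowHomDom V q x ≫ eHomWhiskerRight V s.left x.left :=
  enrichedFunctor_whiskerRight V (arrowDom V) x s s.left (arrowHomEquiv_dom V s)

lemma arrow_whiskerRight_cod {p q : Arrow C} (s : p ⟶ q) (x : Arrow C) :
    eHomWhiskerRight V s x ≫ arrowHomCod V p x =
      arrowHomCod V q x ≫ eHomWhiskerRight V s.right x.right :=
  enrichedFunctor_whiskerRight V (arrowCod V) x s s.right (arrowHomEquiv_cod V s)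

end Whisker

/-! ### Maps of isofibrations -/

namespace IsofibArrow

variable {K : Type u} [Category.{v} K] [SimplicialCategory K] {I : MorphismProperty K}

/-- The projection of `Fun(p, q)` to `Fun(dom p, dom q)`. -/
noncomputable def homDom (p q : IsofibArrow I) :
    (p ⟶[SSet.{v}] q) ⟶ (p.obj.left ⟶[SSet.{v}] q.obj.left) :=
  arrowHomDom SSet.{v} p.obj q.obj

/-- The projection of `Fun(p, q)` to `Fun(cod p, cod q)`. -/
noncomputable def homCod (p q : IsofibArrow I) :
    (p ⟶[SSet.{v}] q) ⟶ (p.obj.right ⟶[SSet.{v}] q.obj.right) :=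
  arrowHomCod SSet.{v} p.obj q.obj

lemma eDom_map (p q : IsofibArrow I) : (eDom I).map p q = homDom p q :=
  Category.id_comp _

lemma eCod_map (p q : IsofibArrow I) : (eCod I).map p q = homCod p q :=
  Category.id_comp _

lemma hom_isPullback (p q : IsofibArrow I) :
    IsPullback (homDom p q) (homCod p q)
      (eHomWhiskerLeft SSet.{v} p.obj.left q.obj.hom)
      (eHomWhiskerRight SSet.{v} p.obj.hom q.obj.right) :=
  arrowHom_isPullback SSet.{v} p.obj q.obj

@[simp]
lemma eHomEquiv_homDom {p q : IsofibArrow I} (s : p ⟶ q) :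
    eHomEquiv SSet.{v} s ≫ homDom p q = eHomEquiv SSet.{v} s.hom.left :=
  arrowHomEquiv_dom SSet.{v} s.hom

@[simp]
lemma eHomEquiv_homCod {p q : IsofibArrow I} (s : p ⟶ q) :
    eHomEquiv SSet.{v} s ≫ homCod p q = eHomEquiv SSet.{v} s.hom.right :=
  arrowHomEquiv_cod SSet.{v} s.hom

lemma whiskerLeft_homDom (x : IsofibArrow I) {p q : IsofibArrow I} (s : p ⟶ q) :
    eHomWhiskerLeft SSet.{v} x s ≫ homDom x q =
      homDom x p ≫ eHomWhiskerLeft SSet.{v} x.obj.left s.hom.left :=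
  arrow_whiskerLeft_dom SSet.{v} x.obj s.hom

lemma whiskerLeft_homCod (x : IsofibArrow I) {p q : IsofibArrow I} (s : p ⟶ q) :
    eHomWhiskerLeft SSet.{v} x s ≫ homCod x q =
      homCod x p ≫ eHomWhiskerLeft SSet.{v} x.obj.right s.hom.right :=
  arrow_whiskerLeft_cod SSet.{v} x.obj s.hom

lemma whiskerRight_homDom {p q : IsofibArrow I} (s : p ⟶ q) (x : IsofibArrow I) :
    eHomWhiskerRight SSet.{v} s x ≫ homDom p x =
      homDom q x ≫ eHomWhiskerRight SSet.{v} s.hom.left x.obj.left :=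
  arrow_whiskerRight_dom SSet.{v} s.hom x.obj

lemma whiskerRight_homCod {p q : IsofibArrow I} (s : p ⟶ q) (x : IsofibArrow I) :
    eHomWhiskerRight SSet.{v} s x ≫ homCod p x =
      homCod q x ≫ eHomWhiskerRight SSet.{v} s.hom.right x.obj.right :=
  arrow_whiskerRight_cod SSet.{v} s.hom x.obj

end IsofibArrow

/-! ### Conical limits -/

section Conical

variable {C : Type u} [Category.{v} C] [SimplicialCategory C] {J : Type*} [Category* J]

lemma IsConicalLimit.hasConicalLimit {F : J ⥤ C} {c : Cone F} (hc : IsConicalLimit c) :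
    Enriched.HasConicalLimit SSet.{v} F where
  toHasLimit := ⟨⟨c, hc.isLimit.some⟩⟩
  preservesLimit_eCoyoneda X :=
    preservesLimit_of_preserves_limit_cone hc.isLimit.some (hc.isLimit_eCoyoneda X).some

lemma isConicalLimit_of_isLimit {F : J ⥤ C} [Enriched.HasConicalLimit SSet.{v} F] {c : Cone F}
    (hc : IsLimit c) : IsConicalLimit c where
  isLimit := ⟨hc⟩
  isLimit_eCoyoneda X := ⟨isLimitOfPreserves (eCoyoneda SSet.{v} X) hc⟩

lemma IsConicalLimit.of_fullyFaithful {P : ObjectProperty C} {F : J ⥤ P.FullSubcategory}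
    {c : Cone F} (hc : IsConicalLimit (P.ι.mapCone c)) : IsConicalLimit c where
  isLimit := ⟨isLimitOfReflects P.ι hc.isLimit.some⟩
  isLimit_eCoyoneda X := by
    obtain ⟨h⟩ := hc.isLimit_eCoyoneda X.obj
    exact ⟨h⟩

/-- Generalised elements `W ⟶ Fun(X, -)` treat both halves of a conical limit at once: `W` the unit
gives the limit in the underlying category, arbitrary `W` the limit of simplicial sets. -/
lemma isConicalLimit_of_existsUnique {F : J ⥤ C} {c : Cone F}
    (h : ∀ (X : C) (W : SSet.{v}) (φ : ∀ j, W ⟶ (X ⟶[SSet.{v}] F.obj j)),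
      (∀ {i j : J} (f : i ⟶ j), φ i ≫ eHomWhiskerLeft SSet.{v} X (F.map f) = φ j) →
      ∃! l : W ⟶ (X ⟶[SSet.{v}] c.pt), ∀ j, l ≫ eHomWhiskerLeft SSet.{v} X (c.π.app j) = φ j) :
    IsConicalLimit c where
  isLimit := by
    have key : ∀ s : Cone F, ∃! l : s.pt ⟶ c.pt, ∀ j, l ≫ c.π.app j = s.π.app j := by
      intro s
      obtain ⟨l, hl, hu⟩ := h s.pt (𝟙_ SSet.{v}) (fun j => eHomEquiv SSet.{v} (s.π.app j))
        (fun f => by rw [eHomEquiv_comp_eHomWhiskerLeft, s.w])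
      refine ⟨(eHomEquiv SSet.{v}).symm l, fun j => ?_, fun m hm => ?_⟩
      · apply (eHomEquiv SSet.{v}).injective
        rw [← eHomEquiv_comp_eHomWhiskerLeft, Equiv.apply_symm_apply, hl]
      · rw [Equiv.eq_symm_apply]
        refine hu _ fun j => ?_
        rw [eHomEquiv_comp_eHomWhiskerLeft, hm]
    exact ⟨{ lift s := (key s).choose
             fac s j := (key s).choose_spec.1 j
             uniq s m hm := (key s).choose_spec.2 m hm }⟩
  isLimit_eCoyoneda X := by
    have key : ∀ s : Cone (F ⋙ eCoyoneda SSet.{v} X), ∃! l : s.pt ⟶ (X ⟶[SSet.{v}] c.pt),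
        ∀ j, l ≫ eHomWhiskerLeft SSet.{v} X (c.π.app j) = s.π.app j :=
      fun s => h X s.pt (fun j => s.π.app j) (fun f => s.w f)
    exact ⟨{ lift s := (key s).choose
             fac s j := (key s).choose_spec.1 j
             uniq s m hm := (key s).choose_spec.2 m hm }⟩

lemma IsConicalLimit.existsUnique {F : J ⥤ C} {c : Cone F} (hc : IsConicalLimit c)
    (X : C) (W : SSet.{v}) (φ : ∀ j, W ⟶ (X ⟶[SSet.{v}] F.obj j))
    (hφ : ∀ {i j : J} (f : i ⟶ j), φ i ≫ eHomWhiskerLeft SSet.{v} X (F.map f) = φ j) :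
    ∃! l : W ⟶ (X ⟶[SSet.{v}] c.pt), ∀ j, l ≫ eHomWhiskerLeft SSet.{v} X (c.π.app j) = φ j := by
  obtain ⟨k⟩ := hc.isLimit_eCoyoneda X
  let s : Cone (F ⋙ eCoyoneda SSet.{v} X) :=
    { pt := W
      π := { app := φ
             naturality i j f := (Category.id_comp _).trans (hφ f).symm } }
  exact ⟨k.lift s, k.fac s, k.uniq s⟩

/-- A compatible family in the spaces `Fun(x, F j)` is a family on domains and one on codomains.
Each lifts to its limit, and the two lifts assemble into the pullback `Fun(x, lim F)`. -/
lemma isConicalLimit_arrow {F : J ⥤ Arrow C} {c : Cone F}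
    (h₀ : IsConicalLimit (Arrow.leftFunc.mapCone c))
    (h₁ : IsConicalLimit (Arrow.rightFunc.mapCone c)) : IsConicalLimit c := by
  refine isConicalLimit_of_existsUnique fun x W φ hφ => ?_
  have hφ₀ {i j : J} (f : i ⟶ j) : (φ i ≫ arrowHomDom SSet.{v} x (F.obj i)) ≫
      eHomWhiskerLeft SSet.{v} x.left (F.map f).left =
        φ j ≫ arrowHomDom SSet.{v} x (F.obj j) := by
    rw [← hφ f, Category.assoc, Category.assoc, arrow_whiskerLeft_dom]
  have hφ₁ {i j : J} (f : i ⟶ j) : (φ i ≫ arrowHomCod SSet.{v} x (F.obj i)) ≫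
      eHomWhiskerLeft SSet.{v} x.right (F.map f).right =
        φ j ≫ arrowHomCod SSet.{v} x (F.obj j) := by
    rw [← hφ f, Category.assoc, Category.assoc, arrow_whiskerLeft_cod]
  have hφ₂ {i j : J} (f : i ⟶ j) : (φ i ≫ arrowHomDom SSet.{v} x (F.obj i) ≫
      eHomWhiskerLeft SSet.{v} x.left (F.obj i).hom) ≫
        eHomWhiskerLeft SSet.{v} x.left (F.map f).right =
        φ j ≫ arrowHomDom SSet.{v} x (F.obj j) ≫
          eHomWhiskerLeft SSet.{v} x.left (F.obj j).hom := by
    rw [← hφ f, Category.assoc, Category.assoc, Category.assoc,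
      reassoc_of% (arrow_whiskerLeft_dom SSet.{v} x),
      ← eHomWhiskerLeft_comp, ← eHomWhiskerLeft_comp, Arrow.w]
  obtain ⟨d, hd, hd'⟩ : ∃! l : W ⟶ (x.left ⟶[SSet.{v}] c.pt.left), ∀ j,
      l ≫ eHomWhiskerLeft SSet.{v} x.left (c.π.app j).left =
        φ j ≫ arrowHomDom SSet.{v} x (F.obj j) :=
    h₀.existsUnique x.left W (fun j => φ j ≫ arrowHomDom SSet.{v} x (F.obj j)) hφ₀
  obtain ⟨e, he, he'⟩ : ∃! l : W ⟶ (x.right ⟶[SSet.{v}] c.pt.right), ∀ j,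
      l ≫ eHomWhiskerLeft SSet.{v} x.right (c.π.app j).right =
        φ j ≫ arrowHomCod SSet.{v} x (F.obj j) :=
    h₁.existsUnique x.right W (fun j => φ j ≫ arrowHomCod SSet.{v} x (F.obj j)) hφ₁
  -- Both composites are maps into `Fun(dom x, lim cod F)`, so uniqueness for the codomain limit,
  -- tested at the object `dom x`, identifies them.
  have hw : d ≫ eHomWhiskerLeft SSet.{v} x.left c.pt.hom =
      e ≫ eHomWhiskerRight SSet.{v} x.hom c.pt.right := by
    have hu : ∃! l : W ⟶ (x.left ⟶[SSet.{v}] c.pt.right), ∀ j,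
      l ≫ eHomWhiskerLeft SSet.{v} x.left (c.π.app j).right =
        φ j ≫ arrowHomDom SSet.{v} x (F.obj j) ≫
          eHomWhiskerLeft SSet.{v} x.left (F.obj j).hom :=
      h₁.existsUnique x.left W (fun j => φ j ≫ arrowHomDom SSet.{v} x (F.obj j) ≫
          eHomWhiskerLeft SSet.{v} x.left (F.obj j).hom) hφ₂
    refine hu.unique (fun j => ?_) (fun j => ?_)
    · rw [Category.assoc, ← eHomWhiskerLeft_comp, ← Arrow.w, eHomWhiskerLeft_comp,
        reassoc_of% hd j]
    · rw [Category.assoc, ← eHom_whisker_exchange, reassoc_of% he j, arrowHom_condition]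
  refine ⟨(arrowHom_isPullback SSet.{v} x c.pt).lift d e hw, fun j => ?_, fun m hm => ?_⟩
  · apply arrowHom_hom_ext SSet.{v}
    · rw [Category.assoc, arrow_whiskerLeft_dom, ← hd j, ← Category.assoc]
      exact congrArg (· ≫ _) (IsPullback.lift_fst _ _ _ _)
    · rw [Category.assoc, arrow_whiskerLeft_cod, ← he j, ← Category.assoc]
      exact congrArg (· ≫ _) (IsPullback.lift_snd _ _ _ _)
  · apply arrowHom_hom_ext SSet.{v}
    · refine Eq.trans ?_ (IsPullback.lift_fst _ _ _ _).symm
      refine hd' _ fun j => ?_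
      rw [← hm j, Category.assoc, Category.assoc, arrow_whiskerLeft_dom]
    · refine Eq.trans ?_ (IsPullback.lift_snd _ _ _ _).symm
      refine he' _ fun j => ?_
      rw [← hm j, Category.assoc, Category.assoc, arrow_whiskerLeft_cod]

end Conical

/-! ### Conical limits of isofibrations, computed on domains and codomains -/

namespace IsofibArrow

variable {K : Type u} [Category.{v} K] {I : MorphismProperty K} {J : Type*} [Category* J]

/-- A cone in the category of isofibrations with given domain and codomain components. -/
def coneMk {F : J ⥤ IsofibArrow I} (c₀ : Cone (F ⋙ dom I)) (c₁ : Cone (F ⋙ cod I))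
    (m : c₀.pt ⟶ c₁.pt) (hm : I m)
    (w : ∀ j, c₀.π.app j ≫ (F.obj j).obj.hom = m ≫ c₁.π.app j) : Cone F where
  pt := ⟨Arrow.mk m, hm⟩
  π :=
    { app j := ObjectProperty.homMk (Arrow.homMk (c₀.π.app j) (c₁.π.app j) (w j))
      naturality i j f := by
        ext
        · exact c₀.π.naturality f
        · exact c₁.π.naturality f }

/-- A cone of arrows with given domain and codomain components. -/
def arrowConeMk {F : J ⥤ Arrow K} (c₀ : Cone (F ⋙ Arrow.leftFunc))
    (c₁ : Cone (F ⋙ Arrow.rightFunc)) (m : c₀.pt ⟶ c₁.pt)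
    (w : ∀ j, c₀.π.app j ≫ (F.obj j).hom = m ≫ c₁.π.app j) : Cone F where
  pt := Arrow.mk m
  π :=
    { app j := Arrow.homMk (c₀.π.app j) (c₁.π.app j) (w j)
      naturality i j f := by
        ext
        · exact c₀.π.naturality f
        · exact c₁.π.naturality f }

lemma exists_map_of_isLimit {F : J ⥤ Arrow K} (c₀ : Cone (F ⋙ Arrow.leftFunc))
    {c₁ : Cone (F ⋙ Arrow.rightFunc)} (h₁ : IsLimit c₁) :
    ∃ m : c₀.pt ⟶ c₁.pt, ∀ j, c₀.π.app j ≫ (F.obj j).hom = m ≫ c₁.π.app j := by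
  let s : Cone (F ⋙ Arrow.rightFunc) :=
    { pt := c₀.pt
      π := { app j := c₀.π.app j ≫ (F.obj j).hom
             naturality i j f := by
              have h : c₀.π.app i ≫ (F.map f).left = c₀.π.app j := c₀.w f
              exact (Category.id_comp _).trans ((congrArg (· ≫ (F.obj j).hom) h.symm).trans
                ((Category.assoc _ _ _).trans ((congrArg (c₀.π.app i ≫ ·)
                  (Arrow.w (F.map f))).trans (Category.assoc _ _ _).symm))) } }
  exact ⟨h₁.lift s, fun j => (h₁.fac s j).symm⟩

/-- The components fix everything except the arrow at the apex, and that arrow is determined by its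
composites with the legs of the codomain limit. -/
lemma cone_ext {F : J ⥤ IsofibArrow I} {c c' : Cone F}
    (h₁ : IsLimit ((cod I).mapCone c))
    (e₀ : (dom I).mapCone c' = (dom I).mapCone c) (e₁ : (cod I).mapCone c' = (cod I).mapCone c) :
    c' = c := by
  obtain ⟨⟨⟨A, B, p⟩, hp⟩, π⟩ := c
  obtain ⟨⟨⟨A', B', p'⟩, hp'⟩, π'⟩ := c'
  obtain rfl : A' = A := congrArg Cone.pt e₀
  obtain rfl : B' = B := congrArg Cone.pt e₁
  have e₀' : ∀ j, (π'.app j).hom.left = (π.app j).hom.left := fun j => by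
    have := eq_of_heq ((Cone.mk.injEq _ _ _ _).mp e₀).2
    exact congrArg (fun t => t.app j) this
  have e₁' : ∀ j, (π'.app j).hom.right = (π.app j).hom.right := fun j => by
    have := eq_of_heq ((Cone.mk.injEq _ _ _ _).mp e₁).2
    exact congrArg (fun t => t.app j) this
  obtain rfl : p' = p := by
    refine h₁.hom_ext fun j => ?_
    have a := Arrow.w (π'.app j).hom
    have b := Arrow.w (π.app j).hom
    rw [e₀', e₁'] at a
    exact a.symm.trans b
  obtain rfl : π' = π := by
    ext j
    · exact e₀' j
    · exact e₁' j
  rfl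

variable [SimplicialCategory K]

lemma isConicalLimit_of_components {F : J ⥤ IsofibArrow I} {c : Cone F}
    (h₀ : IsConicalLimit ((dom I).mapCone c)) (h₁ : IsConicalLimit ((cod I).mapCone c)) :
    IsConicalLimit c :=
  .of_fullyFaithful (isConicalLimit_arrow (c := (incl I).mapCone c) h₀ h₁)

end IsofibArrow

/-- One limit cone is built componentwise; since limit cones are unique up to isomorphism, the
projections then preserve all of them. -/
lemma preservesLimit_arrow {K : Type u} [Category.{v} K] [SimplicialCategory K]
    {J : Type*} [Category* J] (F : J ⥤ Arrow K)
    [Enriched.HasConicalLimit SSet.{v} (F ⋙ Arrow.leftFunc)]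
    [Enriched.HasConicalLimit SSet.{v} (F ⋙ Arrow.rightFunc)] :
    Enriched.HasConicalLimit SSet.{v} F ∧ PreservesLimit F Arrow.leftFunc ∧
      PreservesLimit F Arrow.rightFunc := by
  obtain ⟨m, hm⟩ := IsofibArrow.exists_map_of_isLimit (limit.cone (F ⋙ Arrow.leftFunc))
    (limit.isLimit (F ⋙ Arrow.rightFunc))
  let c := IsofibArrow.arrowConeMk (limit.cone (F ⋙ Arrow.leftFunc))
    (limit.cone (F ⋙ Arrow.rightFunc)) m hm
  have h₀ : IsLimit (Arrow.leftFunc.mapCone c) := limit.isLimit (F ⋙ Arrow.leftFunc)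
  have h₁ : IsLimit (Arrow.rightFunc.mapCone c) := limit.isLimit (F ⋙ Arrow.rightFunc)
  have hc := isConicalLimit_arrow (isConicalLimit_of_isLimit h₀) (isConicalLimit_of_isLimit h₁)
  exact ⟨hc.hasConicalLimit, preservesLimit_of_preserves_limit_cone hc.isLimit.some h₀,
    preservesLimit_of_preserves_limit_cone hc.isLimit.some h₁⟩

/-! ### Limits of isofibrations that exist pointwise -/

namespace IsofibArrow

variable {K : Type u} [Category.{v} K] {I : MorphismProperty K} {J : Type*} [Category* J]
  [SimplicialCategory K]

/-- The limit of `F` exists on domains and on codomains, and the map between the limits is an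
isofibration. -/
structure HasPointwiseLimit (F : J ⥤ IsofibArrow I) : Prop where
  dom : Enriched.HasConicalLimit SSet.{v} (F ⋙ dom I)
  cod : Enriched.HasConicalLimit SSet.{v} (F ⋙ cod I)
  isofibration (c : Cone (F ⋙ incl I)) (h₀ : IsLimit (Arrow.leftFunc.mapCone c))
    (h₁ : IsLimit (Arrow.rightFunc.mapCone c)) : I c.pt.hom

namespace HasPointwiseLimit

variable {F : J ⥤ IsofibArrow I}

lemma preserves (hF : HasPointwiseLimit F) : Enriched.HasConicalLimit SSet.{v} F ∧
    PreservesLimit F (IsofibArrow.dom I) ∧ PreservesLimit F (IsofibArrow.cod I) := by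
  have := hF.dom
  have := hF.cod
  let c₀ := limit.cone (F ⋙ IsofibArrow.dom I)
  let c₁ := limit.cone (F ⋙ IsofibArrow.cod I)
  obtain ⟨m, hm⟩ := exists_map_of_isLimit (F := F ⋙ incl I) c₀
    (limit.isLimit (F ⋙ IsofibArrow.cod I))
  have h : I m := hF.isofibration (arrowConeMk (F := F ⋙ incl I) c₀ c₁ m hm)
    (limit.isLimit (F ⋙ IsofibArrow.dom I)) (limit.isLimit (F ⋙ IsofibArrow.cod I))
  have h₀ : IsLimit ((IsofibArrow.dom I).mapCone (coneMk c₀ c₁ m h hm)) :=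
    limit.isLimit (F ⋙ IsofibArrow.dom I)
  have h₁ : IsLimit ((IsofibArrow.cod I).mapCone (coneMk c₀ c₁ m h hm)) :=
    limit.isLimit (F ⋙ IsofibArrow.cod I)
  have hc := isConicalLimit_of_components (isConicalLimit_of_isLimit h₀)
    (isConicalLimit_of_isLimit h₁)
  exact ⟨hc.hasConicalLimit, preservesLimit_of_preserves_limit_cone hc.isLimit.some h₀,
    preservesLimit_of_preserves_limit_cone hc.isLimit.some h₁⟩

/-- The arrow induced between two given apices is an isofibration by hypothesis, so it supports the
lifted cone, which is unique by `cone_ext`. That limit cones have limit components is the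
preservation in `preserves`. -/
lemma isJointlyCreated (hF : HasPointwiseLimit F) : IsJointlyCreated I F := by
  have := hF.dom
  have := hF.cod
  refine ⟨fun c₀ c₁ h₀ h₁ => ?_, fun c => ⟨fun hc => ?_, fun hc =>
    isConicalLimit_of_components hc.1 hc.2⟩⟩
  · obtain ⟨k₀⟩ := h₀.isLimit
    obtain ⟨k₁⟩ := h₁.isLimit
    obtain ⟨m, hm⟩ := exists_map_of_isLimit (F := F ⋙ incl I) c₀ k₁
    have h : I m := hF.isofibration (arrowConeMk (F := F ⋙ incl I) c₀ c₁ m hm) k₀ k₁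
    have e₀ : (IsofibArrow.dom I).mapCone (coneMk c₀ c₁ m h hm) = c₀ := rfl
    have e₁ : (IsofibArrow.cod I).mapCone (coneMk c₀ c₁ m h hm) = c₁ := rfl
    refine ⟨coneMk c₀ c₁ m h hm, ⟨e₀, e₁⟩, fun c' hc' => ?_⟩
    exact cone_ext (c := coneMk c₀ c₁ m h hm) k₁ (hc'.1.trans e₀.symm) (hc'.2.trans e₁.symm)
  · obtain ⟨k⟩ := hc.isLimit
    obtain ⟨-, h₀, h₁⟩ := hF.preserves
    exact ⟨isConicalLimit_of_isLimit (isLimitOfPreserves (IsofibArrow.dom I) k),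
      isConicalLimit_of_isLimit (isLimitOfPreserves (IsofibArrow.cod I) k)⟩

lemma isClosedUnderLimitInArrows (hF : HasPointwiseLimit F) {S : Set J}
    (hS : ∀ (c : Cone (F ⋙ incl I)), IsLimit (Arrow.leftFunc.mapCone c) →
      IsLimit (Arrow.rightFunc.mapCone c) → ∀ j ∈ S, reedy I (c.π.app j)) :
    IsClosedUnderLimitInArrows I F S := by
  have : Enriched.HasConicalLimit SSet.{v} ((F ⋙ incl I) ⋙ Arrow.leftFunc) := hF.dom
  have : Enriched.HasConicalLimit SSet.{v} ((F ⋙ incl I) ⋙ Arrow.rightFunc) := hF.cod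
  obtain ⟨h, h₀, h₁⟩ := preservesLimit_arrow (F ⋙ incl I)
  refine ⟨h, fun c hc => ?_⟩
  have k₀ := isLimitOfPreserves Arrow.leftFunc hc
  have k₁ := isLimitOfPreserves Arrow.rightFunc hc
  exact ⟨hF.isofibration c k₀ k₁, hS c k₀ k₁⟩

end HasPointwiseLimit

end IsofibArrow

/-! ### Pullbacks and terminal objects -/

lemma isPullback_of_isLimit_cone {C : Type u} [Category.{v} C] {F : WalkingCospan ⥤ C}
    {c : Cone F} (hc : IsLimit c) :
    IsPullback (c.π.app WalkingCospan.left) (c.π.app WalkingCospan.right)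
      (F.map WalkingCospan.Hom.inl) (F.map WalkingCospan.Hom.inr) := by
  refine ⟨⟨(c.w WalkingCospan.Hom.inl).trans (c.w WalkingCospan.Hom.inr).symm⟩,
    ⟨PullbackCone.IsLimit.mk _ (fun s => hc.lift (Cone.ofPullbackCone s))
      (fun s => ?_) (fun s => ?_) (fun s m h₁ h₂ => ?_)⟩⟩
  · exact (hc.fac (Cone.ofPullbackCone s) WalkingCospan.left).trans (Category.comp_id _)
  · exact (hc.fac (Cone.ofPullbackCone s) WalkingCospan.right).trans (Category.comp_id _)
  · refine hc.hom_ext fun j => ?_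
    have e₁ : hc.lift (Cone.ofPullbackCone s) ≫ c.π.app WalkingCospan.left = s.fst :=
      (hc.fac (Cone.ofPullbackCone s) WalkingCospan.left).trans (Category.comp_id _)
    have e₂ : hc.lift (Cone.ofPullbackCone s) ≫ c.π.app WalkingCospan.right = s.snd :=
      (hc.fac (Cone.ofPullbackCone s) WalkingCospan.right).trans (Category.comp_id _)
    rcases j with _ | _ | _
    · rw [← c.w WalkingCospan.Hom.inl, reassoc_of% h₁]
      exact (congrArg (· ≫ F.map WalkingCospan.Hom.inl) e₁.symm).trans (Category.assoc _ _ _)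
    · exact h₁.trans e₁.symm
    · exact h₂.trans e₂.symm

lemma isPullback_of_existsUnique {C : Type u} [Category.{v} C] {P A B D : C} {fst : P ⟶ A}
    {snd : P ⟶ B} {f : A ⟶ D} {g : B ⟶ D} (w : fst ≫ f = snd ≫ g)
    (h : ∀ (X : C) (a : X ⟶ A) (b : X ⟶ B), a ≫ f = b ≫ g →
      ∃! l : X ⟶ P, l ≫ fst = a ∧ l ≫ snd = b) : IsPullback fst snd f g :=
  ⟨⟨w⟩, ⟨PullbackCone.IsLimit.mk _ (fun s => (h _ s.fst s.snd s.condition).choose)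
    (fun s => (h _ s.fst s.snd s.condition).choose_spec.1.1)
    (fun s => (h _ s.fst s.snd s.condition).choose_spec.1.2)
    (fun s m h₁ h₂ => (h _ s.fst s.snd s.condition).choose_spec.2 m ⟨h₁, h₂⟩)⟩⟩

/-- The cone with given legs. -/
abbrev coneOfMaps {C : Type u} [Category.{v} C] {J : Type*} [Category* J] {F : J ⥤ C} {X : C}
    (φ : ∀ j, X ⟶ F.obj j) (hφ : ∀ {i j : J} (f : i ⟶ j), φ i ≫ F.map f = φ j) : Cone F where
  pt := X
  π := { app := φ
         naturality _ _ f := (Category.id_comp _).trans (hφ f).symm }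

lemma nonempty_isLimit_of_existsUnique {C : Type u} [Category.{v} C] {J : Type*} [Category* J]
    {F : J ⥤ C} {c : Cone F}
    (h : ∀ (X : C) (φ : ∀ j, X ⟶ F.obj j), (∀ {i j : J} (f : i ⟶ j), φ i ≫ F.map f = φ j) →
      ∃! l : X ⟶ c.pt, ∀ j, l ≫ c.π.app j = φ j) : Nonempty (IsLimit c) := by
  have key (s : Cone F) := h s.pt (fun j => s.π.app j) fun f => s.w f
  exact ⟨{ lift s := (key s).choose
           fac s j := (key s).choose_spec.1 j
           uniq s m hm := (key s).choose_spec.2 m hm }⟩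

lemma existsUnique_of_isLimit {C : Type u} [Category.{v} C] {J : Type*} [Category* J]
    {F : J ⥤ C} {c : Cone F} (hc : IsLimit c) (X : C)
    (φ : ∀ j, X ⟶ F.obj j) (hφ : ∀ {i j : J} (f : i ⟶ j), φ i ≫ F.map f = φ j) :
    ∃! l : X ⟶ c.pt, ∀ j, l ≫ c.π.app j = φ j :=
  ⟨hc.lift (coneOfMaps φ hφ), hc.fac (coneOfMaps φ hφ), hc.uniq (coneOfMaps φ hφ)⟩

lemma nonempty_isTerminal_of_isLimit {C : Type u} [Category.{v} C]
    {F : Discrete PEmpty.{1} ⥤ C} {c : Cone F} (hc : IsLimit c) : Nonempty (IsTerminal c.pt) := by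
  have key (X : C) := existsUnique_of_isLimit hc X (fun j => j.as.elim) (fun {i} => i.as.elim)
  exact ⟨IsTerminal.ofUniqueHom (fun X => (key X).choose)
    (fun X m => (key X).choose_spec.2 m fun j => j.as.elim)⟩

/-! ### Reedy isofibrations -/

section Reedy

variable {K : Type u} [Category.{v} K] {W : MorphismProperty K}

/-- Two pullbacks of a cospan differ by an isomorphism compatible with the gap maps, so the
existential in `reedy` can be tested on whichever pullback is convenient. -/
lemma reedy_iff [W.RespectsIso] {p q : Arrow K} (s : p ⟶ q) {P : K} {fst : P ⟶ p.right}
    {snd : P ⟶ q.left} (h : IsPullback fst snd s.right q.hom) (l : p.left ⟶ P)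
    (h₁ : l ≫ fst = p.hom) (h₂ : l ≫ snd = s.left) : reedy W s ↔ W s.right ∧ W l := by
  refine and_congr_right fun _ => ⟨?_, fun hl => ⟨P, fst, snd, h, ?_⟩⟩
  · rintro ⟨P', fst', snd', h', hl⟩
    have : l = h'.lift p.hom s.left (Arrow.w s).symm ≫ (h'.isoIsPullback _ _ h).hom := by
      refine h.hom_ext ?_ ?_
      · simp [h₁]
      · simp [h₂]
    rw [this]
    exact (MorphismProperty.cancel_right_of_respectsIso W _ _).2 hl
  · convert hl
    refine h.hom_ext ?_ ?_
    · simp [h₁]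
    · simp [h₂]

variable [W.IsStableUnderBaseChange]

lemma fst_mem {P A B C : K} {fst : P ⟶ A} {snd : P ⟶ B} {f : A ⟶ C} {g : B ⟶ C}
    (h : IsPullback fst snd f g) (hg : W g) : W fst :=
  MorphismProperty.of_isPullback h.flip hg

lemma snd_mem {P A B C : K} {fst : P ⟶ A} {snd : P ⟶ B} {f : A ⟶ C} {g : B ⟶ C}
    (h : IsPullback fst snd f g) (hf : W f) : W snd :=
  MorphismProperty.of_isPullback h hf

/-- The map between pullbacks along `f` and along the composite of `f` with the codomain component
of a Reedy isofibration is an isofibration. -/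
lemma reedy_pullback_comparison {q r : Arrow K} {t : q ⟶ r} (ht : reedy W t) {A P R : K}
    {f : A ⟶ q.right} {fst : P ⟶ A} {snd : P ⟶ q.left} (hP : IsPullback fst snd f q.hom)
    {a : R ⟶ A} {g : R ⟶ r.left} (hR : IsPullback a g (f ≫ t.right) r.hom)
    (κ : P ⟶ R) (h₁ : κ ≫ a = fst) (h₂ : κ ≫ g = snd ≫ t.left) : W κ := by
  obtain ⟨-, Q, b, g', hQ, hl⟩ := ht
  set l := hQ.lift q.hom t.left (Arrow.w t).symm with hl_def
  have l₁ : l ≫ b = q.hom := hQ.lift_fst _ _ _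
  have l₂ : l ≫ g' = t.left := hQ.lift_snd _ _ _
  -- `Q` is the target of the gap map `l` of `t`. Over `f`, the base change of `Q` is `R` and that
  -- of `q.left` is `P`; hence `κ` is the pullback of `l` along `ρ`.
  let ρ : R ⟶ Q := hQ.lift (a ≫ f) g (by rw [Category.assoc, hR.w])
  have ρ₁ : ρ ≫ b = a ≫ f := hQ.lift_fst _ _ _
  have ρ₂ : ρ ≫ g' = g := hQ.lift_snd _ _ _
  have k₁ : IsPullback a ρ f b := IsPullback.of_bot (by rwa [ρ₂]) ρ₁.symm hQ
  have k₂ : IsPullback κ snd ρ l := by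
    refine IsPullback.of_right (by rwa [h₁, l₁]) ?_ k₁
    refine hQ.hom_ext ?_ ?_
    · rw [Category.assoc, ρ₁, reassoc_of% h₁, hP.w, Category.assoc, l₁]
    · rw [Category.assoc, ρ₂, h₂, Category.assoc, l₂]
  exact fst_mem k₂ hl

/-- Pullbacks commute with pullbacks: the gap map of `a` is the pullback of the gap map of `t` along
the map `ρ` between their targets. -/
lemma reedy_of_isPullback {p q p' q' : Arrow K} {a : p' ⟶ p} {b : p' ⟶ q'} {u : p ⟶ q}
    {t : q' ⟶ q} (ht : reedy W t) (h₀ : IsPullback a.left b.left u.left t.left)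
    (h₁ : IsPullback a.right b.right u.right t.right) [HasPullback a.right p.hom] :
    reedy W a := by
  have hS := IsPullback.of_hasPullback a.right p.hom
  have ht' := ht
  obtain ⟨ht₁, Q, qb, qg, hQ, hl⟩ := ht'
  refine ⟨fst_mem h₁ ht₁, _, _, _, hS, ?_⟩
  set S := pullback a.right p.hom
  set κ := hS.lift p'.hom a.left (Arrow.w a).symm
  have κ₁ : κ ≫ pullback.fst a.right p.hom = p'.hom := hS.lift_fst _ _ _
  have κ₂ : κ ≫ pullback.snd a.right p.hom = a.left := hS.lift_snd _ _ _
  set l := hQ.lift q'.hom t.left (Arrow.w t).symm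
  have l₁ : l ≫ qb = q'.hom := hQ.lift_fst _ _ _
  have l₂ : l ≫ qg = t.left := hQ.lift_snd _ _ _
  have k := hS.flip.paste_vert h₁
  rw [← Arrow.w u] at k
  let ρ : S ⟶ Q := hQ.lift (pullback.fst a.right p.hom ≫ b.right)
    (pullback.snd a.right p.hom ≫ u.left) (by simpa using k.w.symm)
  have ρ₁ : ρ ≫ qb = pullback.fst a.right p.hom ≫ b.right := hQ.lift_fst _ _ _
  have ρ₂ : ρ ≫ qg = pullback.snd a.right p.hom ≫ u.left := hQ.lift_snd _ _ _
  have k₁ : IsPullback (pullback.snd a.right p.hom) ρ u.left qg :=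
    IsPullback.of_bot (by rwa [ρ₁]) ρ₂.symm hQ.flip
  have k₂ : IsPullback κ b.left ρ l := by
    refine IsPullback.of_right (by rwa [κ₂, l₂]) ?_ k₁
    refine hQ.hom_ext ?_ ?_
    · rw [Category.assoc, ρ₁, reassoc_of% κ₁, Category.assoc, l₁, Arrow.w]
    · rw [Category.assoc, ρ₂, reassoc_of% κ₂, h₀.w, Category.assoc, l₂]
  exact fst_mem k₂ hl

variable [W.IsMultiplicative]

/-- The gap map of the composite is the gap map of `s` followed by the comparison `κ`, which is a
pullback of the gap map of `t`. -/
lemma reedy_comp {p q r : Arrow K} {s : p ⟶ q} {t : q ⟶ r} (hs : reedy W s) (ht : reedy W t)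
    [HasPullback (s ≫ t).right r.hom] : reedy W (s ≫ t) := by
  obtain ⟨hs₁, P, fst, snd, hP, hl⟩ := hs
  have hR := IsPullback.of_hasPullback (s ≫ t).right r.hom
  refine ⟨W.comp_mem _ _ hs₁ ht.1, _, _, _, hR, ?_⟩
  let κ := hR.lift fst (snd ≫ t.left)
    (by rw [Arrow.comp_right, Category.assoc, reassoc_of% hP.w, Arrow.w])
  have hκ : W κ := reedy_pullback_comparison ht hP hR κ (hR.lift_fst _ _ _) (hR.lift_snd _ _ _)
  convert W.comp_mem _ _ hl hκ
  refine hR.hom_ext ?_ ?_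
  · simp [κ]
  · simp [κ]

/-- `p.hom` is the gap map followed by a pullback of `q.hom`. This is how an arrow obtained as a
limit is seen to be an isofibration. -/
lemma hom_mem_of_reedy {p q : Arrow K} {s : p ⟶ q} (hs : reedy W s) (hq : W q.hom) :
    W p.hom := by
  obtain ⟨-, P, fst, snd, h, hl⟩ := hs
  rw [← h.lift_fst p.hom s.left (Arrow.w s).symm]
  exact W.comp_mem _ _ hl (fst_mem h hq)

/-- `s.left` is the gap map followed by a pullback of `s.right`. -/
lemma left_mem_of_reedy {p q : Arrow K} {s : p ⟶ q} (hs : reedy W s) : W s.left := by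
  obtain ⟨h₁, P, fst, snd, h, hl⟩ := hs
  rw [← h.lift_snd p.hom s.left (Arrow.w s).symm]
  exact W.comp_mem _ _ hl (snd_mem h h₁)

end Reedy

/-- The pullbacks of the arrows of a diagram to an object over the codomains form a diagram. -/
lemma exists_pullback_functor {C : Type u} [Category.{v} C] {J : Type*} [Category* J]
    (F : J ⥤ Arrow C) {A : C} (π : ∀ j, A ⟶ (F.obj j).right)
    (hπ : ∀ {i j} (f : i ⟶ j), π i ≫ (F.map f).right = π j)
    [∀ j, HasPullback (π j) (F.obj j).hom] :
    ∃ (T : J ⥤ C) (fst : ∀ j, T.obj j ⟶ A) (snd : ∀ j, T.obj j ⟶ (F.obj j).left),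
      (∀ j, IsPullback (fst j) (snd j) (π j) (F.obj j).hom) ∧
      (∀ {i j} (f : i ⟶ j), T.map f ≫ fst j = fst i) ∧
      (∀ {i j} (f : i ⟶ j), T.map f ≫ snd j = snd i ≫ (F.map f).left) := by
  have h (j : J) := IsPullback.of_hasPullback (π j) (F.obj j).hom
  have w {i j : J} (f : i ⟶ j) : pullback.fst (π i) (F.obj i).hom ≫ π j =
      (pullback.snd (π i) (F.obj i).hom ≫ (F.map f).left) ≫ (F.obj j).hom := by
    rw [Category.assoc, Arrow.w, ← hπ f, pullback.condition_assoc]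
  let m {i j : J} (f : i ⟶ j) := (h j).lift _ _ (w f)
  have m₁ {i j : J} (f : i ⟶ j) : m f ≫ pullback.fst (π j) (F.obj j).hom =
      pullback.fst (π i) (F.obj i).hom := (h j).lift_fst _ _ _
  have m₂ {i j : J} (f : i ⟶ j) : m f ≫ pullback.snd (π j) (F.obj j).hom =
      pullback.snd (π i) (F.obj i).hom ≫ (F.map f).left := (h j).lift_snd _ _ _
  let T : J ⥤ C :=
    { obj j := pullback (π j) (F.obj j).hom
      map f := m f
      map_id j := (h j).hom_ext (by rw [m₁, Category.id_comp]) (by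
        rw [m₂, Category.id_comp, CategoryTheory.Functor.map_id, Arrow.id_left, Category.comp_id])
      map_comp {i j k} f g := (h k).hom_ext (by rw [m₁, Category.assoc, m₁, m₁]) (by
        rw [m₂, Category.assoc, m₂, reassoc_of% m₂ f, Functor.map_comp, Arrow.comp_left]) }
  exact ⟨T, fun j => pullback.fst _ _, fun j => pullback.snd _ _, h, m₁, m₂⟩

/-! ### First consequences of the axioms -/

namespace IsInfinityCosmos

variable {K : Type u} [Category.{v} K] [SimplicialCategory K] {I : MorphismProperty K}

lemma hasPullback (hK : IsInfinityCosmos K I) {A B C : K} (f : A ⟶ C) {p : B ⟶ C} (hp : I p) :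
    HasPullback f p :=
  (hK.pullbacks (cospan f p) hp).toHasLimit

lemma whiskerLeft_isPullback (hK : IsInfinityCosmos K I) {P A B C : K} {fst : P ⟶ A}
    {snd : P ⟶ B} {f : A ⟶ C} {p : B ⟶ C} (h : IsPullback fst snd f p) (hp : I p) (X : K) :
    IsPullback (eHomWhiskerLeft SSet.{v} X fst) (eHomWhiskerLeft SSet.{v} X snd)
      (eHomWhiskerLeft SSet.{v} X f) (eHomWhiskerLeft SSet.{v} X p) := by
  have := hK.pullbacks (cospan f p) hp
  exact h.map (eCoyoneda SSet.{v} X)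

lemma hasConicalLimit_of_isEmpty (hK : IsInfinityCosmos K I) (F : Discrete PEmpty.{1} ⥤ K) :
    Enriched.HasConicalLimit SSet.{v} F :=
  hK.terminal.hasConicalLimit F

lemma respectsIso (hK : IsInfinityCosmos K I) : I.RespectsIso := by
  have := hK.isMultiplicative
  refine MorphismProperty.RespectsIso.mk _ (fun e f hf => ?_) (fun e f hf => ?_)
  · exact I.comp_mem _ _ (hK.isofibration_of_isIso e.hom) hf
  · exact I.comp_mem _ _ hf (hK.isofibration_of_isIso e.hom)

/-! ### Closure of the isofibrations under limits -/

lemma hasPointwiseLimit_of_isEmpty (hK : IsInfinityCosmos K I)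
    (F : Discrete PEmpty.{1} ⥤ IsofibArrow I) : IsofibArrow.HasPointwiseLimit F where
  dom := hK.hasConicalLimit_of_isEmpty _
  cod := hK.hasConicalLimit_of_isEmpty _
  isofibration c h₀ h₁ := by
    obtain ⟨h⟩ := nonempty_isTerminal_of_isLimit h₁
    exact hK.isofibration_terminal h _

lemma hasPointwiseLimit_product (hK : IsInfinityCosmos K I) {J : Type v}
    (F : Discrete J ⥤ IsofibArrow I) : IsofibArrow.HasPointwiseLimit F where
  dom := hK.products J _
  cod := hK.products J _
  isofibration c h₀ h₁ := by
    refine (hK.isofibration_product J).condition _ _ _ _ h₀ h₁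
      { app j := (F.obj j).obj.hom, naturality := fun i j f => Arrow.w (F.map f).hom }
      (fun j => (F.obj j).property) c.pt.hom (fun j => (Arrow.w (c.π.app j)).symm)

lemma hasPointwiseLimit_pullback (hK : IsInfinityCosmos K I) (F : WalkingCospan ⥤ IsofibArrow I)
    (hF : reedyIsofibrations I (F.map WalkingCospan.Hom.inr)) :
    IsofibArrow.HasPointwiseLimit F ∧
      ∀ (c : Cone (F ⋙ IsofibArrow.incl I)), IsLimit (Arrow.leftFunc.mapCone c) →
        IsLimit (Arrow.rightFunc.mapCone c) → reedy I (c.π.app WalkingCospan.left) := by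
  have := hK.isofibration_pullback
  have := hK.isMultiplicative
  have key (c : Cone (F ⋙ IsofibArrow.incl I)) (h₀ : IsLimit (Arrow.leftFunc.mapCone c))
      (h₁ : IsLimit (Arrow.rightFunc.mapCone c)) : reedy I (c.π.app WalkingCospan.left) := by
    have hp := (F.obj WalkingCospan.left).property
    have : HasPullback (c.π.app WalkingCospan.left).right
      ((F ⋙ IsofibArrow.incl I).obj WalkingCospan.left).hom :=
        hK.hasPullback (c.π.app WalkingCospan.left).right hp
    exact reedy_of_isPullback (b := c.π.app WalkingCospan.right)
      (u := (F.map WalkingCospan.Hom.inl).hom) hF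
      (isPullback_of_isLimit_cone h₀) (isPullback_of_isLimit_cone h₁)
  refine ⟨⟨?_, ?_, fun c h₀ h₁ => ?_⟩, key⟩
  · exact hK.pullbacks _ (left_mem_of_reedy hF)
  · exact hK.pullbacks _ hF.1
  · exact hom_mem_of_reedy (key c h₀ h₁) (F.obj WalkingCospan.left).property

/-- Write `A` for the limit of the codomains. The objects `T n = A ×_{A n} E n` form a tower of
isofibrations by `reedy_pullback_comparison`, and its limit is the limit of the domains. The gap
maps of the legs are the legs of this limit cone. -/
lemma reedy_tower_leg (hK : IsInfinityCosmos K I) (F : ℕᵒᵖ ⥤ Arrow K)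
    (hF : ∀ j, I (F.obj j).hom) (hF' : ∀ n : ℕ, reedy I (F.map (homOfLE (Nat.le_succ n)).op))
    (c : Cone F) (h₀ : IsLimit (Arrow.leftFunc.mapCone c))
    (h₁ : IsLimit (Arrow.rightFunc.mapCone c)) (n : ℕᵒᵖ) : reedy I (c.π.app n) := by
  have := hK.isofibration_pullback
  have (j : ℕᵒᵖ) : HasPullback (c.π.app j).right (F.obj j).hom := hK.hasPullback _ (hF j)
  have w {i j : ℕᵒᵖ} (f : i ⟶ j) : c.π.app i ≫ F.map f = c.π.app j := c.w f
  have wl {i j : ℕᵒᵖ} (f : i ⟶ j) : (c.π.app i).left ≫ (F.map f).left = (c.π.app j).left :=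
    congrArg Arrow.Hom.left (w f)
  have wr {i j : ℕᵒᵖ} (f : i ⟶ j) : (c.π.app i).right ≫ (F.map f).right = (c.π.app j).right :=
    congrArg Arrow.Hom.right (w f)
  let π (j : ℕᵒᵖ) : c.pt.right ⟶ (F.obj j).right := (c.π.app j).right
  have hπ {i j : ℕᵒᵖ} (f : i ⟶ j) : π i ≫ (F.map f).right = π j := wr f
  obtain ⟨T, fst, snd, hP, Tfst, Tsnd⟩ := exists_pullback_functor F π hπ
  let gap (j : ℕᵒᵖ) : c.pt.left ⟶ T.obj j :=
    (hP j).lift c.pt.hom (c.π.app j).left (Arrow.w (c.π.app j)).symm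
  have gap₁ (j) : gap j ≫ fst j = c.pt.hom := (hP j).lift_fst _ _ _
  have gap₂ (j) : gap j ≫ snd j = (c.π.app j).left := (hP j).lift_snd _ _ _
  have hT : IsTower I T := fun m =>
    reedy_pullback_comparison (hF' m) (hP _) (by rw [hπ]; exact hP _) _ (Tfst _) (Tsnd _)
  have hg {i j : ℕᵒᵖ} (f : i ⟶ j) : gap i ≫ T.map f = gap j := by
    refine (hP j).hom_ext ?_ ?_
    · rw [Category.assoc, Tfst, gap₁, gap₁]
    · rw [Category.assoc, Tsnd, reassoc_of% gap₂ i, gap₂, wl f]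
  -- A cone over `T` is a cone over the domains together with one map to `c.pt.right`, the same at
  -- every stage and so read off at stage `0`. The lift to the limit of the domains already
  -- determines that map.
  have hd : Nonempty (IsLimit (coneOfMaps (F := T) gap hg)) := by
    refine nonempty_isLimit_of_existsUnique fun X φ hφ => ?_
    have hφ' {i j : ℕᵒᵖ} (f : i ⟶ j) : (φ i ≫ snd i) ≫ (F.map f).left = φ j ≫ snd j := by
      rw [← hφ f, Category.assoc, Category.assoc, Tsnd]
    obtain ⟨l, hl, hl'⟩ : ∃! l : X ⟶ c.pt.left, ∀ j, l ≫ (c.π.app j).left = φ j ≫ snd j :=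
      existsUnique_of_isLimit h₀ X (fun j => φ j ≫ snd j) hφ'
    have hfst (j : ℕᵒᵖ) : φ j ≫ fst j = φ (op 0) ≫ fst (op 0) := by
      rw [← hφ (homOfLE (Nat.zero_le j.unop)).op, Category.assoc, Tfst]
    have hl₁ : l ≫ c.pt.hom = φ (op 0) ≫ fst (op 0) := by
      refine h₁.hom_ext fun j => ?_
      have e : (l ≫ c.pt.hom) ≫ (c.π.app j).right =
          (φ (op 0) ≫ fst (op 0)) ≫ (c.π.app j).right := by
        have : l ≫ c.pt.hom ≫ (c.π.app j).right = φ j ≫ fst j ≫ π j := by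
          have aw : (c.π.app j).left ≫ (F.obj j).hom = c.pt.hom ≫ (c.π.app j).right :=
            Arrow.w (c.π.app j)
          rw [← aw, (hP j).w, reassoc_of% hl j]
        rw [← hfst j, Category.assoc, Category.assoc, this]
      exact e
    refine ⟨l, fun j => ?_, fun m hm => hl' m fun j => ?_⟩
    · have a₁ : (l ≫ gap j) ≫ fst j = φ j ≫ fst j := by
        rw [Category.assoc, gap₁, hl₁, hfst j]
      have a₂ : (l ≫ gap j) ≫ snd j = φ j ≫ snd j := by
        rw [Category.assoc, gap₂, ← hl j]
      exact (hP j).hom_ext a₁ a₂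
    · have hm' : m ≫ gap j = φ j := hm j
      rw [← hm', Category.assoc]
      exact congrArg (m ≫ ·) (gap₂ j).symm
  have hrt : IsTower I (F ⋙ Arrow.rightFunc) := fun m => (hF' m).1
  exact ⟨hK.isofibration_tower _ hrt _ h₁ n.unop, _, _, _, hP n,
    hK.isofibration_tower T hT _ hd.some n.unop⟩

lemma hasPointwiseLimit_tower (hK : IsInfinityCosmos K I) (F : ℕᵒᵖ ⥤ IsofibArrow I)
    (hF : IsTower (reedyIsofibrations I) F) : IsofibArrow.HasPointwiseLimit F ∧
      ∀ (c : Cone (F ⋙ IsofibArrow.incl I)), IsLimit (Arrow.leftFunc.mapCone c) →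
        IsLimit (Arrow.rightFunc.mapCone c) → ∀ n, reedy I (c.π.app n) := by
  have := hK.isofibration_pullback
  have := hK.isMultiplicative
  have key := hK.reedy_tower_leg (F ⋙ IsofibArrow.incl I) (fun j => (F.obj j).property) hF
  refine ⟨⟨?_, ?_, fun c h₀ h₁ => ?_⟩, key⟩
  · exact hK.towers _ fun n => left_mem_of_reedy (hF n)
  · exact hK.towers _ fun n => (hF n).1
  · exact hom_mem_of_reedy (key c h₀ h₁ (op 0)) (F.obj (op 0)).property

end IsInfinityCosmos

/-! ### Cotensors -/

namespace CotensorCone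

variable {C : Type u} [Category.{v} C] [SimplicialCategory C]

/-- The evaluation `U ⊗ Fun(X, P) ⟶ Fun(X, A)` of a `U`-weighted cone from `P` to `A`. -/
noncomputable def ev {U : SSet.{v}} {A : C} (c : CotensorCone U A) (X : C) :
    U ⊗ (X ⟶[SSet.{v}] c.pt) ⟶ (X ⟶[SSet.{v}] A) :=
  c.cone ▷ (X ⟶[SSet.{v}] c.pt) ≫ (β_ _ _).hom ≫ eComp SSet.{v} X c.pt A

variable {U V : SSet.{v}} {A B : C}

lemma comparison_eq (c : CotensorCone U A) (X : C) :
    c.comparison X = MonoidalClosed.curry (c.ev X) := rfl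

lemma curry_whiskerLeft_ev (c : CotensorCone U A) {X : C} {W : SSet.{v}}
    (ψ : W ⟶ (X ⟶[SSet.{v}] c.pt)) :
    MonoidalClosed.curry (U ◁ ψ ≫ c.ev X) = ψ ≫ c.comparison X :=
  MonoidalClosed.curry_natural_left _ _

/-- Yoneda: the comparison map is invertible exactly when composition with it is bijective on maps
out of every `W`. Transposing replaces the internal hom by the evaluation `ev`. -/
lemma isCotensor_iff (c : CotensorCone U A) : c.IsCotensor ↔
    ∀ (X : C) (W : SSet.{v}) (φ : U ⊗ W ⟶ (X ⟶[SSet.{v}] A)),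
      ∃! ψ : W ⟶ (X ⟶[SSet.{v}] c.pt), U ◁ ψ ≫ c.ev X = φ := by
  refine ⟨fun h X W φ => ?_, fun h X => ?_⟩
  · have := h X
    have key (ψ : W ⟶ (X ⟶[SSet.{v}] c.pt)) :
        U ◁ ψ ≫ c.ev X = φ ↔ ψ ≫ c.comparison X = MonoidalClosed.curry φ := by
      rw [← curry_whiskerLeft_ev]
      exact MonoidalClosed.curry_injective.eq_iff.symm
    refine ⟨MonoidalClosed.curry φ ≫ inv (c.comparison X), (key _).2 (by simp), fun ψ hψ => ?_⟩
    rw [← (key ψ).1 hψ, Category.assoc, IsIso.hom_inv_id, Category.comp_id]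
  · obtain ⟨ψ, hψ, -⟩ := h X _ (MonoidalClosed.uncurry (𝟙 ((ihom U).obj (X ⟶[SSet.{v}] A))))
    have e : ψ ≫ c.comparison X = 𝟙 _ := by
      rw [← curry_whiskerLeft_ev, hψ, MonoidalClosed.curry_uncurry]
    refine ⟨ψ, ?_, e⟩
    refine (h X _ (c.ev X)).unique ?_ ?_
    · apply MonoidalClosed.curry_injective
      rw [curry_whiskerLeft_ev, Category.assoc, e, Category.comp_id, comparison_eq]
    · rw [MonoidalCategory.whiskerLeft_id, Category.id_comp]

lemma whiskerRight_ev (c : CotensorCone U A) {X Y : C} (n : X ⟶ Y) :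
    U ◁ eHomWhiskerRight SSet.{v} n c.pt ≫ c.ev X = c.ev Y ≫ eHomWhiskerRight SSet.{v} n A := by
  simp only [ev, Category.assoc]
  rw [eComp_eHomWhiskerRight, ← BraidedCategory.braiding_naturality_right_assoc,
    whisker_exchange_assoc]

lemma _root_.InfCosmos.IsCotensorMap.whiskerLeft_ev {i : U ⟶ V} {p : A ⟶ B} {c : CotensorCone V A}
    {d : CotensorCone U B} {m : c.pt ⟶ d.pt} (hm : IsCotensorMap i p c d m) (X : C) :
    U ◁ eHomWhiskerLeft SSet.{v} X m ≫ d.ev X =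
      i ▷ _ ≫ c.ev X ≫ eHomWhiskerLeft SSet.{v} X p := by
  simp only [ev, Category.assoc]
  rw [eComp_eHomWhiskerLeft, ← BraidedCategory.braiding_naturality_left_assoc,
    ← comp_whiskerRight_assoc, ← comp_whiskerRight_assoc, Category.assoc, ← hm,
    whisker_exchange_assoc, BraidedCategory.braiding_naturality_right_assoc,
    ← eHomWhiskerRight_whisker_eComp, ← BraidedCategory.braiding_naturality_left_assoc,
    comp_whiskerRight_assoc]

lemma ev_map {D : Type w} [Category.{v} D] [SimplicialCategory D]
    (G : EnrichedFunctor SSet.{v} C D) (c : CotensorCone U A) (X : C) :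
    U ◁ G.map X c.pt ≫ (c.map G).ev (G.obj X) = c.ev X ≫ G.map X A := by
  simp only [ev, Category.assoc, G.map_comp, CotensorCone.map]
  rw [comp_whiskerRight_assoc, BraidedCategory.braiding_naturality_left_assoc,
    whisker_exchange_assoc, BraidedCategory.braiding_naturality_right_assoc,
    MonoidalCategory.tensorHom_def, Category.assoc]

lemma IsCotensor.of_isIso {c' c : CotensorCone U A} (hc' : c'.IsCotensor) (m : c.pt ⟶ c'.pt)
    [IsIso m] (hm : c'.cone ≫ eHomWhiskerRight SSet.{v} m A = c.cone) : c.IsCotensor := by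
  intro X
  have h : IsCotensorMap (𝟙 U) (𝟙 A) c c' m := by
    rw [IsCotensorMap, hm, Category.id_comp, eHomWhiskerLeft_id, Category.comp_id]
  have e : c.comparison X = eHomWhiskerLeft SSet.{v} X m ≫ c'.comparison X := by
    rw [← curry_whiskerLeft_ev, h.whiskerLeft_ev, id_whiskerRight, eHomWhiskerLeft_id,
      Category.id_comp, Category.comp_id, comparison_eq]
  have := hc' X
  have : IsIso (eHomWhiskerLeft SSet.{v} X m) :=
    inferInstanceAs (IsIso ((eCoyoneda SSet.{v} X).map m))
  rw [e]
  infer_instance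

/-- Maps into a cotensor are determined by the weighted cones that they induce. -/
lemma IsCotensor.hom_ext {c : CotensorCone U A} (hc : c.IsCotensor) {X : C} {m m' : X ⟶ c.pt}
    (h : c.cone ≫ eHomWhiskerRight SSet.{v} m A = c.cone ≫ eHomWhiskerRight SSet.{v} m' A) :
    m = m' :=
  (hc.existsUnique_lift _).unique rfl h.symm

lemma IsCotensor.exists_map {d : CotensorCone U B} (hd : d.IsCotensor) (i : U ⟶ V) (p : A ⟶ B)
    (c : CotensorCone V A) : ∃ m, IsCotensorMap i p c d m :=
  (hd.existsUnique_lift _).exists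

lemma IsCotensor.exists_isIso {c c' : CotensorCone U A} (hc : c.IsCotensor) (hc' : c'.IsCotensor) :
    ∃ (m : c.pt ⟶ c'.pt), IsIso m ∧ c'.cone ≫ eHomWhiskerRight SSet.{v} m A = c.cone := by
  obtain ⟨m, hm, -⟩ := hc'.existsUnique_lift c.cone
  obtain ⟨m', hm', -⟩ := hc.existsUnique_lift c'.cone
  refine ⟨m, ⟨m', hc.hom_ext ?_, hc'.hom_ext ?_⟩, hm⟩
  · rw [eHomWhiskerRight_comp, reassoc_of% hm', hm, eHomWhiskerRight_id, Category.comp_id]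
  · rw [eHomWhiskerRight_comp, reassoc_of% hm, hm', eHomWhiskerRight_id, Category.comp_id]

end CotensorCone

lemma IsCotensorMap.comp {C : Type u} [Category.{v} C] [SimplicialCategory C] {U V W : SSet.{v}}
    {A B D : C} {i : U ⟶ V} {j : V ⟶ W} {p : A ⟶ B} {q : B ⟶ D} {c : CotensorCone W A}
    {d : CotensorCone V B} {e : CotensorCone U D} {m : c.pt ⟶ d.pt} {n : d.pt ⟶ e.pt}
    (hm : IsCotensorMap j p c d m) (hn : IsCotensorMap i q d e n) :
    IsCotensorMap (i ≫ j) (p ≫ q) c e (m ≫ n) := by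
  unfold IsCotensorMap at hm hn ⊢
  rw [eHomWhiskerRight_comp, reassoc_of% hn, eHom_whisker_exchange, reassoc_of% hm,
    eHomWhiskerLeft_comp, Category.assoc]

lemma IsCotensorMap.eq {C : Type u} [Category.{v} C] [SimplicialCategory C] {U V : SSet.{v}}
    {A B : C} {i : U ⟶ V} {p : A ⟶ B} {c : CotensorCone V A}
    {d : CotensorCone U B} {m n : c.pt ⟶ d.pt}
    (hm : IsCotensorMap i p c d m) (hn : IsCotensorMap i p c d n) (hd : d.IsCotensor) :
    m = n :=
  hd.hom_ext (Eq.trans hm (Eq.symm hn))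

/-! ### Cotensors preserve isofibrations -/

namespace IsInfinityCosmos

variable {K : Type u} [Category.{v} K] [SimplicialCategory K] {I : MorphismProperty K}

/-- The cotensor of an isofibration is an isofibration. -/
lemma isofibration_cotensor (hK : IsInfinityCosmos K I) {U : SSet.{v}} {E B : K} {p : E ⟶ B}
    (hp : I p) {c : CotensorCone U E} {d : CotensorCone U B} (hc : c.IsCotensor)
    (hd : d.IsCotensor) {m : c.pt ⟶ d.pt} (hm : IsCotensorMap (𝟙 U) p c d m) : I m := by
  -- The Leibniz cotensor with `∅ ⟶ U` is `p^U`: the cotensors by `∅` are terminal, so `p^∅` is an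
  -- isomorphism and the pullback in the axiom may be taken to be `B^U` itself.
  obtain ⟨e, he⟩ := hK.cotensors (⊥_ SSet.{v}) E
  obtain ⟨b, hb⟩ := hK.cotensors (⊥_ SSet.{v}) B
  obtain ⟨Ei, hEi⟩ := he.exists_map (initial.to U) (𝟙 E) c
  obtain ⟨Bi, hBi⟩ := hb.exists_map (initial.to U) (𝟙 B) d
  obtain ⟨pU, hpU⟩ := hb.exists_map (𝟙 _) p e
  have he' {X : K} (f g : X ⟶ e.pt) : f = g := he.hom_ext (initial.hom_ext _ _)
  have hb' {X : K} (f g : X ⟶ b.pt) : f = g := hb.hom_ext (initial.hom_ext _ _)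
  obtain ⟨n, -, -⟩ := he.existsUnique_lift (initial.to (b.pt ⟶[SSet.{v}] E))
  have : IsIso pU := ⟨n, he' _ _, hb' _ _⟩
  exact hK.isofibration_leibniz p hp (initial.to U) c e d b hc he hd hb Ei m pU Bi hEi hm hpU hBi
    (IsPullback.of_vert_isIso (fst := Bi ≫ n) (snd := 𝟙 d.pt) ⟨hb' _ _⟩) m (he' _ _)
    (Category.comp_id m)

end IsInfinityCosmos

/-! ### Cotensors of isofibrations, computed on domains and codomains -/

namespace IsofibArrow

variable {K : Type u} [Category.{v} K] [SimplicialCategory K] {I : MorphismProperty K}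
  {U V : SSet.{v}} {p q : IsofibArrow I}

/-- The domain component of a weighted cone of isofibrations. -/
noncomputable abbrev domCone (c : CotensorCone U p) : CotensorCone U p.obj.left :=
  ⟨c.pt.obj.left, c.cone ≫ homDom c.pt p⟩

/-- The codomain component of a weighted cone of isofibrations. -/
noncomputable abbrev codCone (c : CotensorCone U p) : CotensorCone U p.obj.right :=
  ⟨c.pt.obj.right, c.cone ≫ homCod c.pt p⟩

/-- `eDom` passes through a full subcategory inclusion acting by an identity on hom objects;
`domCone` is the image with this identity removed. -/
lemma map_eDom (c : CotensorCone U p) : c.map (eDom I) = domCone c :=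
  congrArg (fun t => (⟨c.pt.obj.left, c.cone ≫ t⟩ : CotensorCone U p.obj.left)) (eDom_map c.pt p)

lemma map_eCod (c : CotensorCone U p) : c.map (eCod I) = codCone c :=
  congrArg (fun t => (⟨c.pt.obj.right, c.cone ≫ t⟩ : CotensorCone U p.obj.right)) (eCod_map c.pt p)

lemma ev_homDom (c : CotensorCone U p) (x : IsofibArrow I) :
    U ◁ homDom x c.pt ≫ (domCone c).ev x.obj.left = c.ev x ≫ homDom x p :=
  CotensorCone.ev_map (arrowDom SSet.{v}) (⟨c.pt.obj, c.cone⟩ : CotensorCone U p.obj) x.obj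

lemma ev_homCod (c : CotensorCone U p) (x : IsofibArrow I) :
    U ◁ homCod x c.pt ≫ (codCone c).ev x.obj.right = c.ev x ≫ homCod x p :=
  CotensorCone.ev_map (arrowCod SSet.{v}) (⟨c.pt.obj, c.cone⟩ : CotensorCone U p.obj) x.obj

/-- A weighted cone lands in the pullback that defines `Fun(c.pt, p)`; its commutativity is exactly
this compatibility. -/
lemma isCotensorMap_hom (c : CotensorCone U p) :
    IsCotensorMap (𝟙 U) p.obj.hom (domCone c) (codCone c) c.pt.obj.hom := by
  dsimp only [IsCotensorMap, domCone, codCone]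
  rw [Category.assoc, ← (hom_isPullback c.pt p).w, Category.id_comp, Category.assoc]

lemma isCotensorMap_left {i : U ⟶ V} {s : p ⟶ q} {c : CotensorCone V p} {d : CotensorCone U q}
    {m : c.pt ⟶ d.pt} (hm : IsCotensorMap i s c d m) :
    IsCotensorMap i s.hom.left (domCone c) (domCone d) m.hom.left := by
  dsimp only [IsCotensorMap, domCone] at hm ⊢
  rw [Category.assoc, ← whiskerRight_homDom, Category.assoc, ← whiskerLeft_homDom,
    reassoc_of% hm]

lemma isCotensorMap_right {i : U ⟶ V} {s : p ⟶ q} {c : CotensorCone V p} {d : CotensorCone U q}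
    {m : c.pt ⟶ d.pt} (hm : IsCotensorMap i s c d m) :
    IsCotensorMap i s.hom.right (codCone c) (codCone d) m.hom.right := by
  dsimp only [IsCotensorMap, codCone] at hm ⊢
  rw [Category.assoc, ← whiskerRight_homCod, Category.assoc, ← whiskerLeft_homCod,
    reassoc_of% hm]

/-- The weighted analogue of `isConicalLimit_arrow`: transposes are found on domains and on
codomains, and agree in `Fun(dom x, cod c.pt)` by uniqueness for the codomain cotensor. -/
lemma isCotensor_of_components {c : CotensorCone U p} (h₀ : (domCone c).IsCotensor)
    (h₁ : (codCone c).IsCotensor) : c.IsCotensor := by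
  rw [CotensorCone.isCotensor_iff] at h₀ h₁ ⊢
  intro x W φ
  obtain ⟨a, ha, ha'⟩ := h₀ x.obj.left W (φ ≫ homDom x p)
  obtain ⟨b, hb, hb'⟩ := h₁ x.obj.right W (φ ≫ homCod x p)
  have w : a ≫ eHomWhiskerLeft SSet.{v} x.obj.left c.pt.obj.hom =
      b ≫ eHomWhiskerRight SSet.{v} x.obj.hom c.pt.obj.right := by
    refine (h₁ x.obj.left W (φ ≫ homDom x p ≫
      eHomWhiskerLeft SSet.{v} x.obj.left p.obj.hom)).unique ?_ ?_
    · have e := (isCotensorMap_hom c).whiskerLeft_ev x.obj.left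
      rw [id_whiskerRight, Category.id_comp] at e
      rw [MonoidalCategory.whiskerLeft_comp, Category.assoc]
      refine (congrArg (U ◁ a ≫ ·) e).trans ?_
      rw [reassoc_of% ha]
    · have e := (codCone c).whiskerRight_ev x.obj.hom
      rw [MonoidalCategory.whiskerLeft_comp, Category.assoc]
      refine (congrArg (U ◁ b ≫ ·) e).trans ?_
      rw [reassoc_of% hb, (hom_isPullback x p).w]
  have key (ψ : W ⟶ (x ⟶[SSet.{v}] c.pt)) : U ◁ ψ ≫ c.ev x = φ ↔
      ψ ≫ homDom x c.pt = a ∧ ψ ≫ homCod x c.pt = b := by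
    constructor
    · intro h
      refine ⟨ha' _ ?_, hb' _ ?_⟩
      · dsimp only
        rw [MonoidalCategory.whiskerLeft_comp, Category.assoc, ev_homDom, reassoc_of% h]
      · dsimp only
        rw [MonoidalCategory.whiskerLeft_comp, Category.assoc, ev_homCod, reassoc_of% h]
    · rintro ⟨h, h'⟩
      refine (hom_isPullback x p).hom_ext ?_ ?_
      · rw [Category.assoc, ← ev_homDom, ← MonoidalCategory.whiskerLeft_comp_assoc, h, ha]
      · rw [Category.assoc, ← ev_homCod, ← MonoidalCategory.whiskerLeft_comp_assoc, h', hb]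
  refine ⟨(hom_isPullback x c.pt).lift a b w, (key _).2 ⟨?_, ?_⟩, fun ψ hψ => ?_⟩
  · exact (hom_isPullback x c.pt).lift_fst _ _ _
  · exact (hom_isPullback x c.pt).lift_snd _ _ _
  · obtain ⟨h, h'⟩ := (key ψ).1 hψ
    refine (hom_isPullback x c.pt).hom_ext ?_ ?_
    · rw [h, IsPullback.lift_fst]
    · rw [h', IsPullback.lift_snd]

lemma exists_cotensorCone (hK : IsInfinityCosmos K I) {c₀ : CotensorCone U p.obj.left}
    {c₁ : CotensorCone U p.obj.right} (h₀ : c₀.IsCotensor) (h₁ : c₁.IsCotensor) :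
    ∃ c : CotensorCone U p, domCone c = c₀ ∧ codCone c = c₁ := by
  obtain ⟨m, hm⟩ := h₁.exists_map (𝟙 U) p.obj.hom c₀
  have hI : I m := hK.isofibration_cotensor p.property h₀ h₁ hm
  let r : IsofibArrow I := ⟨Arrow.mk m, hI⟩
  have w : c₀.cone ≫ eHomWhiskerLeft SSet.{v} r.obj.left p.obj.hom =
      c₁.cone ≫ eHomWhiskerRight SSet.{v} r.obj.hom p.obj.right :=
    (Category.id_comp _).symm.trans hm.symm
  refine ⟨⟨r, (hom_isPullback r p).lift c₀.cone c₁.cone w⟩, ?_, ?_⟩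
  · exact congrArg (CotensorCone.mk c₀.pt) ((hom_isPullback r p).lift_fst _ _ w)
  · exact congrArg (CotensorCone.mk c₁.pt) ((hom_isPullback r p).lift_snd _ _ w)

lemma cotensorCone_ext {c c' : CotensorCone U p} (h₁ : (codCone c).IsCotensor)
    (e₀ : domCone c' = domCone c) (e₁ : codCone c' = codCone c) : c' = c := by
  have hc := isCotensorMap_hom c
  have hc' := isCotensorMap_hom c'
  obtain ⟨⟨⟨A, B, r⟩, hr⟩, κ⟩ := c
  obtain ⟨⟨⟨A', B', r'⟩, hr'⟩, κ'⟩ := c'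
  obtain rfl : A' = A := congrArg CotensorCone.pt e₀
  obtain rfl : B' = B := congrArg CotensorCone.pt e₁
  have k₀ := eq_of_heq ((CotensorCone.mk.injEq _ _ _ _).mp e₀).2
  have k₁ := eq_of_heq ((CotensorCone.mk.injEq _ _ _ _).mp e₁).2
  obtain rfl : r' = r := by
    dsimp only [IsCotensorMap] at hc hc'
    rw [k₀, k₁, ← hc] at hc'
    exact h₁.hom_ext hc'
  obtain rfl : κ' = κ := (hom_isPullback _ p).hom_ext k₀ k₁
  rfl

lemma exists_isCotensor (hK : IsInfinityCosmos K I) (U : SSet.{v}) (p : IsofibArrow I) :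
    ∃ c : CotensorCone U p, (domCone c).IsCotensor ∧ (codCone c).IsCotensor := by
  obtain ⟨c₀, h₀⟩ := hK.cotensors U p.obj.left
  obtain ⟨c₁, h₁⟩ := hK.cotensors U p.obj.right
  obtain ⟨c, rfl, rfl⟩ := exists_cotensorCone hK h₀ h₁
  exact ⟨c, h₀, h₁⟩

/-- Some cotensor has cotensor components, and any other is isomorphic to it compatibly with the
weighted cones. -/
lemma isCotensor_components (hK : IsInfinityCosmos K I) {c : CotensorCone U p}
    (hc : c.IsCotensor) : (domCone c).IsCotensor ∧ (codCone c).IsCotensor := by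
  obtain ⟨c', h₀, h₁⟩ := exists_isCotensor hK U p
  obtain ⟨m, hm, e⟩ := hc.exists_isIso (isCotensor_of_components h₀ h₁)
  have : IsIso m.hom.left := inferInstanceAs (IsIso ((dom I).map m))
  have : IsIso m.hom.right := inferInstanceAs (IsIso ((cod I).map m))
  refine ⟨h₀.of_isIso (c := domCone c) m.hom.left ?_, h₁.of_isIso (c := codCone c) m.hom.right ?_⟩
  · dsimp only [domCone]
    rw [Category.assoc, ← whiskerRight_homDom, reassoc_of% e]
  · dsimp only [codCone]
    rw [Category.assoc, ← whiskerRight_homCod, reassoc_of% e]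

lemma isCotensorJointlyCreated (hK : IsInfinityCosmos K I) (U : SSet.{v}) (p : IsofibArrow I) :
    IsCotensorJointlyCreated I U p := by
  refine ⟨fun c₀ c₁ h₀ h₁ => ?_, fun c => ?_⟩
  · obtain ⟨c, e₀, e₁⟩ := exists_cotensorCone hK (p := p) h₀ h₁
    refine ⟨c, ⟨(map_eDom c).trans e₀, (map_eCod c).trans e₁⟩, fun c' hc' => ?_⟩
    refine cotensorCone_ext (by rw [e₁]; exact h₁) ?_ ?_
    · exact (map_eDom c').symm.trans (hc'.1.trans e₀.symm)
    · exact (map_eCod c').symm.trans (hc'.2.trans e₁.symm)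
  · rw [map_eDom, map_eCod]
    exact ⟨isCotensor_components hK, fun h => isCotensor_of_components h.1 h.2⟩

end IsofibArrow

/-! ### Cotensors of pullbacks and the relative Leibniz construction -/

namespace IsInfinityCosmos

variable {K : Type u} [Category.{v} K] [SimplicialCategory K] {I : MorphismProperty K}

/-- The cotensor of a pullback of an isofibration is a pullback. -/
lemma isPullback_cotensor (hK : IsInfinityCosmos K I) {U : SSet.{v}} {P A B D : K} {fst : P ⟶ A}
    {snd : P ⟶ B} {f : A ⟶ D} {g : B ⟶ D} (h : IsPullback fst snd f g) (hg : I g)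
    {cP : CotensorCone U P} {cA : CotensorCone U A} {cB : CotensorCone U B} {cD : CotensorCone U D}
    (hP : cP.IsCotensor) (hA : cA.IsCotensor) (hB : cB.IsCotensor) (hD : cD.IsCotensor)
    {fst' : cP.pt ⟶ cA.pt} {snd' : cP.pt ⟶ cB.pt} {f' : cA.pt ⟶ cD.pt} {g' : cB.pt ⟶ cD.pt}
    (hfst : IsCotensorMap (𝟙 U) fst cP cA fst') (hsnd : IsCotensorMap (𝟙 U) snd cP cB snd')
    (hf : IsCotensorMap (𝟙 U) f cA cD f') (hg' : IsCotensorMap (𝟙 U) g cB cD g') :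
    IsPullback fst' snd' f' g' := by
  -- Under the correspondence between maps `X ⟶ A^U` and maps `U ⟶ Fun(X, A)`, composition with
  -- `p^U` becomes composition with `Fun(X, p)`. The claim thus reduces to `Fun(X, -)` preserving
  -- the pullback.
  have key {X A B : K} {p : A ⟶ B} {c : CotensorCone U A} {d : CotensorCone U B} {m : c.pt ⟶ d.pt}
      (hm : IsCotensorMap (𝟙 U) p c d m) (l : X ⟶ c.pt) :
      d.cone ≫ eHomWhiskerRight SSet.{v} (l ≫ m) B =
        (c.cone ≫ eHomWhiskerRight SSet.{v} l A) ≫ eHomWhiskerLeft SSet.{v} X p := by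
    rw [IsCotensorMap, Category.id_comp] at hm
    rw [eHomWhiskerRight_comp, reassoc_of% hm, eHom_whisker_exchange, Category.assoc]
  refine isPullback_of_existsUnique ?_ fun X a b hab => ?_
  · refine IsCotensorMap.eq (hfst.comp hf) ?_ hD
    rw [h.w]
    exact hsnd.comp hg'
  · have hX := hK.whiskerLeft_isPullback h hg X
    have w : (cA.cone ≫ eHomWhiskerRight SSet.{v} a A) ≫ eHomWhiskerLeft SSet.{v} X f =
        (cB.cone ≫ eHomWhiskerRight SSet.{v} b B) ≫ eHomWhiskerLeft SSet.{v} X g := by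
      rw [← key hf, ← key hg', hab]
    obtain ⟨l, hl, -⟩ := hP.existsUnique_lift (hX.lift _ _ w)
    refine ⟨l, ⟨hA.hom_ext ?_, hB.hom_ext ?_⟩, fun m hm => hP.hom_ext (hX.hom_ext ?_ ?_)⟩
    · rw [key hfst, hl, IsPullback.lift_fst]
    · rw [key hsnd, hl, IsPullback.lift_snd]
    · rw [hl, ← key hfst, hm.1, IsPullback.lift_fst]
    · rw [hl, ← key hsnd, hm.2, IsPullback.lift_snd]

end IsInfinityCosmos

namespace IsInfinityCosmos

variable {K : Type u} [Category.{v} K] [SimplicialCategory K] {I : MorphismProperty K}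

/-- The relative Leibniz cotensor: the comparison between the Leibniz cotensors of the components
of a square is the Leibniz cotensor of the induced map to the pullback. -/
lemma isofibration_relative_leibniz (hK : IsInfinityCosmos K I) {U V : SSet.{v}} (i : U ⟶ V)
    [Mono i] {E A F B M : K} {p : E ⟶ A} {q : F ⟶ B} {g : E ⟶ F} {f : A ⟶ B} (hq : I q)
    {Mfst : M ⟶ A} {Msnd : M ⟶ F} (hM : IsPullback Mfst Msnd f q) {h : E ⟶ M} (hh : I h)
    (h₁ : h ≫ Mfst = p) (h₂ : h ≫ Msnd = g)
    {EV : CotensorCone V E} {EU : CotensorCone U E} {AV : CotensorCone V A}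
    {AU : CotensorCone U A} {FV : CotensorCone V F} {FU : CotensorCone U F}
    {BV : CotensorCone V B} {BU : CotensorCone U B}
    (hEV : EV.IsCotensor) (hEU : EU.IsCotensor) (hAV : AV.IsCotensor) (hAU : AU.IsCotensor)
    (hFV : FV.IsCotensor) (hFU : FU.IsCotensor) (hBV : BV.IsCotensor) (hBU : BU.IsCotensor)
    {Ei : EV.pt ⟶ EU.pt} {Ai : AV.pt ⟶ AU.pt} {Fi : FV.pt ⟶ FU.pt} {Bi : BV.pt ⟶ BU.pt}
    (hEi : IsCotensorMap i (𝟙 E) EV EU Ei) (hAi : IsCotensorMap i (𝟙 A) AV AU Ai)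
    (hFi : IsCotensorMap i (𝟙 F) FV FU Fi)
    {pV : EV.pt ⟶ AV.pt} {pU : EU.pt ⟶ AU.pt} {qV : FV.pt ⟶ BV.pt} {qU : FU.pt ⟶ BU.pt}
    {gV : EV.pt ⟶ FV.pt} {gU : EU.pt ⟶ FU.pt} {fV : AV.pt ⟶ BV.pt} {fU : AU.pt ⟶ BU.pt}
    (hpV : IsCotensorMap (𝟙 V) p EV AV pV) (hpU : IsCotensorMap (𝟙 U) p EU AU pU)
    (hqV : IsCotensorMap (𝟙 V) q FV BV qV) (hqU : IsCotensorMap (𝟙 U) q FU BU qU)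
    (hgV : IsCotensorMap (𝟙 V) g EV FV gV) (hgU : IsCotensorMap (𝟙 U) g EU FU gU)
    (hfV : IsCotensorMap (𝟙 V) f AV BV fV) (hfU : IsCotensorMap (𝟙 U) f AU BU fU)
    {P₀ P₁ N : K} {a₀ : P₀ ⟶ EU.pt} {b₀ : P₀ ⟶ FV.pt} {a₁ : P₁ ⟶ AU.pt} {b₁ : P₁ ⟶ BV.pt}
    (hP₀ : IsPullback a₀ b₀ gU Fi) (hP₁ : IsPullback a₁ b₁ fU Bi) {P : P₀ ⟶ P₁}
    (wa : a₀ ≫ pU = P ≫ a₁) (wb : b₀ ≫ qV = P ≫ b₁)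
    {l : AV.pt ⟶ P₁} (l₁ : l ≫ a₁ = Ai) (l₂ : l ≫ b₁ = fV)
    {n₁ : N ⟶ AV.pt} {n₂ : N ⟶ P₀} (hN : IsPullback n₁ n₂ l P)
    (k : EV.pt ⟶ N) (k₁ : k ≫ n₁ = pV) (k₂ : k ≫ n₂ ≫ a₀ = Ei) (k₃ : k ≫ n₂ ≫ b₀ = gV) :
    I k := by
  -- Here `M = A ×_B F`, `P₀ = E^U ×_{F^U} F^V`, `P₁ = A^U ×_{B^U} B^V` and `N = A^V ×_{P₁} P₀`. The
  -- goal is to recognise `N` as `E^U ×_{M^U} M^V`, the target of the Leibniz cotensor of `h`.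
  obtain ⟨MV, hMV⟩ := hK.cotensors V M
  obtain ⟨MU, hMU⟩ := hK.cotensors U M
  obtain ⟨fstV, hfstV⟩ := hAV.exists_map (𝟙 V) Mfst MV
  obtain ⟨sndV, hsndV⟩ := hFV.exists_map (𝟙 V) Msnd MV
  obtain ⟨fstU, hfstU⟩ := hAU.exists_map (𝟙 U) Mfst MU
  obtain ⟨sndU, hsndU⟩ := hFU.exists_map (𝟙 U) Msnd MU
  obtain ⟨hV, hhV⟩ := hMV.exists_map (𝟙 V) h EV
  obtain ⟨hU, hhU⟩ := hMU.exists_map (𝟙 U) h EU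
  obtain ⟨Mi, hMi⟩ := hMU.exists_map i (𝟙 M) MV
  have pbV : IsPullback fstV sndV fV qV :=
    hK.isPullback_cotensor hM hq hMV hAV hFV hBV hfstV hsndV hfV hqV
  have pbU : IsPullback fstU sndU fU qU :=
    hK.isPullback_cotensor hM hq hMU hAU hFU hBU hfstU hsndU hfU hqU
  have eV₁ : hV ≫ fstV = pV := by
    have := hhV.comp hfstV
    rw [h₁] at this
    exact this.eq hpV hAV
  have eV₂ : hV ≫ sndV = gV := by
    have := hhV.comp hsndV
    rw [h₂] at this
    exact this.eq hgV hFV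
  have eU₁ : hU ≫ fstU = pU := by
    have := hhU.comp hfstU
    rw [h₁] at this
    exact this.eq hpU hAU
  have eU₂ : hU ≫ sndU = gU := by
    have := hhU.comp hsndU
    rw [h₂] at this
    exact this.eq hgU hFU
  have m₁ : Mi ≫ fstU = fstV ≫ Ai := by
    have a := hMi.comp hfstU
    have b := hfstV.comp hAi
    rw [Category.id_comp, Category.id_comp] at a
    rw [Category.comp_id, Category.comp_id] at b
    exact a.eq b hAU
  have m₂ : Mi ≫ sndU = sndV ≫ Fi := by
    have a := hMi.comp hsndU
    have b := hsndV.comp hFi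
    rw [Category.id_comp, Category.id_comp] at a
    rw [Category.comp_id, Category.comp_id] at b
    exact a.eq b hFU
  have w : n₁ ≫ fV = (n₂ ≫ b₀) ≫ qV := by
    rw [← l₂, reassoc_of% hN.w, Category.assoc, wb]
  obtain ⟨μ, μ₁, μ₂⟩ : ∃ μ, μ ≫ fstV = n₁ ∧ μ ≫ sndV = n₂ ≫ b₀ :=
    ⟨pbV.lift n₁ (n₂ ≫ b₀) w, pbV.lift_fst _ _ _, pbV.lift_snd _ _ _⟩
  -- Both descriptions classify triples of maps into `A^V`, `E^U` and `F^V` that agree in `A^U`,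
  -- `B^V` and `F^U`.
  have hN' : IsPullback (n₂ ≫ a₀) μ hU Mi := by
    refine isPullback_of_existsUnique (pbU.hom_ext ?_ ?_) fun X e m hem => ?_
    · rw [Category.assoc, Category.assoc, Category.assoc, eU₁, m₁, reassoc_of% μ₁, wa, ← l₁,
        reassoc_of% hN.w]
    · rw [Category.assoc, Category.assoc, Category.assoc, eU₂, m₂, reassoc_of% μ₂, hP₀.w]
    · have c₁ : e ≫ gU = (m ≫ sndV) ≫ Fi := by
        rw [Category.assoc, ← m₂, ← reassoc_of% hem, eU₂]
      obtain ⟨π, π₁, π₂⟩ : ∃ π, π ≫ a₀ = e ∧ π ≫ b₀ = m ≫ sndV :=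
        ⟨hP₀.lift _ _ c₁, hP₀.lift_fst _ _ _, hP₀.lift_snd _ _ _⟩
      have c₂ : (m ≫ fstV) ≫ l = π ≫ P := by
        refine hP₁.hom_ext ?_ ?_
        · rw [Category.assoc, Category.assoc, Category.assoc, l₁, ← wa, reassoc_of% π₁, ← m₁,
            ← reassoc_of% hem, eU₁]
        · rw [Category.assoc, Category.assoc, Category.assoc, l₂, pbV.w, ← wb, reassoc_of% π₂]
      obtain ⟨ν, ν₁, ν₂⟩ : ∃ ν, ν ≫ n₁ = m ≫ fstV ∧ ν ≫ n₂ = π :=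
        ⟨hN.lift _ _ c₂, hN.lift_fst _ _ _, hN.lift_snd _ _ _⟩
      refine ⟨ν, ⟨?_, pbV.hom_ext ?_ ?_⟩, fun y hy => hN.hom_ext ?_ (hP₀.hom_ext ?_ ?_)⟩
      · rw [reassoc_of% ν₂, π₁]
      · rw [Category.assoc, μ₁, ν₁]
      · rw [Category.assoc, μ₂, reassoc_of% ν₂, π₂]
      · rw [ν₁, ← hy.2, Category.assoc, μ₁]
      · rw [ν₂, π₁, ← hy.1, Category.assoc]
      · rw [ν₂, π₂, ← hy.2, Category.assoc, Category.assoc, μ₂]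
  refine hK.isofibration_leibniz h hh i EV EU MV MU hEV hEU hMV hMU Ei hV hU Mi hEi hhV hhU
    hMi hN' k k₂ (pbV.hom_ext ?_ ?_)
  · rw [Category.assoc, μ₁, k₁, eV₁]
  · rw [Category.assoc, μ₂, k₃, eV₂]

end IsInfinityCosmos

/-! ### Cotensors and Leibniz cotensors of Reedy isofibrations -/

namespace IsofibArrow

variable {K : Type u} [Category.{v} K] [SimplicialCategory K] {I : MorphismProperty K}

lemma isPullback_components (hK : IsInfinityCosmos K I) {P p q r : IsofibArrow I} {fst : P ⟶ p}
    {snd : P ⟶ q} {f : p ⟶ r} {g : q ⟶ r} (h : IsPullback fst snd f g)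
    (hg : reedyIsofibrations I g) :
    IsPullback fst.hom.left snd.hom.left f.hom.left g.hom.left ∧
      IsPullback fst.hom.right snd.hom.right f.hom.right g.hom.right := by
  obtain ⟨-, h₀, h₁⟩ := (hK.hasPointwiseLimit_pullback (cospan f g) hg).1.preserves
  exact ⟨h.map (dom I), h.map (cod I)⟩

/-- The gap map of `s^U` is the cotensor by `U` of the gap map of `s`. This ensures that the
pullback in the Leibniz axiom is one along a Reedy isofibration, hence computed componentwise. -/
lemma reedy_cotensor (hK : IsInfinityCosmos K I) {U : SSet.{v}} {p q : IsofibArrow I} {s : p ⟶ q}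
    (hs : reedyIsofibrations I s) {c : CotensorCone U p} {d : CotensorCone U q}
    (hc : c.IsCotensor) (hd : d.IsCotensor) {m : c.pt ⟶ d.pt} (hm : IsCotensorMap (𝟙 U) s c d m) :
    reedyIsofibrations I m := by
  have := hK.respectsIso
  obtain ⟨hc₀, hc₁⟩ := isCotensor_components hK hc
  obtain ⟨hd₀, hd₁⟩ := isCotensor_components hK hd
  obtain ⟨hs₁, M, fst, snd, hM, hl⟩ := hs
  obtain ⟨cM, hcM⟩ := hK.cotensors U M
  obtain ⟨fst', hfst⟩ := hc₁.exists_map (𝟙 U) fst cM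
  obtain ⟨snd', hsnd⟩ := hd₀.exists_map (𝟙 U) snd cM
  obtain ⟨l', hl'⟩ := hcM.exists_map (𝟙 U) (hM.lift p.obj.hom s.hom.left (Arrow.w s.hom).symm)
    (domCone c)
  have pb : IsPullback fst' snd' m.hom.right d.pt.obj.hom :=
    hK.isPullback_cotensor hM q.property hcM hc₁ hd₀ hd₁ hfst hsnd (isCotensorMap_right hm)
      (isCotensorMap_hom d)
  have e₁ : l' ≫ fst' = c.pt.obj.hom := by
    have := hl'.comp hfst
    rw [hM.lift_fst] at this
    exact this.eq (isCotensorMap_hom c) hc₁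
  have e₂ : l' ≫ snd' = m.hom.left := by
    have := hl'.comp hsnd
    rw [hM.lift_snd] at this
    exact this.eq (isCotensorMap_left hm) hd₀
  exact (reedy_iff m.hom pb l' e₁ e₂).2
    ⟨hK.isofibration_cotensor hs₁ hc₁ hd₁ (isCotensorMap_right hm),
      hK.isofibration_cotensor hl hc₀ hcM hl'⟩

lemma isCotensorMap_id_left {U V : SSet.{v}} {i : U ⟶ V} {p : IsofibArrow I}
    {c : CotensorCone V p} {d : CotensorCone U p} {m : c.pt ⟶ d.pt}
    (hm : IsCotensorMap i (𝟙 p) c d m) :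
    IsCotensorMap i (𝟙 p.obj.left) (domCone c) (domCone d) m.hom.left := by
  dsimp only [IsCotensorMap] at hm ⊢
  rw [Category.assoc, ← whiskerRight_homDom, reassoc_of% hm, eHomWhiskerLeft_id, eHomWhiskerLeft_id,
    Category.id_comp, Category.comp_id]

lemma isCotensorMap_id_right {U V : SSet.{v}} {i : U ⟶ V} {p : IsofibArrow I}
    {c : CotensorCone V p} {d : CotensorCone U p} {m : c.pt ⟶ d.pt}
    (hm : IsCotensorMap i (𝟙 p) c d m) :
    IsCotensorMap i (𝟙 p.obj.right) (codCone c) (codCone d) m.hom.right := by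
  dsimp only [IsCotensorMap] at hm ⊢
  rw [Category.assoc, ← whiskerRight_homCod, reassoc_of% hm, eHomWhiskerLeft_id, eHomWhiskerLeft_id,
    Category.id_comp, Category.comp_id]

lemma reedy_leibniz (hK : IsInfinityCosmos K I) {p q : IsofibArrow I} (s : p ⟶ q)
    (hs : reedyIsofibrations I s) {U V : SSet.{v}} (i : U ⟶ V) [Mono i]
    (EV : CotensorCone V p) (EU : CotensorCone U p) (BV : CotensorCone V q)
    (BU : CotensorCone U q) (hEV : EV.IsCotensor) (hEU : EU.IsCotensor) (hBV : BV.IsCotensor)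
    (hBU : BU.IsCotensor)
    (Ei : EV.pt ⟶ EU.pt) (pV : EV.pt ⟶ BV.pt) (pU : EU.pt ⟶ BU.pt) (Bi : BV.pt ⟶ BU.pt)
    (hEi : IsCotensorMap i (𝟙 p) EV EU Ei) (hpV : IsCotensorMap (𝟙 V) s EV BV pV)
    (hpU : IsCotensorMap (𝟙 U) s EU BU pU) (hBi : IsCotensorMap i (𝟙 q) BV BU Bi)
    {P : IsofibArrow I} {fst : P ⟶ EU.pt} {snd : P ⟶ BV.pt} (hP : IsPullback fst snd pU Bi)
    (l : EV.pt ⟶ P) (hl₁ : l ≫ fst = Ei) (hl₂ : l ≫ snd = pV) : reedyIsofibrations I l := by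
  have := hK.respectsIso
  obtain ⟨hP₀, hP₁⟩ := isPullback_components hK hP.flip (reedy_cotensor hK hs hEU hBU hpU)
  obtain ⟨hEV₀, hEV₁⟩ := isCotensor_components hK hEV
  obtain ⟨hEU₀, hEU₁⟩ := isCotensor_components hK hEU
  obtain ⟨hBV₀, hBV₁⟩ := isCotensor_components hK hBV
  obtain ⟨hBU₀, hBU₁⟩ := isCotensor_components hK hBU
  have hEi₀ : IsCotensorMap i (𝟙 p.obj.left) (domCone EV) (domCone EU) Ei.hom.left :=
    isCotensorMap_id_left hEi
  have hEi₁ : IsCotensorMap i (𝟙 p.obj.right) (codCone EV) (codCone EU) Ei.hom.right :=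
    isCotensorMap_id_right hEi
  have hBi₀ : IsCotensorMap i (𝟙 q.obj.left) (domCone BV) (domCone BU) Bi.hom.left :=
    isCotensorMap_id_left hBi
  have hBi₁ : IsCotensorMap i (𝟙 q.obj.right) (codCone BV) (codCone BU) Bi.hom.right :=
    isCotensorMap_id_right hBi
  have hpV₀ := isCotensorMap_left hpV
  have hpV₁ := isCotensorMap_right hpV
  have hpU₀ := isCotensorMap_left hpU
  have hpU₁ := isCotensorMap_right hpU
  have l₁₀ : l.hom.left ≫ fst.hom.left = Ei.hom.left :=
    congrArg (fun t => t.hom.left) hl₁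
  have l₁₁ : l.hom.right ≫ fst.hom.right = Ei.hom.right :=
    congrArg (fun t => t.hom.right) hl₁
  have l₂₀ : l.hom.left ≫ snd.hom.left = pV.hom.left :=
    congrArg (fun t => t.hom.left) hl₂
  have l₂₁ : l.hom.right ≫ snd.hom.right = pV.hom.right :=
    congrArg (fun t => t.hom.right) hl₂
  have hs' := hs
  obtain ⟨hs₁, M, Mfst, Msnd, hM, hh⟩ := hs'
  have := hK.hasPullback l.hom.right P.property
  have hr : I l.hom.right := hK.isofibration_leibniz s.hom.right hs₁ i (codCone EV) (codCone EU)
    (codCone BV) (codCone BU) hEV₁ hEU₁ hBV₁ hBU₁ Ei.hom.right pV.hom.right pU.hom.right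
    Bi.hom.right hEi₁ hpV₁ hpU₁ hBi₁ hP₁.flip l.hom.right l₁₁ l₂₁
  have hN := IsPullback.of_hasPullback l.hom.right P.obj.hom
  obtain ⟨k, k₁, k₂⟩ : ∃ k, k ≫ pullback.fst l.hom.right P.obj.hom = EV.pt.obj.hom ∧
      k ≫ pullback.snd l.hom.right P.obj.hom = l.hom.left :=
    ⟨hN.lift _ _ (Arrow.w l.hom).symm, hN.lift_fst _ _ _, hN.lift_snd _ _ _⟩
  refine (reedy_iff l.hom hN k k₁ k₂).2 ⟨hr, ?_⟩
  -- The gap map `k` of the Leibniz cotensor of the square is the Leibniz cotensor of the gap map of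
  -- `s`.
  exact hK.isofibration_relative_leibniz i q.property hM hh (hM.lift_fst _ _ _) (hM.lift_snd _ _ _)
    hEV₀ hEU₀ hEV₁ hEU₁ hBV₀ hBU₀ hBV₁ hBU₁ hEi₀ hEi₁ hBi₀ (isCotensorMap_hom EV)
    (isCotensorMap_hom EU) (isCotensorMap_hom BV) (isCotensorMap_hom BU) hpV₀ hpU₀ hpV₁ hpU₁
    hP₀.flip hP₁.flip (Arrow.w fst.hom) (Arrow.w snd.hom) l₁₁ l₂₁ hN k k₁
    (by rw [reassoc_of% k₂, l₁₀]) (by rw [reassoc_of% k₂, l₂₀])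

end IsofibArrow

/-! ### Functor spaces and products of Reedy isofibrations -/

lemma IsQCatIsofibration.comp {X Y Z : SSet.{v}} {f : X ⟶ Y} {g : Y ⟶ Z}
    (hf : IsQCatIsofibration f) (hg : IsQCatIsofibration g) : IsQCatIsofibration (f ≫ g) where
  innerFibration := SSet.innerFibrations.comp_mem _ _ hf.innerFibration hg.innerFibration
  lift_zero := by
    have := hf.lift_zero
    have := hg.lift_zero
    infer_instance
  lift_one := by
    have := hf.lift_one
    have := hg.lift_one
    infer_instance

lemma IsQCatIsofibration.of_isPullback {P X Y Z : SSet.{v}} {fst : P ⟶ X} {snd : P ⟶ Y}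
    {f : X ⟶ Z} {g : Y ⟶ Z} (h : IsPullback fst snd f g) (hf : IsQCatIsofibration f) :
    IsQCatIsofibration snd where
  innerFibration := MorphismProperty.of_isPullback h hf.innerFibration
  lift_zero := by
    have := hf.lift_zero
    exact h.hasLiftingProperty _
  lift_one := by
    have := hf.lift_one
    exact h.hasLiftingProperty _

lemma discrete_comp_map {C : Type u} [Category.{v} C] {J : Type w} (F : Discrete J ⥤ C) {X : C}
    (φ : ∀ j, X ⟶ F.obj j) {i j : Discrete J} (g : i ⟶ j) : φ i ≫ F.map g = φ j := by
  obtain ⟨i⟩ := i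
  obtain rfl := Discrete.eq_of_hom g
  obtain rfl : g = 𝟙 _ := Subsingleton.elim _ _
  exact (congrArg _ (F.map_id _)).trans (Category.comp_id _)

namespace IsofibArrow

variable {K : Type u} [Category.{v} K] [SimplicialCategory K] {I : MorphismProperty K}

/-- With `M` the target of the gap map `h`, factor `Fun(x, s)` through the pullback of `Fun(dom x,
M)` and `Fun(cod x, cod p)` over `Fun(dom x, cod p)`. The first factor `κ` is a pullback of `Fun(dom
x, h)`, the second `ρ` a pullback of `Fun(cod x, s.right)`. -/
lemma isQCatIsofibration_whiskerLeft (hK : IsInfinityCosmos K I) (x : IsofibArrow I)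
    {p q : IsofibArrow I} (s : p ⟶ q) (hs : reedyIsofibrations I s) :
    IsQCatIsofibration (eHomWhiskerLeft SSet.{v} x s) := by
  obtain ⟨hs₁, M, Mfst, Msnd, hM, hh⟩ := hs
  obtain ⟨h, h₁, h₂, hh⟩ : ∃ h : p.obj.left ⟶ M, h ≫ Mfst = p.obj.hom ∧
      h ≫ Msnd = s.hom.left ∧ I h := ⟨_, hM.lift_fst _ _ _, hM.lift_snd _ _ _, hh⟩
  have hM' : IsPullback Mfst Msnd s.hom.right q.obj.hom := hM
  have hXM := hK.whiskerLeft_isPullback hM' q.property x.obj.left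
  have hR := IsPullback.of_hasPullback (eHomWhiskerLeft SSet.{v} x.obj.left Mfst)
    (eHomWhiskerRight SSet.{v} x.obj.hom p.obj.right)
  set r₁ := pullback.fst (eHomWhiskerLeft SSet.{v} x.obj.left Mfst)
    (eHomWhiskerRight SSet.{v} x.obj.hom p.obj.right)
  set r₂ := pullback.snd (eHomWhiskerLeft SSet.{v} x.obj.left Mfst)
    (eHomWhiskerRight SSet.{v} x.obj.hom p.obj.right)
  have hp := hom_isPullback x p
  have hq := hom_isPullback x q
  rw [← h₁, eHomWhiskerLeft_comp] at hp
  have hRq := hR.flip.paste_vert hXM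
  rw [← eHom_whisker_exchange] at hRq
  obtain ⟨ρ, ρ₁, ρ₂⟩ : ∃ ρ, ρ ≫ homDom x q = r₁ ≫ eHomWhiskerLeft SSet.{v} x.obj.left Msnd ∧
      ρ ≫ homCod x q = r₂ ≫ eHomWhiskerLeft SSet.{v} x.obj.right s.hom.right :=
    ⟨hq.lift _ _ (by rw [← hRq.w, Category.assoc]), hq.lift_fst _ _ _, hq.lift_snd _ _ _⟩
  obtain ⟨κ, κ₁, κ₂⟩ : ∃ κ, κ ≫ r₁ = homDom x p ≫ eHomWhiskerLeft SSet.{v} x.obj.left h ∧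
      κ ≫ r₂ = homCod x p :=
    ⟨hR.lift _ _ (by rw [Category.assoc, hp.w]), hR.lift_fst _ _ _, hR.lift_snd _ _ _⟩
  have k₁ : IsPullback (homDom x p) κ (eHomWhiskerLeft SSet.{v} x.obj.left h) r₁ :=
    (IsPullback.of_right (by rw [κ₂]; exact hp.flip) κ₁ hR.flip).flip
  have k₂ : IsPullback r₂ ρ (eHomWhiskerLeft SSet.{v} x.obj.right s.hom.right) (homCod x q) :=
    IsPullback.of_bot (by rwa [ρ₁]) ρ₂.symm hq.flip
  have e : κ ≫ ρ = eHomWhiskerLeft SSet.{v} x s := by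
    refine hq.hom_ext ?_ ?_
    · rw [Category.assoc, ρ₁, reassoc_of% κ₁, ← eHomWhiskerLeft_comp, h₂, whiskerLeft_homDom]
    · rw [Category.assoc, ρ₂, reassoc_of% κ₂, whiskerLeft_homCod]
  rw [← e]
  exact ((hK.isofibration_fun _ h hh).of_isPullback k₁).comp
    ((hK.isofibration_fun _ _ hs₁).of_isPullback k₂)

/-- The projection to `Fun(cod p, cod q)` is a pullback of the isofibration `Fun(dom p, q)`, hence
an inner fibration over a quasi-category. -/
lemma quasicategory_hom (hK : IsInfinityCosmos K I) (p q : IsofibArrow I) :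
    SSet.Quasicategory (p ⟶[SSet.{v}] q) := by
  have := hK.quasicategory p.obj.right q.obj.right
  have : SSet.InnerFibration (homCod p q) :=
    ⟨((hK.isofibration_fun p.obj.left q.obj.hom q.property).of_isPullback
      (hom_isPullback p q)).innerFibration⟩
  exact SSet.quasicategory_of_innerFibration (homCod p q)

/-- Products commute with pullbacks, so the gap map of a product of squares is the product of their
gap maps. -/
lemma reedy_product (hK : IsInfinityCosmos K I) (J : Type v) :
    (reedyIsofibrations I).IsStableUnderLimitsOfShape (Discrete J) where
  condition X₁ X₂ c₁ c₂ hc₁ hc₂ f hf φ hφ := by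
    obtain ⟨-, _, _⟩ := (hK.hasPointwiseLimit_product X₁).preserves
    obtain ⟨-, _, _⟩ := (hK.hasPointwiseLimit_product X₂).preserves
    have k₁₀ := isLimitOfPreserves (dom I) hc₁
    have k₁₁ := isLimitOfPreserves (cod I) hc₁
    have k₂₀ := isLimitOfPreserves (dom I) hc₂
    have k₂₁ := isLimitOfPreserves (cod I) hc₂
    have hprod := hK.isofibration_product J
    have φ₀ (j) : φ.hom.left ≫ (c₂.π.app j).hom.left =
      (c₁.π.app j).hom.left ≫ (f.app j).hom.left := congrArg (fun t => t.hom.left) (hφ j)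
    have φ₁ (j) : φ.hom.right ≫ (c₂.π.app j).hom.right =
      (c₁.π.app j).hom.right ≫ (f.app j).hom.right := congrArg (fun t => t.hom.right) (hφ j)
    have hr : I φ.hom.right := hprod.condition _ _ _ _ k₁₁ k₂₁
      (Functor.whiskerRight f (cod I)) (fun j => (hf j).1) φ.hom.right φ₁
    choose hf₁ M Mfst Msnd hM hh using hf
    let h (j) := (hM j).lift (X₁.obj j).obj.hom (f.app j).hom.left (Arrow.w (f.app j).hom).symm
    have h₁ (j) : h j ≫ Mfst j = (X₁.obj j).obj.hom := (hM j).lift_fst _ _ _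
    have h₂ (j) : h j ≫ Msnd j = (f.app j).hom.left := (hM j).lift_snd _ _ _
    have := hK.hasPullback φ.hom.right c₂.pt.property
    have hP := IsPullback.of_hasPullback φ.hom.right c₂.pt.obj.hom
    set P := pullback φ.hom.right c₂.pt.obj.hom
    set a := pullback.fst φ.hom.right c₂.pt.obj.hom
    set b := pullback.snd φ.hom.right c₂.pt.obj.hom
    have wc (j) : (c₂.π.app j).hom.left ≫ (X₂.obj j).obj.hom =
      c₂.pt.obj.hom ≫ (c₂.π.app j).hom.right := Arrow.w (c₂.π.app j).hom
    have wc' (j) : (c₁.π.app j).hom.left ≫ (X₁.obj j).obj.hom =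
      c₁.pt.obj.hom ≫ (c₁.π.app j).hom.right := Arrow.w (c₁.π.app j).hom
    have w (j) : (a ≫ (c₁.π.app j).hom.right) ≫ (f.app j).hom.right =
        (b ≫ (c₂.π.app j).hom.left) ≫ (X₂.obj j).obj.hom := by
      have := wc j
      rw [Category.assoc, Category.assoc, this, ← reassoc_of% hP.w, φ₁]
    let π (j) : P ⟶ M j := (hM j).lift _ _ (w j)
    have π₁ (j) : π j ≫ Mfst j = a ≫ (c₁.π.app j).hom.right := (hM j).lift_fst _ _ _
    have π₂ (j) : π j ≫ Msnd j = b ≫ (c₂.π.app j).hom.left := (hM j).lift_snd _ _ _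
    let T : Discrete J ⥤ K := Discrete.functor fun j => M ⟨j⟩
    -- The target `P` of the gap map of `φ` is the product of the targets `M j`: a family of maps
    -- into the `M j` amounts to maps into the product of the codomains of `X₁` and the product of
    -- the domains of `X₂` that agree over the codomains of `X₂`.
    have hT : Nonempty (IsLimit (coneOfMaps (F := T) π (discrete_comp_map T π))) := by
      refine nonempty_isLimit_of_existsUnique fun X ψ _ => ?_
      obtain ⟨a', ha'⟩ : ∃ a' : X ⟶ c₁.pt.obj.right, ∀ j,
          a' ≫ (c₁.π.app j).hom.right = ψ j ≫ Mfst j :=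
        (existsUnique_of_isLimit k₁₁ X _ (discrete_comp_map (X₁ ⋙ cod I)
          fun j => ψ j ≫ Mfst j)).exists
      obtain ⟨b', hb'⟩ : ∃ b' : X ⟶ c₂.pt.obj.left, ∀ j,
          b' ≫ (c₂.π.app j).hom.left = ψ j ≫ Msnd j :=
        (existsUnique_of_isLimit k₂₀ X _ (discrete_comp_map (X₂ ⋙ dom I)
          fun j => ψ j ≫ Msnd j)).exists
      have hab : a' ≫ φ.hom.right = b' ≫ c₂.pt.obj.hom := k₂₁.hom_ext fun j => by
        change (a' ≫ φ.hom.right) ≫ (c₂.π.app j).hom.right =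
          (b' ≫ c₂.pt.obj.hom) ≫ (c₂.π.app j).hom.right
        have hMw : Mfst j ≫ (f.app j).hom.right = Msnd j ≫ (X₂.obj j).obj.hom := (hM j).w
        rw [Category.assoc, Category.assoc, φ₁, reassoc_of% ha' j, ← wc, reassoc_of% hb' j, hMw]
      refine ⟨hP.lift a' b' hab, fun j => (hM j).hom_ext ?_ ?_, fun m hm => hP.hom_ext ?_ ?_⟩
      · change (hP.lift a' b' hab ≫ π j) ≫ Mfst j = ψ j ≫ Mfst j
        rw [Category.assoc, π₁, hP.lift_fst_assoc, ha']
      · change (hP.lift a' b' hab ≫ π j) ≫ Msnd j = ψ j ≫ Msnd j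
        rw [Category.assoc, π₂, hP.lift_snd_assoc, hb']
      · refine k₁₁.hom_ext fun j => ?_
        change (m ≫ a) ≫ (c₁.π.app j).hom.right =
          (hP.lift a' b' hab ≫ a) ≫ (c₁.π.app j).hom.right
        have hmj : m ≫ π j = ψ j := hm j
        rw [hP.lift_fst, ha', Category.assoc, ← π₁, reassoc_of% hmj]
      · refine k₂₀.hom_ext fun j => ?_
        change (m ≫ b) ≫ (c₂.π.app j).hom.left =
          (hP.lift a' b' hab ≫ b) ≫ (c₂.π.app j).hom.left
        have hmj : m ≫ π j = ψ j := hm j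
        rw [hP.lift_snd, hb', Category.assoc, ← π₂, reassoc_of% hmj]
    refine ⟨hr, P, a, b, hP, ?_⟩
    refine hprod.condition _ T _ _ k₁₀ hT.some
      (Discrete.natTrans h) (fun j => hh j) _ fun j => (hM j).hom_ext ?_ ?_
    · change (hP.lift c₁.pt.obj.hom φ.hom.left (Arrow.w φ.hom).symm ≫ π j) ≫ Mfst j =
        ((c₁.π.app j).hom.left ≫ h j) ≫ Mfst j
      rw [Category.assoc, π₁, hP.lift_fst_assoc, Category.assoc, h₁, wc']
    · change (hP.lift c₁.pt.obj.hom φ.hom.left (Arrow.w φ.hom).symm ≫ π j) ≫ Msnd j =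
        ((c₁.π.app j).hom.left ≫ h j) ≫ Msnd j
      rw [Category.assoc, π₂, hP.lift_snd_assoc, Category.assoc, h₂, φ₀]

end IsofibArrow

/-! ### The ∞-cosmos of isofibrations -/

namespace IsofibArrow

variable {K : Type u} [Category.{v} K] [SimplicialCategory K] {I : MorphismProperty K}

/-- An invertible square is itself a pullback, and for this choice its gap map is an identity. -/
lemma reedy_of_isIso (hK : IsInfinityCosmos K I) {p q : IsofibArrow I} (s : p ⟶ q) [IsIso s] :
    reedyIsofibrations I s := by
  have : IsIso s.hom := inferInstanceAs (IsIso ((incl I).map s))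
  have h₀ : IsIso s.hom.left := inferInstanceAs (IsIso (Arrow.leftFunc.map s.hom))
  have h₁ : IsIso s.hom.right := inferInstanceAs (IsIso (Arrow.rightFunc.map s.hom))
  have := hK.respectsIso
  refine (reedy_iff (W := I) s.hom
    (IsPullback.of_vert_isIso ⟨(Arrow.w s.hom).symm⟩)
    (𝟙 _) (Category.id_comp _) (Category.id_comp _)).2
      ⟨hK.isofibration_of_isIso _, hK.isofibration_of_isIso _⟩

lemma isMultiplicative (hK : IsInfinityCosmos K I) : (reedyIsofibrations I).IsMultiplicative where
  id_mem p := reedy_of_isIso hK (𝟙 p)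
  comp_mem {_ _ r} s t hs ht := by
    have := hK.isofibration_pullback
    have := hK.isMultiplicative
    have : HasPullback (s.hom ≫ t.hom).right ((incl I).obj r).hom :=
      hK.hasPullback _ r.property
    exact reedy_comp hs ht

/-- The isofibrations of an `∞`-cosmos are the objects of an `∞`-cosmos. -/
theorem isInfinityCosmos (hK : IsInfinityCosmos K I) :
    IsInfinityCosmos (IsofibArrow I) (reedyIsofibrations I) where
  quasicategory := quasicategory_hom hK
  isMultiplicative := isMultiplicative hK
  terminal := ⟨fun F => (hK.hasPointwiseLimit_of_isEmpty F).preserves.1⟩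
  products J F := (hK.hasPointwiseLimit_product F).preserves.1
  cotensors U p := by
    obtain ⟨c, h₀, h₁⟩ := exists_isCotensor hK U p
    exact ⟨c, isCotensor_of_components h₀ h₁⟩
  towers F hF := (hK.hasPointwiseLimit_tower F hF).1.preserves.1
  pullbacks F hF := (hK.hasPointwiseLimit_pullback F hF).1.preserves.1
  isofibration_of_isIso s _ := reedy_of_isIso hK s
  isofibration_terminal {p t} ht s := by
    obtain ⟨-, _, _⟩ := (hK.hasPointwiseLimit_of_isEmpty (Functor.empty _)).preserves
    have h₀ : IsTerminal t.obj.left := IsTerminal.isTerminalObj (dom I) t ht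
    have h₁ : IsTerminal t.obj.right := IsTerminal.isTerminalObj (cod I) t ht
    have := hK.respectsIso
    have : IsIso t.obj.hom := isIso_of_isTerminal h₀ h₁ _
    -- Since `t` is an isomorphism between terminal objects, its pullback is the codomain of `p`,
    -- and the gap map is the isofibration `p`.
    refine (reedy_iff (W := I) s.hom (fst := 𝟙 _) (snd := s.hom.right ≫ inv t.obj.hom)
      (IsPullback.of_horiz_isIso ⟨by simp⟩) p.obj.hom (Category.comp_id _)
      (h₀.hom_ext _ _)).2 ⟨hK.isofibration_terminal h₁ _, p.property⟩
  isofibration_pullback := ⟨fun {p q p' q'} f g f' g' h hg => by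
    obtain ⟨h₀, h₁⟩ := isPullback_components hK h.flip hg
    have := hK.isofibration_pullback
    have : HasPullback ((incl I).map g').right ((incl I).obj p).hom :=
      hK.hasPullback _ p.property
    exact reedy_of_isPullback hg h₀ h₁⟩
  isofibration_product := reedy_product hK
  isofibration_tower F hF c hc n := by
    obtain ⟨hF', key⟩ := hK.hasPointwiseLimit_tower F hF
    obtain ⟨-, _, _⟩ := hF'.preserves
    have k₀ : IsLimit ((dom I).mapCone c) := isLimitOfPreserves (dom I) hc
    have k₁ : IsLimit ((cod I).mapCone c) := isLimitOfPreserves (cod I) hc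
    exact key ((incl I).mapCone c) k₀ k₁ (op n)
  isofibration_leibniz s hs _ _ i _ := reedy_leibniz hK s hs i
  isofibration_fun x _ _ s hs := isQCatIsofibration_whiskerLeft hK x s hs

end IsofibArrow

/-! ### Paths -/

/-- The endpoint `0` of the free-standing isomorphism. -/
def isoZero : 𝟙_ SSet.{v} ⟶ SSet.coherentIso.{v} := SSet.const SSet.coherentIso.x₀

/-- The endpoint `1` of the free-standing isomorphism. -/
def isoOne : 𝟙_ SSet.{v} ⟶ SSet.coherentIso.{v} := SSet.const SSet.coherentIso.x₁

/-- The definition uses the endpoint as a map out of `Δ[0]`; the monoidal unit is another terminal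
simplicial set. -/
lemma IsQCatIsofibration.hasLiftingProperty_isoZero {X Y : SSet.{v}} {f : X ⟶ Y}
    (hf : IsQCatIsofibration f) : HasLiftingProperty isoZero f := by
  have := hf.lift_zero
  refine HasLiftingProperty.of_arrow_iso_left (Arrow.isoMk
    (f := Arrow.mk (SSet.yonedaEquiv.symm SSet.coherentIso.x₀)) (g := Arrow.mk isoZero)
    (SSet.stdSimplex.isTerminalObj₀.uniqueUpToIso
      SemiCartesianMonoidalCategory.isTerminalTensorUnit) (Iso.refl _) ?_) f
  rw [SSet.yonedaEquiv_symm_zero]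
  rfl

lemma isoZero_app_ne_isoOne_app (n : SimplexCategoryᵒᵖ) (x y : (𝟙_ SSet.{v}).obj n) :
    isoZero.app n x ≠ isoOne.app n y := by
  intro h
  have h' := congrArg (fun t : ComposableArrows WalkingIso.{v} _ => t.obj 0) h
  change WalkingIso.zero = WalkingIso.one at h'
  have := congrArg WalkingIso.equivBool h'
  cases this

/-- The inclusion of the two endpoints of the free-standing isomorphism. -/
lemma exists_endpoints_inclusion : ∃ (U : SSet.{v}) (i : U ⟶ SSet.coherentIso.{v}) (_ : Mono i)
    (a₀ a₁ : 𝟙_ SSet.{v} ⟶ U), a₀ ≫ i = isoZero ∧ a₁ ≫ i = isoOne ∧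
    (∀ {W Q : SSet.{v}} (f g : 𝟙_ SSet.{v} ⊗ W ⟶ Q),
      ∃ d : U ⊗ W ⟶ Q, a₀ ▷ W ≫ d = f ∧ a₁ ▷ W ≫ d = g) ∧
    (∀ {W Q : SSet.{v}} {d e : U ⊗ W ⟶ Q}, a₀ ▷ W ≫ d = a₀ ▷ W ≫ e → a₁ ▷ W ≫ d = a₁ ▷ W ≫ e →
      d = e) := by
  -- The discrete simplicial set on two points: `U ⊗ W` is two copies of `W`, and `i` is injective
  -- since the endpoints are distinct in every degree.
  let U : SSet.{v} := (Functor.const _).obj (ULift.{v} Bool)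
  let i : U ⟶ SSet.coherentIso.{v} :=
    { app n := TypeCat.ofHom fun b : ULift Bool =>
        if b.down then isoOne.{v}.app n PUnit.unit else isoZero.{v}.app n PUnit.unit
      naturality m n f := by
        refine ConcreteCategory.hom_ext _ _ ?_
        rintro ⟨⟨⟩⟩
        · exact congrArg (fun t => t PUnit.unit) (isoZero.naturality f)
        · exact congrArg (fun t => t PUnit.unit) (isoOne.naturality f)  }
  let a₀ : 𝟙_ SSet.{v} ⟶ U := { app n := TypeCat.ofHom fun _ => ⟨false⟩ }
  let a₁ : 𝟙_ SSet.{v} ⟶ U := { app n := TypeCat.ofHom fun _ => ⟨true⟩ }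
  refine ⟨U, i, ?_, a₀, a₁, rfl, rfl, fun {W Q} f g => ?_, fun {W Q d e} h₀ h₁ => ?_⟩
  · have (n : SimplexCategoryᵒᵖ) : Mono (i.app n) := by
      refine (mono_iff_injective _).2 ?_
      rintro ⟨⟨⟩⟩ ⟨⟨⟩⟩ h
      · rfl
      · exact (isoZero_app_ne_isoOne_app n PUnit.unit PUnit.unit h).elim
      · exact (isoZero_app_ne_isoOne_app n PUnit.unit PUnit.unit h.symm).elim
      · rfl
    exact NatTrans.mono_of_mono_app i
  · refine ⟨{ app n := TypeCat.ofHom fun x : ULift Bool × W.obj n =>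
        if x.1.down then g.app n (PUnit.unit, x.2) else f.app n (PUnit.unit, x.2)
              naturality m n k := ?_}, ?_, ?_⟩
    · ext ⟨⟨b⟩, x⟩
      cases b
      · exact congrArg (fun t => t (PUnit.unit, x)) (f.naturality k)
      · exact congrArg (fun t => t (PUnit.unit, x)) (g.naturality k)
    · ext n ⟨⟨⟩, x⟩
      rfl
    · ext n ⟨⟨⟩, x⟩
      rfl
  · ext n ⟨⟨b⟩, x⟩
    cases b
    · exact congrArg (fun t => t.app n (PUnit.unit, x)) h₀
    · exact congrArg (fun t => t.app n (PUnit.unit, x)) h₁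

namespace IsInfinityCosmos

variable {K : Type u} [Category.{v} K] [SimplicialCategory K] {I : MorphismProperty K}

/-- An isofibration has the right lifting property, in the enriched sense, against the
Leibniz product of a monomorphism and an endpoint inclusion. -/
lemma exists_lift (hK : IsInfinityCosmos K I) {U V : SSet.{v}} (i : U ⟶ V) [Mono i] {X E B : K}
    {p : E ⟶ B} (hp : I p) (a : U ⊗ SSet.coherentIso ⟶ (X ⟶[SSet.{v}] E))
    (b : V ⊗ SSet.coherentIso ⟶ (X ⟶[SSet.{v}] B)) (c : V ⊗ 𝟙_ SSet.{v} ⟶ (X ⟶[SSet.{v}] E))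
    (hab : a ≫ eHomWhiskerLeft SSet.{v} X p = i ▷ _ ≫ b) (hac : U ◁ isoZero ≫ a = i ▷ _ ≫ c)
    (hbc : V ◁ isoZero ≫ b = c ≫ eHomWhiskerLeft SSet.{v} X p) :
    ∃ G : V ⊗ SSet.coherentIso ⟶ (X ⟶[SSet.{v}] E),
      i ▷ _ ≫ G = a ∧ G ≫ eHomWhiskerLeft SSet.{v} X p = b ∧ V ◁ isoZero ≫ G = c := by
  obtain ⟨EV, hEV⟩ := hK.cotensors V E
  obtain ⟨EU, hEU⟩ := hK.cotensors U E
  obtain ⟨BV, hBV⟩ := hK.cotensors V B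
  obtain ⟨BU, hBU⟩ := hK.cotensors U B
  obtain ⟨Ei, hEi⟩ := hEU.exists_map i (𝟙 E) EV
  obtain ⟨pV, hpV⟩ := hBV.exists_map (𝟙 V) p EV
  obtain ⟨pU, hpU⟩ := hBU.exists_map (𝟙 U) p EU
  obtain ⟨Bi, hBi⟩ := hBU.exists_map i (𝟙 B) BV
  have hpU' : I pU := hK.isofibration_cotensor hp hEU hBU hpU
  have := hK.hasPullback Bi hpU'
  have hP := (IsPullback.of_hasPullback Bi pU).flip
  set fst := pullback.snd Bi pU
  set snd := pullback.fst Bi pU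
  have w : Ei ≫ pU = pV ≫ Bi := by
    refine IsCotensorMap.eq (i := i) (p := p) ?_ ?_ hBU
    · simpa only [Category.comp_id, Category.id_comp] using hEi.comp hpU
    · simpa only [Category.comp_id, Category.id_comp] using hpV.comp hBi
  obtain ⟨l, l₁, l₂⟩ : ∃ l : EV.pt ⟶ pullback Bi pU, l ≫ fst = Ei ∧ l ≫ snd = pV :=
    ⟨hP.lift _ _ w, hP.lift_fst _ _ _, hP.lift_snd _ _ _⟩
  have hl : I l := hK.isofibration_leibniz p hp i EV EU BV BU hEV hEU hBV hBU Ei pV pU Bi hEi hpV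
    hpU hBi hP l l₁ l₂
  have := (hK.isofibration_fun X l hl).hasLiftingProperty_isoZero
  have hXP := (hK.whiskerLeft_isPullback hP.flip hpU' X).flip
  obtain ⟨a', ha', -⟩ := EU.isCotensor_iff.1 hEU X _ a
  obtain ⟨b', hb', -⟩ := BV.isCotensor_iff.1 hBV X _ b
  obtain ⟨c', hc', -⟩ := EV.isCotensor_iff.1 hEV X _ c
  have hEi' := hEi.whiskerLeft_ev X
  have hpV' := hpV.whiskerLeft_ev X
  have hpU'' := hpU.whiskerLeft_ev X
  have hBi' := hBi.whiskerLeft_ev X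
  rw [eHomWhiskerLeft_id, Category.comp_id] at hEi' hBi'
  rw [id_whiskerRight, Category.id_comp] at hpV' hpU''
  have w₁ : a' ≫ eHomWhiskerLeft SSet.{v} X pU = b' ≫ eHomWhiskerLeft SSet.{v} X Bi := by
    refine (BU.isCotensor_iff.1 hBU X _ _).unique rfl ?_
    rw [MonoidalCategory.whiskerLeft_comp_assoc, MonoidalCategory.whiskerLeft_comp_assoc, hBi',
      hpU'', reassoc_of% ha', whisker_exchange_assoc, hb', hab]
  obtain ⟨d, d₁, d₂⟩ : ∃ d, d ≫ eHomWhiskerLeft SSet.{v} X fst = a' ∧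
      d ≫ eHomWhiskerLeft SSet.{v} X snd = b' :=
    ⟨hXP.lift _ _ w₁, hXP.lift_fst _ _ _, hXP.lift_snd _ _ _⟩
  -- By transposition the lifting problem becomes one of `isoZero` against `Fun(X, l)`, where `l` is
  -- the Leibniz cotensor of `i` and `p`.
  have sq : CommSq c' isoZero (eHomWhiskerLeft SSet.{v} X l) d := by
    refine ⟨hXP.hom_ext ?_ ?_⟩
    · rw [Category.assoc, Category.assoc, ← eHomWhiskerLeft_comp, l₁, d₁]
      refine (EU.isCotensor_iff.1 hEU X _ _).unique rfl ?_
      rw [MonoidalCategory.whiskerLeft_comp_assoc, MonoidalCategory.whiskerLeft_comp_assoc, hEi',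
        ha', hac, whisker_exchange_assoc, hc']
    · rw [Category.assoc, Category.assoc, ← eHomWhiskerLeft_comp, l₂, d₂]
      refine (BV.isCotensor_iff.1 hBV X _ _).unique rfl ?_
      rw [MonoidalCategory.whiskerLeft_comp_assoc, MonoidalCategory.whiskerLeft_comp_assoc, hpV',
        hb', hbc, reassoc_of% hc']
  refine ⟨V ◁ sq.lift ≫ EV.ev X, ?_, ?_, ?_⟩
  · rw [← whisker_exchange_assoc, ← hEi', ← l₁, eHomWhiskerLeft_comp,
      ← MonoidalCategory.whiskerLeft_comp_assoc, sq.fac_right_assoc, d₁, ha']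
  · rw [Category.assoc, ← hpV', ← l₂, eHomWhiskerLeft_comp,
      ← MonoidalCategory.whiskerLeft_comp_assoc, sq.fac_right_assoc, d₂, hb']
  · rw [← MonoidalCategory.whiskerLeft_comp_assoc, sq.fac_left, hc']

open CartesianMonoidalCategory in
/-- Two paths with the same start and the same image in the base of an isofibration are related
by a path between their ends in the fibre. -/
lemma exists_fibre_path (hK : IsInfinityCosmos K I) {X E B : K} {p : E ⟶ B} (hp : I p)
    (α β : SSet.coherentIso ⟶ (X ⟶[SSet.{v}] E)) (h₀ : isoZero ≫ α = isoZero ≫ β)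
    (h : α ≫ eHomWhiskerLeft SSet.{v} X p = β ≫ eHomWhiskerLeft SSet.{v} X p) :
    ∃ γ : SSet.coherentIso ⟶ (X ⟶[SSet.{v}] E), isoZero ≫ γ = isoOne ≫ α ∧
      isoOne ≫ γ = isoOne ≫ β ∧
      γ ≫ eHomWhiskerLeft SSet.{v} X p =
        toUnit _ ≫ isoOne ≫ α ≫ eHomWhiskerLeft SSet.{v} X p := by
  -- Fill a square `G(s, t)` with `G(0, t) = α t`, `G(1, t) = β t`, the edge `t = 0` constant, and
  -- image in the base independent of `s`. The path sought is the remaining edge `t = 1`.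
  obtain ⟨U, i, _, a₀, a₁, e₀, e₁, hU, hU'⟩ := exists_endpoints_inclusion.{v}
  obtain ⟨a, ha₀, ha₁⟩ := hU ((λ_ _).hom ≫ α) ((λ_ _).hom ≫ β)
  have w₁ : a ≫ eHomWhiskerLeft SSet.{v} X p =
      i ▷ _ ≫ snd _ _ ≫ α ≫ eHomWhiskerLeft SSet.{v} X p := by
    refine hU' ?_ ?_
    · rw [reassoc_of% ha₀, ← comp_whiskerRight_assoc, whiskerRight_snd_assoc, leftUnitor_hom]
    · rw [reassoc_of% ha₁, ← comp_whiskerRight_assoc, whiskerRight_snd_assoc, leftUnitor_hom,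
        h]
  have w₂ : U ◁ isoZero ≫ a = i ▷ _ ≫ snd _ _ ≫ isoZero ≫ α := by
    refine hU' ?_ ?_
    · rw [← whisker_exchange_assoc, ha₀, ← comp_whiskerRight_assoc, whiskerRight_snd_assoc,
        leftUnitor_hom, whiskerLeft_snd_assoc]
    · rw [← whisker_exchange_assoc, ha₁, ← comp_whiskerRight_assoc, whiskerRight_snd_assoc,
        leftUnitor_hom, whiskerLeft_snd_assoc, h₀]
  obtain ⟨G, hG₁, hG₂, -⟩ := hK.exists_lift i hp a (snd _ _ ≫ α ≫ eHomWhiskerLeft SSet.{v} X p)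
    (snd _ _ ≫ isoZero ≫ α) w₁ w₂ (by simp)
  have key (x : 𝟙_ SSet.{v} ⟶ SSet.coherentIso) (y : 𝟙_ SSet.{v} ⟶ U) (hy : y ≫ i = x) :
      x ≫ lift (𝟙 _) (toUnit _ ≫ isoOne) ≫ G = isoOne ≫ (λ_ _).inv ≫ y ▷ _ ≫ a := by
    rw [← hG₁, ← comp_whiskerRight_assoc, hy]
    simp only [← Category.assoc]
    congr 1
  refine ⟨lift (𝟙 _) (toUnit _ ≫ isoOne) ≫ G, ?_, ?_, ?_⟩
  · rw [key _ _ e₀, ha₀, Iso.inv_hom_id_assoc]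
  · rw [key _ _ e₁, ha₁, Iso.inv_hom_id_assoc]
  · rw [Category.assoc, hG₂, lift_snd_assoc, Category.assoc]

end IsInfinityCosmos

/-! ### Homotopies -/

section Homotopic

variable {C : Type u} [Category.{v} C] [SimplicialCategory C]

/-- Two maps are homotopic if there is a path between them parametrised by the free-standing
isomorphism. -/
def Homotopic : HomRel C := fun A B f g =>
  ∃ H : SSet.coherentIso ⟶ (A ⟶[SSet.{v}] B),
    isoZero ≫ H = eHomEquiv SSet.{v} f ∧ isoOne ≫ H = eHomEquiv SSet.{v} g

namespace Homotopic

variable {A B D : C}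

open CartesianMonoidalCategory in
lemma refl (f : A ⟶ B) : Homotopic f f :=
  ⟨toUnit _ ≫ eHomEquiv SSet.{v} f, by simp, by simp⟩

lemma comp_left (f : A ⟶ B) {g g' : B ⟶ D} (h : Homotopic g g') : Homotopic (f ≫ g) (f ≫ g') := by
  obtain ⟨H, h₀, h₁⟩ := h
  exact ⟨H ≫ eHomWhiskerRight SSet.{v} f D,
    by rw [reassoc_of% h₀, eHomEquiv_comp_eHomWhiskerRight],
    by rw [reassoc_of% h₁, eHomEquiv_comp_eHomWhiskerRight]⟩

lemma comp_right {f f' : A ⟶ B} (h : Homotopic f f') (g : B ⟶ D) : Homotopic (f ≫ g) (f' ≫ g) := by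
  obtain ⟨H, h₀, h₁⟩ := h
  exact ⟨H ≫ eHomWhiskerLeft SSet.{v} A g,
    by rw [reassoc_of% h₀, eHomEquiv_comp_eHomWhiskerLeft],
    by rw [reassoc_of% h₁, eHomEquiv_comp_eHomWhiskerLeft]⟩

end Homotopic

instance : HomRel.IsStableUnderPrecomp (Homotopic (C := C)) where
  comp_left f _ _ h := h.comp_left f

instance : HomRel.IsStableUnderPostcomp (Homotopic (C := C)) where
  comp_right g h := h.comp_right g

end Homotopic

section

open CartesianMonoidalCategory

lemma IsIsoHomotopic.exists_path {X Y : SSet.{v}} {f g : X ⟶ Y} (h : IsIsoHomotopic f g)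
    (x : 𝟙_ SSet.{v} ⟶ X) : ∃ L : SSet.coherentIso ⟶ Y, isoZero ≫ L = x ≫ f ∧
      isoOne ≫ L = x ≫ g := by
  obtain ⟨H, h₀, h₁⟩ := h
  have key (z : 𝟙_ SSet.{v} ⟶ SSet.coherentIso) :
      z ≫ lift (toUnit _ ≫ x) (𝟙 _) ≫ H = x ≫ lift (𝟙 _) (toUnit _ ≫ z) ≫ H := by
    simp only [← Category.assoc]
    congr 1
  exact ⟨lift (toUnit _ ≫ x) (𝟙 _) ≫ H, (key _).trans (congrArg (x ≫ ·) h₀),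
    (key _).trans (congrArg (x ≫ ·) h₁)⟩

lemma lift_const_eq (X : SSet.{v}) {Y : SSet.{v}} (y : 𝟙_ SSet.{v} ⟶ Y)
    {Z : SSet.{v}} (f : X ⊗ Y ⟶ Z) :
    lift (𝟙 X) (toUnit _ ≫ y) ≫ f = (ρ_ X).inv ≫ X ◁ y ≫ f := by
  simp only [← Category.assoc]
  congr 1

/-- A path in `Fun(A, B)` acts on every `Fun(X, A)` by composition. -/
lemma isIsoHomotopic_of_path {C : Type u} [Category.{v} C] [SimplicialCategory C] {X A B : C}
    (H : SSet.coherentIso ⟶ (A ⟶[SSet.{v}] B)) {f g : (X ⟶[SSet.{v}] A) ⟶ (X ⟶[SSet.{v}] B)}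
    (hf : (ρ_ _).inv ≫ _ ◁ (isoZero ≫ H) ≫ eComp SSet.{v} X A B = f)
    (hg : (ρ_ _).inv ≫ _ ◁ (isoOne ≫ H) ≫ eComp SSet.{v} X A B = g) : IsIsoHomotopic f g := by
  refine ⟨_ ◁ H ≫ eComp SSet.{v} X A B, ?_, ?_⟩
  · rw [← hf, MonoidalCategory.whiskerLeft_comp, Category.assoc, ← lift_const_eq]
    rfl
  · rw [← hg, MonoidalCategory.whiskerLeft_comp, Category.assoc, ← lift_const_eq]
    rfl

end

/-! ### Homotopy is a congruence, and equivalences are homotopy equivalences -/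

namespace IsInfinityCosmos

variable {K : Type u} [Category.{v} K] [SimplicialCategory K] {I : MorphismProperty K}

/-- Over a terminal object the condition on images in `exists_fibre_path` is vacuous, which gives
its absolute version. -/
lemma exists_isofibration_subsingleton (hK : IsInfinityCosmos K I) (A : K) : ∃ (T : K) (t : A ⟶ T),
    I t ∧ ∀ (X : K) (W : SSet.{v}) (f g : W ⟶ (X ⟶[SSet.{v}] T)), f = g := by
  have := hK.hasConicalLimit_of_isEmpty (Functor.empty K)
  have h := isConicalLimit_of_isLimit (limit.isLimit (Functor.empty K))
  obtain ⟨hT⟩ := nonempty_isTerminal_of_isLimit h.isLimit.some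
  refine ⟨_, hT.from A, hK.isofibration_terminal hT _, fun X W f g => ?_⟩
  obtain ⟨hX⟩ := nonempty_isTerminal_of_isLimit (h.isLimit_eCoyoneda X).some
  exact hX.hom_ext f g

/-- Two paths with a common start have ends joined by a path. Together with reflexivity this
Euclidean property yields symmetry and transitivity. -/
lemma homotopic_of_homotopic (hK : IsInfinityCosmos K I) {A B : K} {f g h : A ⟶ B}
    (hg : Homotopic f g) (hh : Homotopic f h) : Homotopic g h := by
  obtain ⟨α, α₀, α₁⟩ := hg
  obtain ⟨β, β₀, β₁⟩ := hh
  obtain ⟨T, t, ht, hT⟩ := hK.exists_isofibration_subsingleton B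
  obtain ⟨γ, γ₀, γ₁, -⟩ := hK.exists_fibre_path ht α β (α₀.trans β₀.symm) (hT _ _ _ _)
  exact ⟨γ, γ₀.trans α₁, γ₁.trans β₁⟩

lemma homotopic_symm (hK : IsInfinityCosmos K I) {A B : K} {f g : A ⟶ B} (h : Homotopic f g) :
    Homotopic g f :=
  hK.homotopic_of_homotopic h (.refl f)

lemma homotopic_trans (hK : IsInfinityCosmos K I) {A B : K} {f g h : A ⟶ B} (hfg : Homotopic f g)
    (hgh : Homotopic g h) : Homotopic f h :=
  hK.homotopic_of_homotopic (hK.homotopic_symm hfg) hgh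

lemma congruence (hK : IsInfinityCosmos K I) : Congruence (Homotopic (C := K)) where
  equivalence := ⟨.refl, hK.homotopic_symm, hK.homotopic_trans⟩

lemma equivalences_iff_exists (hK : IsInfinityCosmos K I) {A B : K} (f : A ⟶ B) :
    equivalences K f ↔ ∃ g : B ⟶ A, Homotopic (𝟙 A) (f ≫ g) ∧ Homotopic (g ≫ f) (𝟙 B) := by
  constructor
  · intro h
    have key {X Y : K} (x : 𝟙_ SSet.{v} ⟶ (X ⟶[SSet.{v}] Y)) : ∃ g, eHomEquiv SSet.{v} g = x :=
      ⟨_, Equiv.apply_symm_apply _ _⟩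
    -- The inverse `g` is the image of `𝟙 B` under an inverse of `Fun(B, f)`.
    obtain ⟨r, -, hr⟩ := h B
    obtain ⟨g, hg⟩ := key (eHomEquiv SSet.{v} (𝟙 B) ≫ r)
    have hgf : Homotopic (g ≫ f) (𝟙 B) := by
      obtain ⟨L, h₀, h₁⟩ := hr.exists_path (eHomEquiv SSet.{v} (𝟙 B))
      refine ⟨L, h₀.trans ?_, h₁.trans (Category.comp_id _)⟩
      rw [← eHomEquiv_comp_eHomWhiskerLeft, hg, Category.assoc]
    refine ⟨g, ?_, hgf⟩
    obtain ⟨r', hr', -⟩ := h A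
    have hr'' (a : A ⟶ A) (b : A ⟶ A)
        (hb : eHomEquiv SSet.{v} b = eHomEquiv SSet.{v} (a ≫ f) ≫ r') : Homotopic a b := by
      obtain ⟨L, h₀, h₁⟩ := hr'.exists_path (eHomEquiv SSet.{v} a)
      refine ⟨L, h₀.trans (Category.comp_id _), h₁.trans ?_⟩
      rw [hb, ← eHomEquiv_comp_eHomWhiskerLeft, Category.assoc]
    -- With `r'` inverse to `Fun(A, f)`, the path from `f ≫ g ≫ f` to `f` is carried to one from `n`
    -- to `m`, while `m` is homotopic to `𝟙 A` and `n` to `f ≫ g`. This avoids any naturality of the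
    -- chosen inverses.
    obtain ⟨m, hm⟩ := key (eHomEquiv SSet.{v} (𝟙 A ≫ f) ≫ r')
    obtain ⟨n, hn⟩ := key (eHomEquiv SSet.{v} ((f ≫ g) ≫ f) ≫ r')
    obtain ⟨Q, h₀, h₁⟩ := hgf.comp_left f
    have hnm : Homotopic n m := by
      refine ⟨Q ≫ r', ?_, ?_⟩
      · rw [reassoc_of% h₀, hn, Category.assoc]
      · rw [reassoc_of% h₁, hm, Category.id_comp]
    exact hK.homotopic_trans (hr'' _ _ hm)
      (hK.homotopic_symm (hK.homotopic_trans (hr'' _ _ hn) hnm))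
  · rintro ⟨g, ⟨H, h₀, h₁⟩, ⟨H', h₀', h₁'⟩⟩ X
    refine ⟨eHomWhiskerLeft SSet.{v} X g, isIsoHomotopic_of_path H ?_ ?_,
      isIsoHomotopic_of_path H' ?_ ?_⟩
    · rw [h₀, ← eHomWhiskerLeft_id]; rfl
    · rw [h₁, ← eHomWhiskerLeft_comp]; rfl
    · rw [h₀', ← eHomWhiskerLeft_comp]; rfl
    · rw [h₁', ← eHomWhiskerLeft_id]; rfl

end IsInfinityCosmos

/-! ### Equivalences and trivial fibrations -/

namespace IsInfinityCosmos

variable {K : Type u} [Category.{v} K] [SimplicialCategory K] {I : MorphismProperty K}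

lemma functor_map_eq (hK : IsInfinityCosmos K I) {A B : K} {f g : A ⟶ B} :
    (Quotient.functor (Homotopic (C := K))).map f = (Quotient.functor Homotopic).map g ↔
      Homotopic f g := by
  have := hK.congruence
  exact Quotient.functor_map_eq_iff _ _ _

/-- The equivalences are the maps that become invertible in the homotopy category. -/
lemma equivalences_eq (hK : IsInfinityCosmos K I) : equivalences K =
    (MorphismProperty.isomorphisms _).inverseImage (Quotient.functor (Homotopic (C := K))) := by
  ext A B f
  rw [hK.equivalences_iff_exists, MorphismProperty.inverseImage_iff,
    MorphismProperty.isomorphisms.iff]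
  constructor
  · rintro ⟨g, h₀, h₁⟩
    refine ⟨(Quotient.functor Homotopic).map g, ?_, ?_⟩
    · rw [← Functor.map_comp, ← CategoryTheory.Functor.map_id]
      exact (hK.functor_map_eq.2 h₀).symm
    · rw [← Functor.map_comp, ← CategoryTheory.Functor.map_id]
      exact hK.functor_map_eq.2 h₁
  · intro h
    obtain ⟨g, hg⟩ := (Quotient.functor (Homotopic (C := K))).map_surjective
      (inv ((Quotient.functor Homotopic).map f))
    refine ⟨g, hK.functor_map_eq.1 ?_, hK.functor_map_eq.1 ?_⟩
    · rw [Functor.map_comp, CategoryTheory.Functor.map_id, hg, IsIso.hom_inv_id]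
    · rw [Functor.map_comp, CategoryTheory.Functor.map_id, hg, IsIso.inv_hom_id]

lemma hasTwoOutOfThreeProperty (hK : IsInfinityCosmos K I) :
    (equivalences K).HasTwoOutOfThreeProperty := by
  rw [hK.equivalences_eq]
  infer_instance

lemma equivalences_of_homotopic (hK : IsInfinityCosmos K I) {A B : K} {f g : A ⟶ B}
    (h : Homotopic f g) (hf : equivalences K f) : equivalences K g := by
  rw [hK.equivalences_eq, MorphismProperty.inverseImage_iff] at hf ⊢
  rwa [← hK.functor_map_eq.2 h]

lemma equivalences_of_homotopic_id (hK : IsInfinityCosmos K I) {A : K} {f : A ⟶ A}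
    (h : Homotopic f (𝟙 A)) : equivalences K f := by
  refine hK.equivalences_of_homotopic (hK.homotopic_symm h)
    ((hK.equivalences_iff_exists _).2 ⟨𝟙 A, ?_, ?_⟩) <;>
  · rw [Category.comp_id]
    exact .refl _

/-- The equivalences have the two-out-of-six property. -/
lemma equivalences_of_comp_of_comp (hK : IsInfinityCosmos K I) {A B C D : K} {f : A ⟶ B}
    {g : B ⟶ C} {h : C ⟶ D} (hfg : equivalences K (f ≫ g)) (hgh : equivalences K (g ≫ h)) :
    equivalences K g ∧ equivalences K h := by
  have := hK.hasTwoOutOfThreeProperty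
  have hg : equivalences K g := by
    rw [hK.equivalences_eq, MorphismProperty.inverseImage_iff,
      MorphismProperty.isomorphisms.iff] at hfg hgh ⊢
    rw [CategoryTheory.Functor.map_comp] at hfg hgh
    -- In the homotopy category `g` is split epi because `f ≫ g` is invertible, and mono because `g
    -- ≫ h` is.
    have := IsSplitEpi.mk' (f := (Quotient.functor Homotopic).map g)
      ⟨inv ((Quotient.functor Homotopic).map f ≫ (Quotient.functor Homotopic).map g) ≫
        (Quotient.functor Homotopic).map f, by simp⟩
    have := mono_of_mono ((Quotient.functor Homotopic).map g) ((Quotient.functor Homotopic).map h)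
    exact isIso_of_mono_of_isSplitEpi _
  exact ⟨hg, (equivalences K).of_precomp _ _ hg hgh⟩

/-- Paths lift along isofibrations. -/
lemma exists_path_lift (hK : IsInfinityCosmos K I) {X E B : K} {p : E ⟶ B} (hp : I p) (e : X ⟶ E)
    (Φ : SSet.coherentIso ⟶ (X ⟶[SSet.{v}] B)) (h : isoZero ≫ Φ = eHomEquiv SSet.{v} (e ≫ p)) :
    ∃ (e' : X ⟶ E) (Ψ : SSet.coherentIso ⟶ (X ⟶[SSet.{v}] E)),
      isoZero ≫ Ψ = eHomEquiv SSet.{v} e ∧ isoOne ≫ Ψ = eHomEquiv SSet.{v} e' ∧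
      Ψ ≫ eHomWhiskerLeft SSet.{v} X p = Φ := by
  have := (hK.isofibration_fun X p hp).hasLiftingProperty_isoZero
  have sq : CommSq (eHomEquiv SSet.{v} e) isoZero (eHomWhiskerLeft SSet.{v} X p) Φ :=
    ⟨by rw [eHomEquiv_comp_eHomWhiskerLeft, h]⟩
  exact ⟨(eHomEquiv SSet.{v}).symm (isoOne ≫ sq.lift), sq.lift, sq.fac_left, by simp, sq.fac_right⟩

lemma exists_lift_of_homotopic (hK : IsInfinityCosmos K I) {X E B : K} {p : E ⟶ B} (hp : I p)
    {e : X ⟶ E} {b : X ⟶ B} (h : Homotopic (e ≫ p) b) : ∃ e', Homotopic e e' ∧ e' ≫ p = b := by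
  obtain ⟨Φ, h₀, h₁⟩ := h
  obtain ⟨e', Ψ, k₀, k₁, k⟩ := hK.exists_path_lift hp e Φ h₀
  refine ⟨e', ⟨Ψ, k₀, k₁⟩, (eHomEquiv SSet.{v}).injective ?_⟩
  rw [← eHomEquiv_comp_eHomWhiskerLeft, ← k₁, Category.assoc, k, h₁]

open CartesianMonoidalCategory in
/-- A trivial fibration has a section that is a fibrewise homotopy inverse. -/
lemma trivialFibrations_iff_exists (hK : IsInfinityCosmos K I) {E B : K} (f : E ⟶ B) :
    trivialFibrations I f ↔ I f ∧ ∃ (t : B ⟶ E) (γ : SSet.coherentIso ⟶ (E ⟶[SSet.{v}] E)),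
      t ≫ f = 𝟙 B ∧ isoZero ≫ γ = eHomEquiv SSet.{v} (𝟙 E) ∧
      isoOne ≫ γ = eHomEquiv SSet.{v} (f ≫ t) ∧
      γ ≫ eHomWhiskerLeft SSet.{v} E f = toUnit _ ≫ eHomEquiv SSet.{v} f := by
  refine and_congr_right fun hf => ⟨fun h => ?_, ?_⟩
  · obtain ⟨g, h₀, h₁⟩ := (hK.equivalences_iff_exists f).1 h
    -- Lifting the homotopy from `g ≫ f` to `𝟙 B` turns the homotopy inverse into a strict section.
    obtain ⟨t, hgt, ht⟩ := hK.exists_lift_of_homotopic hf h₁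
    obtain ⟨H, H₀, H₁⟩ := hK.homotopic_symm (hK.homotopic_trans h₀ (hgt.comp_left f))
    -- `H` and its composite with `f ≫ t` both start at `f ≫ t` and, since `t ≫ f = 𝟙 B`, have the
    -- same image under `f`. Their ends `𝟙 E` and `f ≫ t` are therefore joined by a path in the
    -- fibre.
    obtain ⟨γ, γ₀, γ₁, hγ⟩ := hK.exists_fibre_path hf H (H ≫ eHomWhiskerLeft SSet.{v} E (f ≫ t))
      (by rw [reassoc_of% H₀, H₀, eHomEquiv_comp_eHomWhiskerLeft, Category.assoc, reassoc_of% ht])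
      (by rw [Category.assoc, ← eHomWhiskerLeft_comp, Category.assoc, ht, Category.comp_id])
    refine ⟨t, γ, ht, γ₀.trans H₁, ?_, ?_⟩
    · rw [γ₁, reassoc_of% H₁, eHomEquiv_comp_eHomWhiskerLeft, Category.id_comp]
    · rw [hγ, reassoc_of% H₁, eHomEquiv_comp_eHomWhiskerLeft, Category.id_comp]
  · rintro ⟨t, γ, ht, h₀, h₁, -⟩
    refine (hK.equivalences_iff_exists f).2 ⟨t, ⟨γ, h₀, h₁⟩, ?_⟩
    rw [ht]
    exact .refl _

open CartesianMonoidalCategory in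
-- A section and a homotopy that is constant over the base can both be pulled back; an arbitrary
-- homotopy inverse could not.
lemma trivialFibrations_isStableUnderBaseChange (hK : IsInfinityCosmos K I) :
    (trivialFibrations I).IsStableUnderBaseChange := ⟨by
  intro X E P B f h g' f' sq hf
  have := hK.isofibration_pullback
  rw [hK.trivialFibrations_iff_exists] at hf ⊢
  obtain ⟨hI, t, γ, ht, h₀, h₁, hγ⟩ := hf
  refine ⟨MorphismProperty.of_isPullback sq hI, ?_⟩
  obtain ⟨t', t₁, t₂⟩ : ∃ t', t' ≫ g' = f ≫ t ∧ t' ≫ f' = 𝟙 X :=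
    ⟨sq.lift (f ≫ t) (𝟙 X) (by simp [ht]), sq.lift_fst _ _ _, sq.lift_snd _ _ _⟩
  have hP := (hK.whiskerLeft_isPullback sq.flip hI P).flip
  obtain ⟨δ, δ₁, δ₂⟩ : ∃ δ, δ ≫ eHomWhiskerLeft SSet.{v} P g' =
        γ ≫ eHomWhiskerRight SSet.{v} g' E ∧
      δ ≫ eHomWhiskerLeft SSet.{v} P f' = toUnit _ ≫ eHomEquiv SSet.{v} f' :=
    ⟨hP.lift _ _ (by
      rw [Category.assoc, ← eHom_whisker_exchange, reassoc_of% hγ,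
        eHomEquiv_comp_eHomWhiskerRight, Category.assoc, eHomEquiv_comp_eHomWhiskerLeft, sq.w]),
      hP.lift_fst _ _ _, hP.lift_snd _ _ _⟩
  refine ⟨t', δ, t₂, hP.hom_ext ?_ ?_, hP.hom_ext ?_ ?_, δ₂⟩
  · rw [Category.assoc, δ₁, reassoc_of% h₀, eHomEquiv_comp_eHomWhiskerRight,
      eHomEquiv_comp_eHomWhiskerLeft]
    simp
  · rw [Category.assoc, δ₂, eHomEquiv_comp_eHomWhiskerLeft]
    simp
  · rw [Category.assoc, δ₁, reassoc_of% h₁, eHomEquiv_comp_eHomWhiskerRight,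
      eHomEquiv_comp_eHomWhiskerLeft, Category.assoc, t₁, sq.w_assoc]
  · rw [Category.assoc, δ₂, eHomEquiv_comp_eHomWhiskerLeft, Category.assoc, t₂]
    simp⟩

end IsInfinityCosmos

/-! ### Equivalences and trivial fibrations between isofibrations -/

namespace IsofibArrow

open CartesianMonoidalCategory

variable {K : Type u} [Category.{v} K] [SimplicialCategory K] {I : MorphismProperty K}

lemma homotopic_components {p q : IsofibArrow I} {s t : p ⟶ q} (h : Homotopic s t) :
    Homotopic s.hom.left t.hom.left ∧ Homotopic s.hom.right t.hom.right := by
  obtain ⟨H, h₀, h₁⟩ := h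
  exact ⟨⟨H ≫ homDom p q, by rw [reassoc_of% h₀, eHomEquiv_homDom],
    by rw [reassoc_of% h₁, eHomEquiv_homDom]⟩, ⟨H ≫ homCod p q,
    by rw [reassoc_of% h₀, eHomEquiv_homCod], by rw [reassoc_of% h₁, eHomEquiv_homCod]⟩⟩

/-- Compatible paths between the components of two squares. -/
lemma homotopic_of_components {p q : IsofibArrow I} {s t : p ⟶ q}
    (α : SSet.coherentIso ⟶ (p.obj.left ⟶[SSet.{v}] q.obj.left))
    (β : SSet.coherentIso ⟶ (p.obj.right ⟶[SSet.{v}] q.obj.right))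
    (h : α ≫ eHomWhiskerLeft SSet.{v} p.obj.left q.obj.hom =
      β ≫ eHomWhiskerRight SSet.{v} p.obj.hom q.obj.right)
    (α₀ : isoZero ≫ α = eHomEquiv SSet.{v} s.hom.left)
    (α₁ : isoOne ≫ α = eHomEquiv SSet.{v} t.hom.left)
    (β₀ : isoZero ≫ β = eHomEquiv SSet.{v} s.hom.right)
    (β₁ : isoOne ≫ β = eHomEquiv SSet.{v} t.hom.right) : Homotopic s t := by
  have hpq := hom_isPullback p q
  refine ⟨hpq.lift α β h, hpq.hom_ext ?_ ?_, hpq.hom_ext ?_ ?_⟩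
  · rw [Category.assoc, hpq.lift_fst, α₀, eHomEquiv_homDom]
  · rw [Category.assoc, hpq.lift_snd, β₀, eHomEquiv_homCod]
  · rw [Category.assoc, hpq.lift_fst, α₁, eHomEquiv_homDom]
  · rw [Category.assoc, hpq.lift_snd, β₁, eHomEquiv_homCod]

/-- The square over the identity of the codomain given by an endomorphism over the codomain. -/
abbrev fibreEnd (p : IsofibArrow I) (k : p.obj.left ⟶ p.obj.left) (hk : k ≫ p.obj.hom = p.obj.hom) :
    p ⟶ p :=
  ObjectProperty.homMk (Arrow.homMk k (𝟙 p.obj.right) (hk.trans (Category.comp_id _).symm))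

/-- Dold's argument. The homotopy `H` from `k` to the identity need not lie over the codomain.
Lifting its image from the identity gives a path `M` to some `m` over the same image, and `m`
corrects the drift of `H`. -/
lemma exists_homotopic_fibreEnd_comp (hK : IsInfinityCosmos K I) (p : IsofibArrow I)
    (k : p.obj.left ⟶ p.obj.left) (hk : k ≫ p.obj.hom = p.obj.hom) (h : Homotopic k (𝟙 _)) :
    ∃ (m : p.obj.left ⟶ p.obj.left) (hm : m ≫ p.obj.hom = p.obj.hom), Homotopic m (𝟙 _) ∧
      Homotopic (fibreEnd p m hm ≫ fibreEnd p k hk) (𝟙 p) := by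
  obtain ⟨H, H₀, H₁⟩ := h
  obtain ⟨m, M, M₀, M₁, hM⟩ := hK.exists_path_lift p.property (𝟙 _)
    (H ≫ eHomWhiskerLeft SSet.{v} p.obj.left p.obj.hom)
    (by rw [reassoc_of% H₀, eHomEquiv_comp_eHomWhiskerLeft, hk, Category.id_comp])
  have hm : m ≫ p.obj.hom = p.obj.hom := (eHomEquiv SSet.{v}).injective (by
    rw [← eHomEquiv_comp_eHomWhiskerLeft, ← M₁, Category.assoc, hM, reassoc_of% H₁,
      eHomEquiv_comp_eHomWhiskerLeft, Category.id_comp])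
  -- `M` followed by `k` runs from `k` to `m ≫ k`, and `H` from `k` to the identity, with the same
  -- image in the codomain; so their ends are homotopic in the fibre.
  obtain ⟨γ, γ₀, γ₁, hγ⟩ := hK.exists_fibre_path p.property
    (M ≫ eHomWhiskerLeft SSet.{v} p.obj.left k) H
    (by rw [reassoc_of% M₀, eHomEquiv_comp_eHomWhiskerLeft, H₀, Category.id_comp])
    (by rw [Category.assoc, ← eHomWhiskerLeft_comp, hk, hM])
  refine ⟨m, hm, hK.homotopic_symm ⟨M, M₀, M₁⟩, homotopic_of_components γ
    (toUnit _ ≫ eHomEquiv SSet.{v} (𝟙 _)) ?_ ?_ ?_ ?_ ?_⟩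
  · rw [hγ, Category.assoc, reassoc_of% M₁, ← eHomWhiskerLeft_comp, hk,
      eHomEquiv_comp_eHomWhiskerLeft, hm, Category.assoc, eHomEquiv_comp_eHomWhiskerRight,
      Category.comp_id]
  · rw [γ₀, reassoc_of% M₁, eHomEquiv_comp_eHomWhiskerLeft]
    rfl
  · rw [γ₁, H₁]
    rfl
  · simp
  · simp

/-- The map `m` satisfies the same hypotheses as `k`, so the construction iterates once more to `n`;
two-out-of-six applies to `n`, `m`, `k`. -/
lemma equivalences_fibreEnd (hK : IsInfinityCosmos K I) (p : IsofibArrow I)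
    (k : p.obj.left ⟶ p.obj.left) (hk : k ≫ p.obj.hom = p.obj.hom) (h : Homotopic k (𝟙 _)) :
    equivalences (IsofibArrow I) (fibreEnd p k hk) := by
  have hK₂ := isInfinityCosmos hK
  obtain ⟨m, hm, hm', h₁⟩ := exists_homotopic_fibreEnd_comp hK p k hk h
  obtain ⟨n, hn, hn', h₂⟩ := exists_homotopic_fibreEnd_comp hK p m hm hm'
  exact (hK₂.equivalences_of_comp_of_comp (hK₂.equivalences_of_homotopic_id h₂)
    (hK₂.equivalences_of_homotopic_id h₁)).2

/-- Lifting the codomain homotopy along `p` deforms `s` to a square that is the identity on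
codomains, where `equivalences_fibreEnd` applies. -/
lemma equivalences_of_components_homotopic_id (hK : IsInfinityCosmos K I) {p : IsofibArrow I}
    (s : p ⟶ p) (h₀ : Homotopic s.hom.left (𝟙 _)) (h₁ : Homotopic s.hom.right (𝟙 _)) :
    equivalences (IsofibArrow I) s := by
  obtain ⟨Λ, Λ₀, Λ₁⟩ := h₁
  obtain ⟨k, Ψ, Ψ₀, Ψ₁, hΨ⟩ := hK.exists_path_lift p.property s.hom.left
    (Λ ≫ eHomWhiskerRight SSet.{v} p.obj.hom p.obj.right)
    (by rw [reassoc_of% Λ₀, eHomEquiv_comp_eHomWhiskerRight]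
        exact congrArg _ (Arrow.w s.hom).symm)
  have hk : k ≫ p.obj.hom = p.obj.hom := (eHomEquiv SSet.{v}).injective (by
    rw [← eHomEquiv_comp_eHomWhiskerLeft, ← Ψ₁, Category.assoc, hΨ, reassoc_of% Λ₁,
      eHomEquiv_comp_eHomWhiskerRight, Category.comp_id])
  have hsk : Homotopic s (fibreEnd p k hk) := homotopic_of_components Ψ Λ hΨ Ψ₀ Ψ₁ Λ₀ Λ₁
  exact (isInfinityCosmos hK).equivalences_of_homotopic
    ((isInfinityCosmos hK).homotopic_symm hsk)
    (equivalences_fibreEnd hK p k hk (hK.homotopic_of_homotopic ⟨Ψ, Ψ₀, Ψ₁⟩ h₀))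

/-- Componentwise inverses commute with `p` and `q` only up to homotopy. Lifting that homotopy along
`p` replaces `g` by `g'`, giving a strict square `r`. Both composites with `s` have components
homotopic to identities, so two-out-of-six applies to `s`, `r`, `s`. -/
theorem equivalences_iff (hK : IsInfinityCosmos K I) {p q : IsofibArrow I} (s : p ⟶ q) :
    equivalences (IsofibArrow I) s ↔
      equivalences K s.hom.left ∧ equivalences K s.hom.right := by
  have hK₂ := isInfinityCosmos hK
  constructor
  · intro h
    obtain ⟨r, h₀, h₁⟩ := (hK₂.equivalences_iff_exists s).1 h
    exact ⟨(hK.equivalences_iff_exists _).2 ⟨r.hom.left, (homotopic_components h₀).1,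
        (homotopic_components h₁).1⟩,
      (hK.equivalences_iff_exists _).2 ⟨r.hom.right, (homotopic_components h₀).2,
        (homotopic_components h₁).2⟩⟩
  · rintro ⟨h₀, h₁⟩
    obtain ⟨g, hg₀, hg₁⟩ := (hK.equivalences_iff_exists _).1 h₀
    obtain ⟨f, hf₀, hf₁⟩ := (hK.equivalences_iff_exists _).1 h₁
    have w : s.hom.left ≫ q.obj.hom = p.obj.hom ≫ s.hom.right := Arrow.w s.hom
    have key : Homotopic (g ≫ p.obj.hom) (q.obj.hom ≫ f) := by
      have k₁ := (hf₀.comp_left p.obj.hom).comp_left g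
      have k₂ := (hg₁.comp_right q.obj.hom).comp_right f
      rw [Category.comp_id, ← reassoc_of% w] at k₁
      rw [Category.id_comp, Category.assoc, Category.assoc] at k₂
      exact hK.homotopic_trans k₁ k₂
    obtain ⟨g', hgg', hg'⟩ := hK.exists_lift_of_homotopic p.property key
    let r : q ⟶ p := ObjectProperty.homMk (Arrow.homMk g' f hg')
    have e₁ : equivalences (IsofibArrow I) (s ≫ r) :=
      equivalences_of_components_homotopic_id hK (s ≫ r)
        (hK.homotopic_symm (hK.homotopic_trans hg₀ (hgg'.comp_left s.hom.left)))
        (hK.homotopic_symm hf₀)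
    have e₂ : equivalences (IsofibArrow I) (r ≫ s) :=
      equivalences_of_components_homotopic_id hK (r ≫ s)
        (hK.homotopic_of_homotopic (hgg'.comp_right s.hom.left) hg₁) hf₁
    exact (hK₂.equivalences_of_comp_of_comp e₁ e₂).2

/-- The domain component is the gap map followed by a pullback of the trivial fibration `s.right`,
so by two-out-of-three it is an equivalence exactly when the gap map is. -/
theorem trivialFibrations_iff (hK : IsInfinityCosmos K I) {p q : IsofibArrow I} (s : p ⟶ q) :
    trivialFibrations (reedyIsofibrations I) s ↔ reedy (trivialFibrations I) s.hom := by
  have := hK.hasTwoOutOfThreeProperty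
  have := hK.trivialFibrations_isStableUnderBaseChange
  have key {P : K} {fst : P ⟶ p.obj.right} {snd : P ⟶ q.obj.left}
      (h : IsPullback fst snd s.hom.right q.obj.hom) (l : p.obj.left ⟶ P)
      (hl : l ≫ snd = s.hom.left) (hs : trivialFibrations I s.hom.right) :
      equivalences K l ↔ equivalences K s.hom.left := by
    rw [← hl]
    exact ⟨fun h' => (equivalences K).comp_mem _ _ h' (snd_mem h hs).2,
      (equivalences K).of_postcomp _ _ (snd_mem h hs).2⟩
  constructor
  · rintro ⟨⟨h₁, P, fst, snd, h, hl⟩, hs⟩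
    rw [equivalences_iff hK] at hs
    exact ⟨⟨h₁, hs.2⟩, P, fst, snd, h, hl, (key h _ (h.lift_snd _ _ _) ⟨h₁, hs.2⟩).2 hs.1⟩
  · rintro ⟨h₁, P, fst, snd, h, hl⟩
    exact ⟨⟨h₁.1, P, fst, snd, h, hl.1⟩, (equivalences_iff hK s).2
      ⟨(key h _ (h.lift_snd _ _ _) h₁).1 hl.2, h₁.2⟩⟩

lemma isofibration_left (hK : IsInfinityCosmos K I) {p q : IsofibArrow I} {s : p ⟶ q}
    (hs : reedyIsofibrations I s) : I s.hom.left := by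
  have := hK.isofibration_pullback
  have := hK.isMultiplicative
  exact left_mem_of_reedy hs

end IsofibArrow

end InfCosmos

/-! ### The theorem -/

theorem mainTheorem11 {K : Type u} [Category.{v} K] [SimplicialCategory K]
    (I : MorphismProperty K) (hK : InfCosmos.IsInfinityCosmos K I) :
    -- isofibrations and squares form an `∞`-cosmos, with the Reedy isofibrations
    InfCosmos.IsInfinityCosmos (InfCosmos.IsofibArrow I) (InfCosmos.reedyIsofibrations I) ∧
    -- description of the equivalences
    (∀ {p q : InfCosmos.IsofibArrow I} (s : p ⟶ q),
      InfCosmos.equivalences (InfCosmos.IsofibArrow I) s ↔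
        InfCosmos.equivalences K s.hom.left ∧ InfCosmos.equivalences K s.hom.right) ∧
    -- description of the trivial fibrations
    (∀ {p q : InfCosmos.IsofibArrow I} (s : p ⟶ q),
      InfCosmos.trivialFibrations (InfCosmos.reedyIsofibrations I) s ↔
        InfCosmos.reedy (InfCosmos.trivialFibrations I) s.hom) ∧
    -- the domain component is then an isofibration or a trivial fibration, respectively
    (∀ {p q : InfCosmos.IsofibArrow I} (s : p ⟶ q),
      (InfCosmos.reedyIsofibrations I s → I s.hom.left) ∧
      (InfCosmos.trivialFibrations (InfCosmos.reedyIsofibrations I) s →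
        InfCosmos.trivialFibrations I s.hom.left)) ∧
    -- terminal object
    (∀ F : Discrete PEmpty.{1} ⥤ InfCosmos.IsofibArrow I,
      InfCosmos.IsJointlyCreated I F ∧ InfCosmos.IsClosedUnderLimitInArrows I F ∅) ∧
    -- small products
    (∀ (J : Type v) (F : Discrete J ⥤ InfCosmos.IsofibArrow I),
      InfCosmos.IsJointlyCreated I F ∧ InfCosmos.IsClosedUnderLimitInArrows I F ∅) ∧
    -- limits of towers of isofibrations
    (∀ F : ℕᵒᵖ ⥤ InfCosmos.IsofibArrow I,
      InfCosmos.IsTower (InfCosmos.reedyIsofibrations I) F →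
        InfCosmos.IsJointlyCreated I F ∧
          InfCosmos.IsClosedUnderLimitInArrows I F Set.univ) ∧
    -- pullbacks of isofibrations
    (∀ F : WalkingCospan ⥤ InfCosmos.IsofibArrow I,
      InfCosmos.reedyIsofibrations I (F.map WalkingCospan.Hom.inr) →
        InfCosmos.IsJointlyCreated I F ∧
          InfCosmos.IsClosedUnderLimitInArrows I F {WalkingCospan.left}) ∧
    -- cotensors
    (∀ (U : SSet.{v}) (p : InfCosmos.IsofibArrow I),
      InfCosmos.IsCotensorJointlyCreated I U p) := by
  refine ⟨InfCosmos.IsofibArrow.isInfinityCosmos hK,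
    fun s => InfCosmos.IsofibArrow.equivalences_iff hK s,
    fun s => InfCosmos.IsofibArrow.trivialFibrations_iff hK s,
    fun s => ⟨InfCosmos.IsofibArrow.isofibration_left hK, fun hs =>
      ⟨InfCosmos.IsofibArrow.isofibration_left hK hs.1,
        ((InfCosmos.IsofibArrow.equivalences_iff hK s).1 hs.2).1⟩⟩,
    fun F => ?_, fun J F => ?_, fun F hF => ?_, fun F hF => ?_,
    InfCosmos.IsofibArrow.isCotensorJointlyCreated hK⟩
  · have h := hK.hasPointwiseLimit_of_isEmpty F
    exact ⟨h.isJointlyCreated, h.isClosedUnderLimitInArrows fun _ _ _ _ hj => hj.elim⟩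
  · have h := hK.hasPointwiseLimit_product F
    exact ⟨h.isJointlyCreated, h.isClosedUnderLimitInArrows fun _ _ _ _ hj => hj.elim⟩
  · obtain ⟨h, h'⟩ := hK.hasPointwiseLimit_tower F hF
    exact ⟨h.isJointlyCreated, h.isClosedUnderLimitInArrows fun c h₀ h₁ j _ => h' c h₀ h₁ j⟩
  · obtain ⟨h, h'⟩ := hK.hasPointwiseLimit_pullback F hF
    refine ⟨h.isJointlyCreated, h.isClosedUnderLimitInArrows fun c h₀ h₁ j hj => ?_⟩
    obtain rfl := Set.mem_singleton_iff.1 hj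
    exact h' c h₀ h₁
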